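/- **Setting.** Let $\mathfrak g$ be of type $A_n^{(1)}$ $(n\ge1)$, $B_n^{(1)}$ $(n\ge3)$, $C_n^{(1)}$ $(n\ge2)$, $A_{2n-1}^{(2)}$ $(n\ge3)$, $A_{2n}^{(2)}$ $(n\ge1)$ or $D_{n+1}^{(2)}$ $(n\ge2)$, with $I=\{0,\dots,n\}$, generalized Cartan matrix $(a_{ij})$, $a_{ij}=\langle h_i,\alpha_j\rangle$, and classical weight lattice $\bar P=\bigoplus_{i\in I}\mathbb Z\Lambda_i$ (in which $\alpha_i=\sum_j a_{ji}\Lambda_j$). For $A_{2n}^{(2)}$ we have $a_{01}=-2$, $a_{10}=-1$, $a_{n-1,n}=-2$, $a_{n,n-1}=-1$ if $n\geq 2$, and $a_{01}=-4$, $a_{10}=-1$ if $n=1$. Let $l\ge1$. A $U_q'(\mathfrak g)$-crystal is a set $B$ with maps $\overline{\mathrm{wt}}:B\to\bar P$, $\varepsilon_i,\varphi_i:B\to\mathbb Z\cup\{-\infty\}$, $\tilde e_i,\tilde f_i:B\to B\cup\{0\}$ $(i\in I)$ such that: $\varphi_i(b)=\varepsilon_i(b)+\langle h_i,\overline{\mathrm{wt}}(b)\rangle$;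 $\tilde e_i$ (resp. $\tilde f_i$), where nonzero, changes $\overline{\mathrm{wt}},\varepsilon_i,\varphi_i$ by $\alpha_i,-1,+1$ (resp. $-\alpha_i,+1,-1$); $\tilde f_ib=b'\iff \tilde e_ib'=b$; and $\tilde e_ib=\tilde f_ib=0$ if $\varepsilon_i(b)=-\infty$. An isomorphism of crystals is a bijection preserving $\overline{\mathrm{wt}},\varepsilon_i,\varphi_i$ and commuting with all $\tilde e_i,\tilde f_i$ (with $0\mapsto0$). **The perfect crystals $B^{l}$.** All coordinates are non-negative integers, and $(x)_+=\max(0,x)$. * $A_n^{(1)}$: $(x_0,\dots,x_n)$ with $\sum x_i=l$. * $B_n^{(1)}$ (resp. $D_{n+1}^{(2)}$): $(x_1,\dots,x_n|x_0|\bar x_n,\dots,\bar x_1)$ with $x_0\in\{0,1\}$ and $s=l$ (resp. $s\le l$). * $A_{2n-1}^{(2)}$ (resp. $A_{2n}^{(2)}$; $C_n^{(1)}$): $(x_1,\dots,x_n|\bar x_n,\dots,\bar x_1)$ with $s=l$ (resp. $s\le l$; $s\le 2l$ and $s$ even). Here $s$ denotes the sum of all coordinates. The maps are as follows; a result outside $B^l$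 is read as $0$. * $A_n^{(1)}$ (indices modulo $n+1$): $\tilde f_i$ is $x_{i-1}\mapsto x_{i-1}-1,\ x_i\mapsto x_i+1$; $\tilde e_i$ is $x_i\mapsto x_i-1,\ x_{i-1}\mapsto x_{i-1}+1$; $\varphi_i=x_{i-1}$, $\varepsilon_i=x_i$. * All other types, $1\le i\le n-1$: $\tilde f_i$ is $x_i-1,\ x_{i+1}+1$ if $x_{i+1}\ge\bar x_{i+1}$, and $\bar x_{i+1}-1,\ \bar x_i+1$ otherwise; $\tilde e_i$ is $x_i+1,\ x_{i+1}-1$ if $x_{i+1}>\bar x_{i+1}$, and $\bar x_{i+1}+1,\ \bar x_i-1$ otherwise; $\varphi_i=x_i+(\bar x_{i+1}-x_{i+1})_+$, $\varepsilon_i=\bar x_i+(x_{i+1}-\bar x_{i+1})_+$. * $i=n$ for $B_n^{(1)},D_{n+1}^{(2)}$: $\tilde f_n$ is $x_n-1,\ x_0+1$ if $x_0=0$, and $x_0-1,\ \bar x_n+1$ if $x_0=1$; $\tilde e_n$ is $x_n+1,\ x_0-1$ if $x_0=1$, and $x_0+1,\ \bar x_n-1$ if $x_0=0$; $\varphi_n=2x_n+x_0$,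 $\varepsilon_n=2\bar x_n+x_0$. * $i=n$ for $C_n^{(1)},A_{2n-1}^{(2)},A_{2n}^{(2)}$: $\tilde f_n$ is $x_n-1,\ \bar x_n+1$; $\tilde e_n$ is $x_n+1,\ \bar x_n-1$; $\varphi_n=x_n$, $\varepsilon_n=\bar x_n$. * $i=0$ for $B_n^{(1)},A_{2n-1}^{(2)}$: $\tilde f_0$ is $x_2+1,\ \bar x_1-1$ if $x_2\ge\bar x_2$, and $x_1+1,\ \bar x_2-1$ otherwise; $\tilde e_0$ is $x_2-1,\ \bar x_1+1$ if $x_2>\bar x_2$, and $x_1-1,\ \bar x_2+1$ otherwise; $\varphi_0=\bar x_1+(\bar x_2-x_2)_+$, $\varepsilon_0=x_1+(x_2-\bar x_2)_+$. * $i=0$ for $A_{2n}^{(2)},D_{n+1}^{(2)}$: $\tilde f_0$ is $x_1+1$ if $x_1\ge\bar x_1$, and $\bar x_1-1$ otherwise; $\tilde e_0$ is $x_1-1$ if $x_1>\bar x_1$, and $\bar x_1+1$ otherwise; $\varphi_0=l-s+2(\bar x_1-x_1)_+$, $\varepsilon_0=l-s+2(x_1-\bar x_1)_+$. * $i=0$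 for $C_n^{(1)}$: $\tilde f_0$ is $x_1+2$ if $x_1\ge\bar x_1$; $x_1+1,\ \bar x_1-1$ if $x_1=\bar x_1-1$; $\bar x_1-2$ if $x_1\le\bar x_1-2$. $\tilde e_0$ is $x_1-2$ if $x_1\ge\bar x_1+2$; $x_1-1,\ \bar x_1+1$ if $x_1=\bar x_1+1$; $\bar x_1+2$ if $x_1\le\bar x_1$. $\varphi_0=l-\frac s2+(\bar x_1-x_1)_+$, $\varepsilon_0=l-\frac s2+(x_1-\bar x_1)_+$. In all cases $\overline{\mathrm{wt}}=\sum_i(\varphi_i-\varepsilon_i)\Lambda_i$. **Slices.** Blocks, each carrying a color in $I$, are stacked in a column of unit depth. Read upwards from the ground, the rows repeat the following cycle: $$\begin{aligned} A_n^{(1)}&:\ c,c+1,\dots,n,0,\dots,c-1\quad(\text{for a fixed } c\in I),\\ B_n^{(1)},A_{2n-1}^{(2)}&:\ (01),2,\dots,n-1,n,n,n-1,\dots,2,\\ C_n^{(1)},A_{2n}^{(2)}&:\ 0,0,1,\dots,n-1,n,n-1,\dots,1,\\ D_{n+1}^{(2)}&:\ 0,0,1,\dots,n-1,n,n,n-1,\dots,1.\end{aligned}$$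 The row $(01)$ is a unit cube (a $01$-block) made of a $0$-block and a $1$-block of half-unit depth, one in front of the other (which one is in front is fixed by the pattern); every other row is one block of full depth. The blocks from the second $0$ (for $B_n^{(1)},A_{2n-1}^{(2)}$: from $(01)$) up to the first $n$ of a cycle are *supporting*; those from the last $n$ of a cycle up to the first $0$ (resp. to $(01)$) of the next cycle are *covering*; the first row $0$ (resp. $(01)$) of every cycle is covering. Blocks occurring once in a cycle (all blocks for $A_n^{(1)}$) are both. A *level-$1$ slice* (level-$\frac12$ slice for $C_n^{(1)}$) is a finite stack of blocks following the pattern, with no block on top of a column of half-unit depth. An *$i$-slot* is a place on top of a column where an $i$-block may be added; it is supporting or covering as the block fitting there. The height of a top block or slot is that of its row. Adding a $\delta$-column (one full cycle) to $c$ gives $c+\delta$. Put $L=2l$ for $C_n^{(1)}$ and $L=l$ otherwise. For a fixed pattern, a *level-$l$ slice* is a tuple $C=(c_1,\dots,c_L)$ of such columns (the *layers*, $c_1$ in front) with $c_1\subset c_2\subset\cdots\subset c_L\subset c_1+\delta$ and, in addition: for $A_{2n-1}^{(2)}$ (resp. $C_n^{(1)}$) the total number of $n$-blocks (resp. $0$-blocks)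 is even; for $D_{n+1}^{(2)}$ at most one layer has a supporting $n$-block on top. Let $C+\delta=(c_2,\dots,c_L,c_1+\delta)$, let $C\sim C'$ if one of $C,C'$ is obtained from the other by adding finitely many $\delta$'s, and let $\mathcal C^{(l)}$ be the set of equivalence classes of level-$l$ slices. **Splitting.** Let $k$ be a color or $k=01$. For $B_n^{(1)},A_{2n-1}^{(2)}$, to split a $k$-block one needs a layer with a supporting $k$-block on top and a layer with a covering $k$-slot on top; the top half of the block is broken off and placed in the slot. For $C_n^{(1)},A_{2n}^{(2)},D_{n+1}^{(2)}$, exchange "supporting" and "covering". Choose the block in the fore-front layer (smallest index) among those with the highest height, and the slot in the very back layer (largest index) among those with the lowest height. A top consisting of a broken half counts neither as a block nor as a slot. The *$k$-split form* is the result of all possible splittings of $k$-blocks. **Kashiwara operators.** For $i\in I$ let $C'$ be as follows. $A_n^{(1)}$: $C'=C$. $B_n^{(1)},A_{2n-1}^{(2)}$: $C'=C$ for $i=0,1$; the $01$-split form of $C$ for $i=2$; the $(i-1)$-split form of $C$ for $i\ge3$. $C_n^{(1)},A_{2n}^{(2)},D_{n+1}^{(2)}$: the $(i+1)$-split form of $C$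 for $i\ne n$; $C'=C$ for $i=n$. Call covering blocks and supporting slots *preferred* for $A_n^{(1)},B_n^{(1)},A_{2n-1}^{(2)}$; call supporting blocks and covering slots preferred for $C_n^{(1)},A_{2n}^{(2)},D_{n+1}^{(2)}$. * *One-block rule* (all cases but those below). If no layer of $C'$ has an $i$-block on top, $\tilde e_iC=0$. Otherwise consider the layers of $C'$ with a preferred $i$-block on top or, if there are none, all layers with an $i$-block on top; among those with the highest height, remove the $i$-block from the fore-front layer. If no layer of $C'$ has an $i$-slot, $\tilde f_iC=0$. Otherwise consider the layers of $C'$ with a preferred $i$-slot or, if there are none, all layers with an $i$-slot; among those with the lowest height, add an $i$-block to the very back layer. * *Two-block rule* ($i=n$ for $A_{2n-1}^{(2)}$, $i=0$ for $C_n^{(1)}$). If no layer of $C'$ has an $i$-block on top, $\tilde e_iC=0$. If exactly one layer has a preferred $i$-block on top, remove it, and then remove an $i$-block from the fore-front layer of highest height among the layers which now have a non-preferred $i$-block on top. Otherwise, among the layers with a preferred $i$-block on top (if there are none: among all layers with an $i$-block on top) take the fore-front layer of highest height and then the fore-front layer of highest height among the remaining ones, and remove one $i$-block from each. $\tilde f_i$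 is defined in the same way, adding blocks in $i$-slots, with "very back" and "lowest" in place of "fore-front" and "highest". The halves broken off are put back after the action. These operators induce operators on $\mathcal C^{(l)}$, computed on representatives all of whose layers contain a full $\delta$-column. On $\mathcal C^{(l)}$ put $\varepsilon_i(C)=\max\{k\mid\tilde e_i^kC\ne0\}$, $\varphi_i(C)=\max\{k\mid\tilde f_i^kC\neq0\}$, $\overline{\mathrm{wt}}(C)=\sum_i(\varphi_i(C)-\varepsilon_i(C))\Lambda_i$. **The canonical map.** Describe a layer by its top: * $A_n^{(1)}$: $\mathbf u_i$ ($i\in I$): an $i$-block. * $C_n^{(1)},A_{2n}^{(2)},D_{n+1}^{(2)}$: $\mathbf w_0$: a covering $0$-block; $\mathbf u_i$ ($1\le i\le n$): a supporting $(i-1)$-block; $\mathbf v_i$ ($1\le i\le n$): a covering $i$-block; and for $D_{n+1}^{(2)}$, $\mathbf u_0$: a supporting $n$-block. * $B_n^{(1)},A_{2n-1}^{(2)}$: $\mathbf u_1$ (resp. $\mathbf v_1$): a $0$-block (resp. $1$-block) of half-unit depth alone in its row; $\mathbf u_2$: a $01$-block; $\mathbf u_i$ ($3\le i\le n$): a supporting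 $(i-1)$-block; $\mathbf v_i$ ($2\le i\le n$): a covering $i$-block; $\mathbf u_0$: a supporting $n$-block. For $b\in B^l$ let $\psi(b)\in\mathcal C^{(l)}$ be the class of a level-$l$ slice having * for $A_n^{(1)}$: $x_i$ layers $\mathbf u_i$ for each $i\in I$; * for $C_n^{(1)},A_{2n}^{(2)},D_{n+1}^{(2)}$: $x_i$ layers $\mathbf u_i$ and $\bar x_i$ layers $\mathbf v_i$ for $1\le i\le n$, $L-s$ layers $\mathbf w_0$, and for $D_{n+1}^{(2)}$ also $x_0$ layers $\mathbf u_0$; * for $B_n^{(1)},A_{2n-1}^{(2)}$: $(x_i-\bar x_i)_++\min\{x_{i-1},\bar x_{i-1}\}$ layers $\mathbf u_i$ and $(\bar x_i-x_i)_++\min\{x_{i-1},\bar x_{i-1}\}$ layers $\mathbf v_i$ for $1\le i\le n$ (the minimum is omitted for $i=1$), and $x_0+2\min\{x_n,\bar x_n\}$ layers $\mathbf u_0$ (with $x_0=0$ for $A_{2n-1}^{(2)}$). **Theorem.** In each of the six types, for every $l\ge1$ and every stacking pattern, $B^l$ is a $U_q'(\mathfrak g)$-crystal; the operators $\tilde e_i,\tilde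 f_i$ on $\mathcal C^{(l)}$ are well defined and make $\mathcal C^{(l)}$ a $U_q'(\mathfrak g)$-crystal; the map $\psi$ is well defined (for every $b$ a slice as prescribed exists, and all such slices are related); and $\psi:B^l\to\mathcal C^{(l)}$ is an isomorphism of $U_q'(\mathfrak g)$-crystals. -/

import Mathlib

/-!
# Classical crystals, coherent families of perfect crystals, and slices

Index set `I = {0, …, n}` is `Fin (n + 1)`.  The zero element `0` adjoined to a crystal is `none`.
-/

namespace YoungSlice

/-- The six families `A_n^(1)`, `B_n^(1)`, `C_n^(1)`, `A_{2n-1}^(2)`, `A_{2n}^(2)`, `D_{n+1}^(2)`. -/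
inductive AffineType
  | A1
  | B1
  | C1
  | A2odd
  | A2even
  | D2

/-- The smallest admissible `n` in each family. -/
def minRank : AffineType → ℕ
  | .A1 => 1
  | .B1 => 3
  | .C1 => 2
  | .A2odd => 3
  | .A2even => 1
  | .D2 => 2

/-! ## Cartan matrices and classical crystals -/

/-- The affine generalized Cartan matrix `(a_{ij})`, `a_{ij} = ⟨h_i, α_j⟩`. -/
def cartan (t : AffineType) (n : ℕ) : Matrix (Fin (n + 1)) (Fin (n + 1)) ℤ := fun i' j' =>
  let i : ℕ := i'
  let j : ℕ := j'
  let linear : Prop := i + 1 = j ∨ j + 1 = i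
  let fork : Prop := (i = 0 ∧ j = 2) ∨ (i = 2 ∧ j = 0) ∨ (0 < i ∧ 0 < j ∧ linear)
  if i = j then 2 else
  match t with
  | .A1 =>
      if n = 1 then -2
      else if (i + 1) % (n + 1) = j ∨ (j + 1) % (n + 1) = i then -1 else 0
  | .B1 => if fork then (if i = n ∧ j + 1 = n then -2 else -1) else 0
  | .A2odd => if fork then (if i + 1 = n ∧ j = n then -2 else -1) else 0
  | .C1 => if linear then (if (i = 1 ∧ j = 0) ∨ (i + 1 = n ∧ j = n) then -2 else -1) else 0
  | .A2even =>
      if linear then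
        (if n = 1 ∧ i = 0 then -4
         else if n ≠ 1 ∧ ((i = 0 ∧ j = 1) ∨ (i + 1 = n ∧ j = n)) then -2 else -1)
      else 0
  | .D2 => if linear then (if (i = 0 ∧ j = 1) ∨ (i = n ∧ j + 1 = n) then -2 else -1) else 0

/-- The maps carried by a classical crystal with underlying set `B`.  The weight lattice
`⊕ ℤ Λ_i` is `Fin (n + 1) → ℤ`, so that `⟨h_i, λ⟩ = λ i`. -/
structure CrystalData (n : ℕ) (B : Type) where
  wt : B → (Fin (n + 1) → ℤ)
  eps : Fin (n + 1) → B → WithBot ℤ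
  phi : Fin (n + 1) → B → WithBot ℤ
  e : Fin (n + 1) → B → Option B
  f : Fin (n + 1) → B → Option B

/-- The axioms of a classical crystal (a `U_q'(𝔤)`-crystal) for the Cartan matrix `A`. In the
classical weight lattice `α_i = ∑_j a_{ji} Λ_j`. -/
structure IsCrystal {n : ℕ} {B : Type} (A : Matrix (Fin (n + 1)) (Fin (n + 1)) ℤ)
    (K : CrystalData n B) : Prop where
  phi_eq : ∀ i b, K.phi i b = K.eps i b + ((K.wt b i : ℤ) : WithBot ℤ)
  wt_e : ∀ i b b', K.e i b = some b' → ∀ j, K.wt b' j = K.wt b j + A j i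
  wt_f : ∀ i b b', K.f i b = some b' → ∀ j, K.wt b' j = K.wt b j - A j i
  eps_e : ∀ i b b', K.e i b = some b' → K.eps i b = K.eps i b' + 1
  phi_e : ∀ i b b', K.e i b = some b' → K.phi i b' = K.phi i b + 1
  eps_f : ∀ i b b', K.f i b = some b' → K.eps i b' = K.eps i b + 1
  phi_f : ∀ i b b', K.f i b = some b' → K.phi i b = K.phi i b' + 1
  e_f : ∀ i b b', K.f i b = some b' ↔ K.e i b' = some b
  bot : ∀ i b, K.eps i b = ⊥ → K.e i b = none ∧ K.f i b = none

/-- An isomorphism of crystals: a bijection preserving `wt`, `ε_i`, `φ_i` and commuting with all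
Kashiwara operators (including where these are `0`), so that it and its inverse are morphisms. -/
structure IsCrystalIso {n : ℕ} {B₁ B₂ : Type} (K₁ : CrystalData n B₁) (K₂ : CrystalData n B₂)
    (ψ : B₁ → B₂) : Prop where
  bijective : Function.Bijective ψ
  wt : ∀ b, K₂.wt (ψ b) = K₁.wt b
  eps : ∀ i b, K₂.eps i (ψ b) = K₁.eps i b
  phi : ∀ i b, K₂.phi i (ψ b) = K₁.phi i b
  e : ∀ i b, K₂.e i (ψ b) = (K₁.e i b).map ψ
  f : ∀ i b, K₂.f i (ψ b) = (K₁.f i b).map ψ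

/-! ## The coherent family of perfect crystals -/

/-- Coordinates: `x i` is `x_i` and `xb i` is `x̄_i`.  For type `A_n^(1)` only `x_0, …, x_n` are used;
for the other types `x_1, …, x_n`, `x̄_1, …, x̄_n` and possibly `x_0`. Unused ones are `0`. -/
structure Coord (n : ℕ) where
  x : Fin (n + 1) → ℤ
  xb : Fin (n + 1) → ℤ

/-- `x_k`, indexed by natural numbers. -/
def Coord.X {n : ℕ} (b : Coord n) (k : ℕ) : ℤ := if h : k < n + 1 then b.x ⟨k, h⟩ else 0

/-- `x̄_k`, indexed by natural numbers. -/
def Coord.Xb {n : ℕ} (b : Coord n) (k : ℕ) : ℤ := if h : k < n + 1 then b.xb ⟨k, h⟩ else 0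

/-- Replace `x_k` by `x_k + d`. -/
def Coord.addX {n : ℕ} (b : Coord n) (k : ℕ) (d : ℤ) : Coord n :=
  { b with x := fun j => if j.val = k then b.x j + d else b.x j }

/-- Replace `x̄_k` by `x̄_k + d`. -/
def Coord.addXb {n : ℕ} (b : Coord n) (k : ℕ) (d : ℤ) : Coord n :=
  { b with xb := fun j => if j.val = k then b.xb j + d else b.xb j }

/-- The sum of all coordinates. -/
def Coord.total {n : ℕ} (b : Coord n) : ℤ := ∑ i, b.x i + ∑ i, b.xb i

/-- The conditions on the sum of the coordinates and on the coordinates not in use. -/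
def Coord.Shape (t : AffineType) {n : ℕ} (l : ℕ) (b : Coord n) : Prop :=
  match t with
  | .A1 => (∀ i, b.xb i = 0) ∧ b.total = l
  | .B1 => b.x 0 ≤ 1 ∧ b.total = l
  | .C1 => b.x 0 = 0 ∧ b.total ≤ 2 * l ∧ Even b.total
  | .A2odd => b.x 0 = 0 ∧ b.total = l
  | .A2even => b.x 0 = 0 ∧ b.total ≤ l
  | .D2 => b.x 0 ≤ 1 ∧ b.total ≤ l

instance (t : AffineType) {n : ℕ} (l : ℕ) (b : Coord n) : Decidable (b.Shape t l) := by
  unfold Coord.Shape; cases t <;> infer_instance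

/-- Membership of a coordinate vector in the level-`l` perfect crystal. -/
def Coord.Mem (t : AffineType) {n : ℕ} (l : ℕ) (b : Coord n) : Prop :=
  (∀ i, 0 ≤ b.x i) ∧ (∀ i, 0 ≤ b.xb i) ∧ b.xb 0 = 0 ∧ b.Shape t l

instance (t : AffineType) {n : ℕ} (l : ℕ) (b : Coord n) : Decidable (b.Mem t l) := by
  unfold Coord.Mem; infer_instance

/-- The underlying set of the level-`l` perfect crystal. -/
def Perfect (t : AffineType) (n l : ℕ) : Type := {b : Coord n // b.Mem t l}

/-- The result of `ẽ_i` before checking whether it lies in the crystal. -/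
def rawE (t : AffineType) {n : ℕ} (i : ℕ) (b : Coord n) : Coord n :=
  match t with
  | .A1 => (b.addX i (-1)).addX ((i + n) % (n + 1)) 1
  | _ =>
    if i = 0 then
      match t with
      | .C1 =>
          if b.X 1 ≥ b.Xb 1 + 2 then b.addX 1 (-2)
          else if b.X 1 = b.Xb 1 + 1 then (b.addX 1 (-1)).addXb 1 1
          else b.addXb 1 2
      | .A2even | .D2 => if b.X 1 > b.Xb 1 then b.addX 1 (-1) else b.addXb 1 1
      | _ => if b.X 2 > b.Xb 2 then (b.addX 2 (-1)).addXb 1 1 else (b.addX 1 (-1)).addXb 2 1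
    else if i = n then
      match t with
      | .B1 | .D2 => if b.X 0 = 1 then (b.addX n 1).addX 0 (-1) else (b.addX 0 1).addXb n (-1)
      | _ => (b.addX n 1).addXb n (-1)
    else
      if b.X (i + 1) > b.Xb (i + 1) then (b.addX i 1).addX (i + 1) (-1)
      else (b.addXb (i + 1) 1).addXb i (-1)

/-- The result of `f̃_i` before checking whether it lies in the crystal. -/
def rawF (t : AffineType) {n : ℕ} (i : ℕ) (b : Coord n) : Coord n :=
  match t with
  | .A1 => (b.addX i 1).addX ((i + n) % (n + 1)) (-1)
  | _ =>
    if i = 0 then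
      match t with
      | .C1 =>
          if b.X 1 ≥ b.Xb 1 then b.addX 1 2
          else if b.X 1 = b.Xb 1 - 1 then (b.addX 1 1).addXb 1 (-1)
          else b.addXb 1 (-2)
      | .A2even | .D2 => if b.X 1 ≥ b.Xb 1 then b.addX 1 1 else b.addXb 1 (-1)
      | _ => if b.X 2 ≥ b.Xb 2 then (b.addX 2 1).addXb 1 (-1) else (b.addX 1 1).addXb 2 (-1)
    else if i = n then
      match t with
      | .B1 | .D2 => if b.X 0 = 0 then (b.addX n (-1)).addX 0 1 else (b.addX 0 (-1)).addXb n 1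
      | _ => (b.addX n (-1)).addXb n 1
    else
      if b.X (i + 1) ≥ b.Xb (i + 1) then (b.addX i (-1)).addX (i + 1) 1
      else (b.addXb (i + 1) (-1)).addXb i 1

/-- `(a)_+ = max(0, a)`. -/
def pos (a : ℤ) : ℤ := max 0 a

/-- `ε_i` on the level-`l` perfect crystal. -/
def oldEps (t : AffineType) {n : ℕ} (l : ℕ) (i : ℕ) (b : Coord n) : ℤ :=
  match t with
  | .A1 => b.X i
  | _ =>
    if i = 0 then
      match t with
      | .C1 => l - b.total / 2 + pos (b.X 1 - b.Xb 1)
      | .A2even | .D2 => l - b.total + 2 * pos (b.X 1 - b.Xb 1)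
      | _ => b.X 1 + pos (b.X 2 - b.Xb 2)
    else if i = n then
      match t with
      | .B1 | .D2 => 2 * b.Xb n + b.X 0
      | _ => b.Xb n
    else b.Xb i + pos (b.X (i + 1) - b.Xb (i + 1))

/-- `φ_i` on the level-`l` perfect crystal. -/
def oldPhi (t : AffineType) {n : ℕ} (l : ℕ) (i : ℕ) (b : Coord n) : ℤ :=
  match t with
  | .A1 => b.X ((i + n) % (n + 1))
  | _ =>
    if i = 0 then
      match t with
      | .C1 => l - b.total / 2 + pos (b.Xb 1 - b.X 1)
      | .A2even | .D2 => l - b.total + 2 * pos (b.Xb 1 - b.X 1)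
      | _ => b.Xb 1 + pos (b.Xb 2 - b.X 2)
    else if i = n then
      match t with
      | .B1 | .D2 => 2 * b.X n + b.X 0
      | _ => b.X n
    else b.X i + pos (b.Xb (i + 1) - b.X (i + 1))

/-- A coordinate vector outside the crystal is read as `0`. -/
def toPerfect (t : AffineType) {n : ℕ} (l : ℕ) (b : Coord n) : Option (Perfect t n l) :=
  if h : b.Mem t l then some ⟨b, h⟩ else none

/-- The level-`l` perfect crystal of the coherent family. -/
def perfectCrystal (t : AffineType) (n l : ℕ) : CrystalData n (Perfect t n l) where
  wt b := fun i => oldPhi t l i b.1 - oldEps t l i b.1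
  eps i b := ((oldEps t l i b.1 : ℤ) : WithBot ℤ)
  phi i b := ((oldPhi t l i b.1 : ℤ) : WithBot ℤ)
  e i b := toPerfect t l (rawE t i b.1)
  f i b := toPerfect t l (rawF t i b.1)

/-! ## Stacking patterns -/

/-- One row of a stacking pattern: a single block of full depth, or a unit cube made of two blocks
of half-unit depth, one in front and one behind. -/
inductive Row
  | whole (color : ℕ)
  | pair (front back : ℕ)

def Row.isWhole : Row → ℕ → Bool
  | .whole j, i => j == i
  | .pair _ _, _ => false

def Row.isPair : Row → Bool
  | .whole _ => false
  | .pair _ _ => true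

/-- Color of the front (`false`) or back (`true`) block of a row of two blocks. -/
def Row.sideColor : Row → Bool → Option ℕ
  | .whole _, _ => none
  | .pair a _, false => some a
  | .pair _ b, true => some b

/-- Number of `i`-blocks in a row. -/
def Row.count (i : ℕ) : Row → ℕ
  | .whole j => if j = i then 1 else 0
  | .pair a b => (if a = i then 1 else 0) + (if b = i then 1 else 0)

/-- The possible stacking patterns: for `A_n^(1)` the color of the lowest block, for `B_n^(1)` and
`A_{2n-1}^(2)` whether the `0`-blocks are in front of the `1`-blocks, otherwise just one. -/
def Pattern : AffineType → ℕ → Type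
  | .A1, n => Fin (n + 1)
  | .B1, _ => Bool
  | .A2odd, _ => Bool
  | .C1, _ => Unit
  | .A2even, _ => Unit
  | .D2, _ => Unit

/-- Number of rows in one cycle of the stacking pattern (the rows of a `δ`-column). -/
def period : AffineType → ℕ → ℕ
  | .A1, n => n + 1
  | .B1, n => 2 * n - 1
  | .A2odd, n => 2 * n - 1
  | .C1, n => 2 * n + 1
  | .A2even, n => 2 * n + 1
  | .D2, n => 2 * n + 2

/-- The cycle `01, 2, …, n-1, n, n, n-1, …, 2` (read upwards from `r = 0`). -/
def forkRow (n : ℕ) (zeroInFront : Bool) (r : ℕ) : Row :=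
  if r = 0 then (if zeroInFront then .pair 0 1 else .pair 1 0)
  else if r + 1 < n then .whole (r + 1)
  else if r ≤ n then .whole n
  else .whole (2 * n - r)

/-- Row number `r` (counted upwards from the ground, starting with `0`) of the stacking pattern:
the cycles are `s, s+1, …, n, 0, …, s-1` for `A_n^(1)`; `01, 2, …, n-1, n, n, n-1, …, 2` for
`B_n^(1)`, `A_{2n-1}^(2)`; `0, 0, 1, …, n-1, n, n-1, …, 1` for `C_n^(1)`, `A_{2n}^(2)`;
`0, 0, 1, …, n-1, n, n, n-1, …, 1` for `D_{n+1}^(2)`. -/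
def row : (t : AffineType) → (n : ℕ) → Pattern t n → ℕ → Row
  | .A1, n, s, r => .whole ((Fin.val (n := n + 1) s + r) % (n + 1))
  | .B1, n, z, r => forkRow n z (r % (2 * n - 1))
  | .A2odd, n, z, r => forkRow n z (r % (2 * n - 1))
  | .C1, n, _, r =>
      let k := r % (2 * n + 1)
      .whole (if k ≤ 1 then 0 else if k ≤ n + 1 then k - 1 else 2 * n + 1 - k)
  | .A2even, n, _, r =>
      let k := r % (2 * n + 1)
      .whole (if k ≤ 1 then 0 else if k ≤ n + 1 then k - 1 else 2 * n + 1 - k)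
  | .D2, n, _, r =>
      let k := r % (2 * n + 2)
      .whole (if k ≤ 1 then 0 else if k ≤ n + 1 then k - 1 else 2 * n + 2 - k)

/-- Whether the blocks of row `r` are supporting blocks, i.e. lie on the way up to the next
`n`-block.  Blocks occurring once in a cycle (among them the `01`-cube) are both supporting and
covering. -/
def supporting (t : AffineType) (n r : ℕ) : Bool :=
  let k := r % period t n
  match t with
  | .A1 => true
  | .B1 | .A2odd => decide (k < n)
  | .C1 | .A2even | .D2 => decide (1 ≤ k ∧ k ≤ n + 1)

/-- Whether the blocks of row `r` are covering blocks. -/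
def covering (t : AffineType) (n r : ℕ) : Bool :=
  let k := r % period t n
  match t with
  | .A1 => true
  | .B1 | .A2odd => decide (k = 0 ∨ n ≤ k)
  | .C1 | .A2even => decide (k = 0 ∨ n + 1 ≤ k)
  | .D2 => decide (k = 0 ∨ n + 2 ≤ k)

/-! ## Columns: level-`1` (level-`1/2` for `C_n^(1)`) slices -/

/-- A stack of blocks in one column: the rows `0, …, full - 1` are completely filled, and possibly
the front (`some false`) or back (`some true`) block of row `full` is present. Nothing can lie on
top of a column of half-unit depth, so every level-`1` slice is of this form. -/
structure Column where
  full : ℕ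
  half : Option Bool

/-- A half-depth block can only be present in a row of two blocks. -/
def Column.Valid (t : AffineType) (n : ℕ) (p : Pattern t n) (c : Column) : Prop :=
  c.half = none ∨ (row t n p c.full).isPair = true

/-- Inclusion of sets of blocks. -/
def Column.Sub (c d : Column) : Prop :=
  c.full < d.full ∨ (c.full = d.full ∧ (c.half = none ∨ c.half = d.half))

/-- Addition of a `δ`-column. -/
def Column.addDelta (t : AffineType) (n : ℕ) (c : Column) : Column :=
  ⟨c.full + period t n, c.half⟩

/-- Number of `i`-blocks of a column. -/
def Column.count (t : AffineType) (n : ℕ) (p : Pattern t n) (i : ℕ) (c : Column) : ℕ :=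
  (∑ r ∈ Finset.range c.full, (row t n p r).count i) +
    match c.half with
    | none => 0
    | some s => if (row t n p c.full).sideColor s = some i then 1 else 0

/-- Removal of an `i`-block from the top of a column, `none` if its top is not an `i`-block. -/
def Column.remove (t : AffineType) (n : ℕ) (p : Pattern t n) (i : ℕ) (c : Column) :
    Option Column :=
  match c.half with
  | some s => if (row t n p c.full).sideColor s = some i then some ⟨c.full, none⟩ else none
  | none =>
    match c.full with
    | 0 => none
    | r + 1 =>
      match row t n p r with
      | .whole j => if j = i then some ⟨r, none⟩ else none
      | .pair a b =>
          if a = i then some ⟨r, some true⟩ else if b = i then some ⟨r, some false⟩ else none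

/-- Addition of an `i`-block to a column, `none` if its top is not an `i`-slot. -/
def Column.add (t : AffineType) (n : ℕ) (p : Pattern t n) (i : ℕ) (c : Column) :
    Option Column :=
  match c.half with
  | some s => if (row t n p c.full).sideColor (!s) = some i then some ⟨c.full + 1, none⟩ else none
  | none =>
    match row t n p c.full with
    | .whole j => if j = i then some ⟨c.full + 1, none⟩ else none
    | .pair a b =>
        if a = i then some ⟨c.full, some false⟩
        else if b = i then some ⟨c.full, some true⟩ else none

/-- The row of the top block(s) of a column. -/
def Column.topRow (c : Column) : ℕ := if c.half = none then c.full - 1 else c.full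

/-- The row of the slots of a column. -/
def Column.slotRow (c : Column) : ℕ := c.full

/-- The top of the column is a full-depth `i`-block in a row satisfying `side`. -/
def Column.topWhole (t : AffineType) (n : ℕ) (p : Pattern t n) (i : ℕ) (side : ℕ → Bool)
    (c : Column) : Bool :=
  c.half.isNone && decide (0 < c.full) && (row t n p (c.full - 1)).isWhole i && side (c.full - 1)

/-- The top of the column is a `01`-block (a complete row of two blocks). -/
def Column.topPair (t : AffineType) (n : ℕ) (p : Pattern t n) (c : Column) : Bool :=
  c.half.isNone && decide (0 < c.full) && (row t n p (c.full - 1)).isPair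

/-- The top of the column is an `i`-block of half-unit depth without its partner. -/
def Column.topHalf (t : AffineType) (n : ℕ) (p : Pattern t n) (i : ℕ) (c : Column) : Bool :=
  match c.half with
  | none => false
  | some s => decide ((row t n p c.full).sideColor s = some i)

/-! ## Slices -/

/-- Number of layers of a level-`l` slice. -/
def numLayers : AffineType → ℕ → ℕ
  | .C1, l => 2 * l
  | _, l => l

/-- The condition on slices that is special to the type. -/
def ExtraCondition (t : AffineType) (n : ℕ) (p : Pattern t n) {L : ℕ} (C : Fin L → Column) :
    Prop :=
  match t with
  | .A2odd => Even (∑ j, (C j).count .A2odd n p n)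
  | .C1 => Even (∑ j, (C j).count .C1 n p 0)
  | .D2 =>
      (Finset.univ.filter fun j => (C j).topWhole .D2 n p n (supporting .D2 n) = true).card ≤ 1
  | _ => True

/-- An ordered tuple of columns `c_1 ⊂ c_2 ⊂ ⋯ ⊂ c_L ⊂ c_1 + δ` satisfying the condition
special to the type. The layers `c_1, …, c_L` are numbered `0, …, L - 1` here. -/
def IsSlice (t : AffineType) (n : ℕ) (p : Pattern t n) {L : ℕ} (C : Fin L → Column) : Prop :=
  (∀ j, (C j).Valid t n p) ∧
  (∀ j k : Fin L, k.val = j.val + 1 → (C j).Sub (C k)) ∧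
  (∀ j k : Fin L, j.val + 1 = L → k.val = 0 → (C j).Sub ((C k).addDelta t n)) ∧
  ExtraCondition t n p C

/-- The set of level-`l` slices with stacking pattern `p`. -/
def Slice (t : AffineType) (n : ℕ) (p : Pattern t n) (l : ℕ) : Type :=
  {C : Fin (numLayers t l) → Column // IsSlice t n p C}

/-- `C + δ = (c_2, …, c_L, c_1 + δ)`. -/
def addDelta (t : AffineType) (n : ℕ) {L : ℕ} (C : Fin L → Column) : Fin L → Column := fun j =>
  if h : j.val + 1 < L then C ⟨j.val + 1, h⟩
  else (C ⟨0, Nat.lt_of_le_of_lt (Nat.zero_le _) j.isLt⟩).addDelta t n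

theorem addDelta_injective (t : AffineType) (n L : ℕ) :
    Function.Injective (addDelta t n (L := L)) := by
  intro C D h
  funext j
  by_cases hj : j.val = 0
  · have hL : 0 < L := Nat.lt_of_le_of_lt (Nat.zero_le _) j.isLt
    have h1 := congrFun h ⟨L - 1, by omega⟩
    have hn : ¬ (L - 1 + 1 < L) := by omega
    simp only [addDelta, hn, dite_false, Column.addDelta, Column.mk.injEq] at h1
    have hj' : j = ⟨0, hL⟩ := Fin.ext hj
    subst hj'
    rcases hC : C ⟨0, hL⟩ with ⟨a, b⟩
    rcases hD : D ⟨0, hL⟩ with ⟨a', b'⟩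
    simp only [hC, hD] at h1
    simp only [Column.mk.injEq]
    exact ⟨by omega, h1.2⟩
  · have h1 := congrFun h ⟨j.val - 1, by omega⟩
    have hj1 : j.val - 1 + 1 = j.val := by omega
    simpa [addDelta, hj1] using h1

/-- Two slices are related if one is obtained from the other by adding finitely many `δ`'s. -/
def Related {t : AffineType} {n : ℕ} {p : Pattern t n} {l : ℕ} (C D : Slice t n p l) : Prop :=
  ∃ k : ℕ, D.1 = (addDelta t n)^[k] C.1 ∨ C.1 = (addDelta t n)^[k] D.1

theorem related_trans {t : AffineType} {n : ℕ} {p : Pattern t n} {l : ℕ} {C D E : Slice t n p l}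
    (h₁ : Related C D) (h₂ : Related D E) : Related C E := by
  obtain ⟨a, ha⟩ := h₁
  obtain ⟨b, hb⟩ := h₂
  have inj := fun k => (addDelta_injective t n (numLayers t l)).iterate k
  have comp := fun (x y : ℕ) (F : Fin (numLayers t l) → Column) =>
    (Function.iterate_add_apply (addDelta t n) x y F).symm
  rcases ha with ha | ha <;> rcases hb with hb | hb
  · exact ⟨b + a, Or.inl (by rw [hb, ha, comp])⟩
  · rcases le_total a b with hab | hab
    · refine ⟨b - a, Or.inr (inj a ?_)⟩
      rw [← ha, hb, comp]; congr 2; omega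
    · refine ⟨a - b, Or.inl (inj b ?_)⟩
      rw [← hb, ha, comp]; congr 2; omega
  · rcases le_total a b with hab | hab
    · refine ⟨b - a, Or.inl ?_⟩
      rw [hb, ha, comp]; congr 2; omega
    · refine ⟨a - b, Or.inr ?_⟩
      rw [ha, hb, comp]; congr 2; omega
  · exact ⟨a + b, Or.inr (by rw [ha, hb, comp])⟩

instance sliceSetoid (t : AffineType) (n : ℕ) (p : Pattern t n) (l : ℕ) :
    Setoid (Slice t n p l) where
  r := Related
  iseqv :=
    { refl := fun _ => ⟨0, Or.inl rfl⟩
      symm := fun ⟨k, hk⟩ => ⟨k, hk.symm⟩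
      trans := related_trans }

/-- The set of equivalence classes of level-`l` slices. -/
def SliceClass (t : AffineType) (n : ℕ) (p : Pattern t n) (l : ℕ) : Type :=
  Quotient (sliceSetoid t n p l)

/-! ## Splitting of blocks -/

/-- Among the layers in `S`, the fore-front one among those of the highest height. -/
def frontHighest {L : ℕ} (S : Finset (Fin L)) (height : Fin L → ℕ) : Option (Fin L) :=
  let T := S.filter fun j => height j = S.sup height
  if h : T.Nonempty then some (T.min' h) else none

/-- Among the layers in `S`, the very back one among those of the lowest height. -/
def backLowest {L : ℕ} (S : Finset (Fin L)) (height : Fin L → ℕ) : Option (Fin L) :=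
  let T := S.filter fun j => ∀ k ∈ S, height j ≤ height k
  if h : T.Nonempty then some (T.max' h) else none

/-- Which blocks are to be split: none, the `01`-blocks, or the `k`-blocks. -/
inductive SplitIndex
  | nothing
  | cube01
  | block (k : ℕ)

/-- Whether a complete row is a block of the kind to be split. -/
def SplitIndex.matchRow : SplitIndex → Row → Bool
  | .nothing, _ => false
  | .cube01, R => R.isPair
  | .block k, R => R.isWhole k

/-- The blocks that are split for the action of `ẽ_i` and `f̃_i`. -/
def splitIndex (t : AffineType) (n i : ℕ) : SplitIndex :=
  match t with
  | .A1 => .nothing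
  | .B1 | .A2odd => if i ≤ 1 then .nothing else if i = 2 then .cube01 else .block (i - 1)
  | .C1 | .A2even | .D2 => if i = n then .nothing else .block (i + 1)

/-- The rows whose blocks may give away their top half: supporting for `B_n^(1)`, `A_{2n-1}^(2)`;
covering for `C_n^(1)`, `A_{2n}^(2)`, `D_{n+1}^(2)`. -/
def giver (t : AffineType) (n : ℕ) : ℕ → Bool :=
  match t with
  | .A1 | .B1 | .A2odd => supporting t n
  | .C1 | .A2even | .D2 => covering t n

/-- The rows whose slots may receive a broken half: covering for `B_n^(1)`, `A_{2n-1}^(2)`;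
supporting for `C_n^(1)`, `A_{2n}^(2)`, `D_{n+1}^(2)`. -/
def receiver (t : AffineType) (n : ℕ) : ℕ → Bool :=
  match t with
  | .A1 | .B1 | .A2odd => covering t n
  | .C1 | .A2even | .D2 => supporting t n

/-- One splitting. The state consists of the layers that have lost the top half of their top block
and the layers that carry a broken half on top; the tops of these layers are broken halves, hence
neither blocks nor slots.  If nothing can be split, the state is unchanged. -/
def splitStep (t : AffineType) (n : ℕ) (p : Pattern t n) (σ : SplitIndex) {L : ℕ}
    (C : Fin L → Column) (st : Finset (Fin L) × Finset (Fin L)) :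
    Finset (Fin L) × Finset (Fin L) :=
  let whole := Finset.univ.filter fun j => j ∉ st.1 ∧ j ∉ st.2 ∧ (C j).half = none
  let blocks := whole.filter fun j =>
    0 < (C j).full ∧ σ.matchRow (row t n p ((C j).full - 1)) = true ∧
      giver t n ((C j).full - 1) = true
  let slots := whole.filter fun j =>
    σ.matchRow (row t n p (C j).full) = true ∧ receiver t n (C j).full = true
  match frontHighest blocks (fun j => (C j).topRow), backLowest slots (fun j => (C j).slotRow) with
  | some j, some k => (insert j st.1, insert k st.2)
  | _, _ => st

/-- The layers whose top is not a broken half in the split form `C'` used for `ẽ_i`, `f̃_i`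
(every splitting uses up layers, so `L` steps perform all possible splittings). -/
def unbroken (t : AffineType) (n : ℕ) (p : Pattern t n) (i : ℕ) {L : ℕ} (C : Fin L → Column) :
    Finset (Fin L) :=
  let st := (splitStep t n p (splitIndex t n i) C)^[L] (∅, ∅)
  Finset.univ.filter fun j => j ∉ st.1 ∧ j ∉ st.2

/-! ## Kashiwara operators on slices -/

/-- The layers in `U` on which the move (adding or removing an `i`-block) is possible. -/
def movable {L : ℕ} (move : Column → Option Column) (U : Finset (Fin L)) (C : Fin L → Column) :
    Finset (Fin L) :=
  U.filter fun j => (move (C j)).isSome = true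

/-- Perform the move on layer `j`. -/
def moveAt {L : ℕ} (move : Column → Option Column) (C : Fin L → Column) (j : Fin L) :
    Fin L → Column :=
  Function.update C j ((move (C j)).getD (C j))

/-- The rule moving one block: if some of the movable layers lie in preferred rows, only these are
considered, otherwise all of them; then `pick` chooses the layer. -/
def actOnce {L : ℕ} (move : Column → Option Column) (height : Column → ℕ)
    (pick : Finset (Fin L) → (Fin L → ℕ) → Option (Fin L)) (preferred : ℕ → Bool)
    (U : Finset (Fin L)) (C : Fin L → Column) : Option (Fin L → Column) :=
  let S := movable move U C
  let P := S.filter fun j => preferred (height (C j)) = true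
  (pick (if P.Nonempty then P else S) fun j => height (C j)).map (moveAt move C)

/-- The rule moving two blocks.  If exactly one movable layer lies in a preferred row, the block is
moved there, and the second one is chosen in the result among the movable layers in the `other`
rows (possibly the same layer again).  Otherwise two distinct layers are chosen one after the other
among the layers in preferred rows, if there are any, or else among all movable layers. -/
def actTwice {L : ℕ} (move : Column → Option Column) (height : Column → ℕ)
    (pick : Finset (Fin L) → (Fin L → ℕ) → Option (Fin L)) (preferred other : ℕ → Bool)
    (U : Finset (Fin L)) (C : Fin L → Column) : Option (Fin L → Column) :=
  let S := movable move U C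
  let P := S.filter fun j => preferred (height (C j)) = true
  if P.card = 1 then
    (pick P fun j => height (C j)).bind fun j =>
      let C₁ := moveAt move C j
      let Q := (movable move U C₁).filter fun k => other (height (C₁ k)) = true
      (pick Q fun k => height (C₁ k)).map (moveAt move C₁)
  else
    let T := if P.Nonempty then P else S
    (pick T fun j => height (C j)).bind fun j =>
      (pick (T.erase j) fun k => height (C k)).map (moveAt move (moveAt move C j))

/-- The cases in which the Kashiwara operators move two blocks: `i = n` for `A_{2n-1}^(2)` and
`i = 0` for `C_n^(1)`. -/
def isDouble (t : AffineType) (n i : ℕ) : Bool :=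
  match t with
  | .A2odd => decide (i = n)
  | .C1 => decide (i = 0)
  | _ => false

/-- `ẽ_i` on slices. Preferred are covering blocks for `B_n^(1)`, `A_{2n-1}^(2)` and supporting
blocks for `C_n^(1)`, `A_{2n}^(2)`, `D_{n+1}^(2)`. -/
def sliceE (t : AffineType) (n : ℕ) (p : Pattern t n) (i : ℕ) {L : ℕ} (C : Fin L → Column) :
    Option (Fin L → Column) :=
  if isDouble t n i = true then
    actTwice (Column.remove t n p i) Column.topRow frontHighest (receiver t n) (giver t n)
      (unbroken t n p i C) C
  else
    actOnce (Column.remove t n p i) Column.topRow frontHighest (receiver t n)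
      (unbroken t n p i C) C

/-- `f̃_i` on slices. Preferred are supporting slots for `B_n^(1)`, `A_{2n-1}^(2)` and covering
slots for `C_n^(1)`, `A_{2n}^(2)`, `D_{n+1}^(2)`. -/
def sliceF (t : AffineType) (n : ℕ) (p : Pattern t n) (i : ℕ) {L : ℕ} (C : Fin L → Column) :
    Option (Fin L → Column) :=
  if isDouble t n i = true then
    actTwice (Column.add t n p i) Column.slotRow backLowest (giver t n) (receiver t n)
      (unbroken t n p i C) C
  else
    actOnce (Column.add t n p i) Column.slotRow backLowest (giver t n)
      (unbroken t n p i C) C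

/-! ## The crystal of equivalence classes of slices -/

/-- Every layer contains a full `δ`-column above the ground. Every class has such representatives;
on them the operators are not disturbed by the ground. -/
def Slice.Tall {t : AffineType} {n : ℕ} {p : Pattern t n} {l : ℕ} (C : Slice t n p l) : Prop :=
  ∀ j, period t n ≤ (C.1 j).full

open Classical in
/-- The operator induced on equivalence classes, computed on representatives away from the
ground. -/
noncomputable def classOp {t : AffineType} {n : ℕ} {p : Pattern t n} {l : ℕ}
    (op : (Fin (numLayers t l) → Column) → Option (Fin (numLayers t l) → Column))
    (X : SliceClass t n p l) : Option (SliceClass t n p l) :=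
  if h : ∃ D : Slice t n p l, ∃ C : Slice t n p l, C.Tall ∧ Quotient.mk _ C = X ∧ op C.1 = some D.1
  then some (Quotient.mk _ h.choose) else none

/-- `max {k | op^k X ≠ 0}`. -/
noncomputable def maxIterate {B : Type} (op : B → Option B) (X : B) : ℕ :=
  sSup {k : ℕ | ((fun Y : Option B => Y.bind op)^[k] (some X)).isSome = true}

/-- The crystal structure on the set of equivalence classes of level-`l` slices. -/
noncomputable def sliceCrystal (t : AffineType) (n : ℕ) (p : Pattern t n) (l : ℕ) :
    CrystalData n (SliceClass t n p l) where
  wt X := fun i => (maxIterate (classOp (sliceF t n p i)) X : ℤ) -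
    (maxIterate (classOp (sliceE t n p i)) X : ℤ)
  eps i X := (((maxIterate (classOp (sliceE t n p i)) X : ℕ) : ℤ) : WithBot ℤ)
  phi i X := (((maxIterate (classOp (sliceF t n p i)) X : ℕ) : ℤ) : WithBot ℤ)
  e i X := classOp (sliceE t n p i) X
  f i X := classOp (sliceF t n p i) X

/-- `opX`, an operator on classes, is induced by the operator `op` on slices: on slices away from
the ground `op` gives `0` or a slice again, and the class of the result is `opX` of the class. -/
def InducedBy {t : AffineType} {n : ℕ} {p : Pattern t n} {l : ℕ}
    (op : (Fin (numLayers t l) → Column) → Option (Fin (numLayers t l) → Column))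
    (opX : SliceClass t n p l → Option (SliceClass t n p l)) : Prop :=
  ∀ C : Slice t n p l, C.Tall →
    (op C.1 = none ∧ opX (Quotient.mk _ C) = none) ∨
    ∃ D : Slice t n p l, op C.1 = some D.1 ∧ opX (Quotient.mk _ C) = some (Quotient.mk _ D)

/-! ## The canonical map -/

/-- The elementary slices `𝐮_i`, `𝐯_i`, `𝐰_0`. -/
inductive Elementary (n : ℕ)
  | u (i : Fin (n + 1))
  | v (i : Fin (n + 1))
  | w

/-- Whether the top of a column is the given elementary slice.  (For `A_{2n-1}^(2)` the elementary
slice whose top is the supporting `n`-block is called `u 0`, as for `B_n^(1)`.) -/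
def Elementary.isTop (t : AffineType) (n : ℕ) (p : Pattern t n) (a : Elementary n) (c : Column) :
    Bool :=
  match t, p, a with
  | .A1, p, .u i => c.topWhole .A1 n p i (supporting .A1 n)
  | .A1, _, _ => false
  | .B1, p, .u i =>
      if i.val = 0 then c.topWhole .B1 n p n (supporting .B1 n)
      else if i.val = 1 then c.topHalf .B1 n p 0
      else if i.val = 2 then c.topPair .B1 n p
      else c.topWhole .B1 n p (i - 1) (supporting .B1 n)
  | .B1, p, .v i =>
      if i.val = 0 then false
      else if i.val = 1 then c.topHalf .B1 n p 1
      else c.topWhole .B1 n p i (covering .B1 n)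
  | .B1, _, .w => false
  | .A2odd, p, .u i =>
      if i.val = 0 then c.topWhole .A2odd n p n (supporting .A2odd n)
      else if i.val = 1 then c.topHalf .A2odd n p 0
      else if i.val = 2 then c.topPair .A2odd n p
      else c.topWhole .A2odd n p (i - 1) (supporting .A2odd n)
  | .A2odd, p, .v i =>
      if i.val = 0 then false
      else if i.val = 1 then c.topHalf .A2odd n p 1
      else c.topWhole .A2odd n p i (covering .A2odd n)
  | .A2odd, _, .w => false
  | .C1, p, .u i =>
      if i.val = 0 then false else c.topWhole .C1 n p (i - 1) (supporting .C1 n)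
  | .C1, p, .v i => if i.val = 0 then false else c.topWhole .C1 n p i (covering .C1 n)
  | .C1, p, .w => c.topWhole .C1 n p 0 (covering .C1 n)
  | .A2even, p, .u i =>
      if i.val = 0 then false else c.topWhole .A2even n p (i - 1) (supporting .A2even n)
  | .A2even, p, .v i => if i.val = 0 then false else c.topWhole .A2even n p i (covering .A2even n)
  | .A2even, p, .w => c.topWhole .A2even n p 0 (covering .A2even n)
  | .D2, p, .u i =>
      if i.val = 0 then c.topWhole .D2 n p n (supporting .D2 n)
      else c.topWhole .D2 n p (i - 1) (supporting .D2 n)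
  | .D2, p, .v i => if i.val = 0 then false else c.topWhole .D2 n p i (covering .D2 n)
  | .D2, p, .w => c.topWhole .D2 n p 0 (covering .D2 n)

/-- `min {x_k, x̄_k}` for `k ≥ 1`, and `0` for `k = 0`. -/
def Coord.overlap {n : ℕ} (b : Coord n) (k : ℕ) : ℤ := if k = 0 then 0 else min (b.X k) (b.Xb k)

/-- How many copies of each elementary slice are pasted together for the image of `b`. -/
def multiplicity (t : AffineType) {n : ℕ} (l : ℕ) (b : Coord n) (a : Elementary n) : ℤ :=
  match t with
  | .A1 =>
      match a with
      | .u i => b.X i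
      | _ => 0
  | .B1 | .A2odd =>
      match a with
      | .u i =>
          if i.val = 0 then b.X 0 + 2 * b.overlap n
          else pos (b.X i - b.Xb i) + b.overlap (i - 1)
      | .v i => if i.val = 0 then 0 else pos (b.Xb i - b.X i) + b.overlap (i - 1)
      | .w => 0
  | .C1 | .A2even | .D2 =>
      match a with
      | .u i => b.X i
      | .v i => b.Xb i
      | .w => numLayers t l - b.total

/-- The slice `C` is obtained by pasting together the elementary slices prescribed by `b`. -/
def Pastes {t : AffineType} {n : ℕ} {p : Pattern t n} {l : ℕ} (b : Perfect t n l)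
    (C : Slice t n p l) : Prop :=
  ∀ a : Elementary n,
    ((Finset.univ.filter fun j => a.isTop t n p (C.1 j) = true).card : ℤ) = multiplicity t l b.1 a

end YoungSlice

/-! Up to adding δ, a slice is determined by how many of its layers carry each kind of top. Give
every column a label (`Column.lab`) depending only on its height modulo the period and on a half
block if there is one; the labels are the names 𝐮_i, 𝐯_i, 𝐰_0 of the elementary slices. Adding δ
permutes the layers cyclically without changing labels. Conversely, any slice can be shifted until
all layers end in one prescribed cycle; there a label determines its column, and the inclusions
force the order of the layers. Hence two slices are related exactly when their label counts `cnt`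
agree (`related_iff`). The functions that occur as counts are described by `Admissible`
(nonnegative, supported on occurring labels, of total L, and not both half blocks) together with
`Special` (the parity condition, or the bound on 𝐮_0). `exists_chain` realizes them all.

On the other side, `labMult` sends a coordinate vector to the prescribed multiplicities, and it is a
bijection from B^l onto the same set of functions (`exists_labMult_eq`, `labMult_injective`). For
the types C, A_even, D the multiplicities are the coordinates themselves, with 𝐰_0 filling up the
total. For B and A_odd the overlaps min(x_k, x̄_k) are moved one index up, and can be read off as
min(𝐮_{k+1}, 𝐯_{k+1}), the last one as half of the number of 𝐮_0.

It remains to see that both families of operators act on counts by the same rule. For each color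
there are four labels q, p, s, r such that ẽ_i turns q into p or s into r, and f̃_i reverses these
moves. The splitting before the action breaks q-layers against r-layers, so an intact q-layer
survives exactly when q outnumbers r; then ẽ_i uses q → p, and otherwise s → r. This is `stepE`. On
coordinates it is `labMult_rawE`. On slices it is `actOnce_spec` and `actTwice_spec`, the two-block
rule being `stepE` applied twice. The combinatorial core on slices is that the prescribed choice of
layer always leaves a chain of inclusions: only layers with the same kind of block in the same row,
or one cycle away, can obstruct a move (`remove_cover`, `add_cover`), and choosing the highest and
foremost (or lowest and backmost) layer avoids them.

Finally B^l is checked to be a crystal directly, and the bijection carries its operators, and with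
them ε_i, φ_i and the weight, to classes of slices; there ε_i and φ_i are string lengths, and they
are string lengths on B^l too (`maxIterate_perfect_e`, `maxIterate_perfect_f`). So the crystal
axioms transfer. -/

namespace YoungSlice

/-! ### Coordinate vectors indexed by natural numbers -/

section CoordBasics
variable {n : ℕ}

theorem Coord.X_fin (b : Coord n) (j : Fin (n + 1)) : b.X j = b.x j := dif_pos j.isLt

theorem Coord.Xb_fin (b : Coord n) (j : Fin (n + 1)) : b.Xb j = b.xb j := dif_pos j.isLt

theorem Coord.X_addX (b : Coord n) (k : ℕ) (d : ℤ) (j : ℕ) :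
    (b.addX k d).X j = if j = k ∧ j ≤ n then b.X j + d else b.X j := by
  unfold Coord.X Coord.addX
  by_cases h : j < n + 1
  · simp only [h, dite_true, Nat.le_of_lt_succ h, and_true]
  · simp only [h, dite_false, Nat.lt_succ_iff.not.mp h, and_false, if_false]

theorem Coord.Xb_addX (b : Coord n) (k : ℕ) (d : ℤ) (j : ℕ) : (b.addX k d).Xb j = b.Xb j := rfl

theorem Coord.X_addXb (b : Coord n) (k : ℕ) (d : ℤ) (j : ℕ) : (b.addXb k d).X j = b.X j := rfl

theorem Coord.Xb_addXb (b : Coord n) (k : ℕ) (d : ℤ) (j : ℕ) :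
    (b.addXb k d).Xb j = if j = k ∧ j ≤ n then b.Xb j + d else b.Xb j := by
  unfold Coord.Xb Coord.addXb
  by_cases h : j < n + 1
  · simp only [h, dite_true, Nat.le_of_lt_succ h, and_true]
  · simp only [h, dite_false, Nat.lt_succ_iff.not.mp h, and_false, if_false]

theorem Coord.total_addX (b : Coord n) {k : ℕ} (hk : k ≤ n) (d : ℤ) :
    (b.addX k d).total = b.total + d := by
  have : ∀ j : Fin (n + 1), (if j.val = k then b.x j + d else b.x j) =
      b.x j + if j = ⟨k, by omega⟩ then d else 0 := by
    intro j
    by_cases h : j.val = k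
    · have : j = ⟨k, by omega⟩ := Fin.ext h
      simp [this]
    · have : j ≠ ⟨k, by omega⟩ := fun h' => h (by rw [h'])
      simp [this, h]
  simp only [Coord.total, Coord.addX, this, Finset.sum_add_distrib, Finset.sum_ite_eq',
    Finset.mem_univ, if_true]
  ring

theorem Coord.total_addXb (b : Coord n) {k : ℕ} (hk : k ≤ n) (d : ℤ) :
    (b.addXb k d).total = b.total + d := by
  have := Coord.total_addX ⟨b.xb, b.x⟩ hk d
  simp only [Coord.total, Coord.addX] at this
  simp only [Coord.total, Coord.addXb]
  linarith

theorem Coord.ext_of_XXb {b c : Coord n} (h : ∀ k ≤ n, b.X k = c.X k)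
    (h' : ∀ k ≤ n, b.Xb k = c.Xb k) : b = c := by
  obtain ⟨x, y⟩ := b
  obtain ⟨x', y'⟩ := c
  congr 1 <;> funext j
  · simpa only [Coord.X_fin] using h j (by omega)
  · simpa only [Coord.Xb_fin] using h' j (by omega)

theorem Coord.X_of_lt (b : Coord n) {k : ℕ} (h : n < k) : b.X k = 0 := by
  simp [Coord.X]; omega

theorem Coord.Xb_of_lt (b : Coord n) {k : ℕ} (h : n < k) : b.Xb k = 0 := by
  simp [Coord.Xb]; omega

theorem Coord.x_zero_eq (b : Coord n) : b.x 0 = b.X 0 := (b.X_fin 0).symm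

theorem Coord.xb_zero_eq (b : Coord n) : b.xb 0 = b.Xb 0 := (b.Xb_fin 0).symm

/-- The condition `Shape` in terms of `X` and `Xb`. -/
def Coord.ShapeX (t : AffineType) {n : ℕ} (l : ℕ) (b : Coord n) : Prop :=
  match t with
  | .A1 => (∀ k, b.Xb k = 0) ∧ b.total = l
  | .B1 => b.X 0 ≤ 1 ∧ b.total = l
  | .C1 => b.X 0 = 0 ∧ b.total ≤ 2 * l ∧ b.total % 2 = 0
  | .A2odd => b.X 0 = 0 ∧ b.total = l
  | .A2even => b.X 0 = 0 ∧ b.total ≤ l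
  | .D2 => b.X 0 ≤ 1 ∧ b.total ≤ l

/-- Out of range `X` is 0, which is why `P 0` is required. Natural-number indices allow statements
about k - 1 and k + 1 without casts. -/
theorem Coord.forall_X (b : Coord n) (P : ℤ → Prop) (h0 : P 0) :
    (∀ i, P (b.x i)) ↔ ∀ k, P (b.X k) := by
  constructor
  · intro h k
    unfold Coord.X
    split_ifs
    · exact h _
    · exact h0
  · intro h i
    simpa only [Coord.X_fin] using h i

theorem Coord.forall_Xb (b : Coord n) (P : ℤ → Prop) (h0 : P 0) :
    (∀ i, P (b.xb i)) ↔ ∀ k, P (b.Xb k) :=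
  Coord.forall_X ⟨b.xb, b.x⟩ P h0

theorem Coord.mem_iff {t : AffineType} {l : ℕ} {b : Coord n} :
    b.Mem t l ↔ (∀ k, 0 ≤ b.X k) ∧ (∀ k, 0 ≤ b.Xb k) ∧ b.Xb 0 = 0 ∧ b.ShapeX t l := by
  unfold Coord.Mem
  rw [b.forall_X (fun a => 0 ≤ a) le_rfl, b.forall_Xb (fun a => 0 ≤ a) le_rfl, b.xb_zero_eq]
  refine and_congr_right fun _ => and_congr_right fun _ => and_congr_right fun _ => ?_
  cases t <;> simp only [Coord.Shape, Coord.ShapeX, b.x_zero_eq, Int.even_iff,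
    b.forall_Xb (fun a => a = 0) rfl]

end CoordBasics

/-! ### Formulas for the operators, type by type -/

section Equations

theorem rawE_A1 {n : ℕ} (i : ℕ) (b : Coord n) :
    rawE .A1 i b =
      (b.addX i (-1)).addX ((i + n) % (n + 1)) 1 := rfl

theorem rawE_B1 {n : ℕ} (i : ℕ) (b : Coord n) :
    rawE .B1 i b =
    if i = 0 then
      if b.X 2 > b.Xb 2 then (b.addX 2 (-1)).addXb 1 1 else (b.addX 1 (-1)).addXb 2 1
    else if i = n then
      if b.X 0 = 1 then (b.addX n 1).addX 0 (-1) else (b.addX 0 1).addXb n (-1)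
    else
      if b.X (i + 1) > b.Xb (i + 1) then (b.addX i 1).addX (i + 1) (-1)
      else (b.addXb (i + 1) 1).addXb i (-1) := rfl

theorem rawE_A2odd {n : ℕ} (i : ℕ) (b : Coord n) :
    rawE .A2odd i b =
    if i = 0 then
      if b.X 2 > b.Xb 2 then (b.addX 2 (-1)).addXb 1 1 else (b.addX 1 (-1)).addXb 2 1
    else if i = n then
      (b.addX n 1).addXb n (-1)
    else
      if b.X (i + 1) > b.Xb (i + 1) then (b.addX i 1).addX (i + 1) (-1)
      else (b.addXb (i + 1) 1).addXb i (-1) := rfl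

theorem rawE_C1 {n : ℕ} (i : ℕ) (b : Coord n) :
    rawE .C1 i b =
    if i = 0 then
      if b.X 1 ≥ b.Xb 1 + 2 then b.addX 1 (-2)
      else if b.X 1 = b.Xb 1 + 1 then (b.addX 1 (-1)).addXb 1 1 else b.addXb 1 2
    else if i = n then
      (b.addX n 1).addXb n (-1)
    else
      if b.X (i + 1) > b.Xb (i + 1) then (b.addX i 1).addX (i + 1) (-1)
      else (b.addXb (i + 1) 1).addXb i (-1) := rfl

theorem rawE_A2even {n : ℕ} (i : ℕ) (b : Coord n) :
    rawE .A2even i b =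
    if i = 0 then
      if b.X 1 > b.Xb 1 then b.addX 1 (-1) else b.addXb 1 1
    else if i = n then
      (b.addX n 1).addXb n (-1)
    else
      if b.X (i + 1) > b.Xb (i + 1) then (b.addX i 1).addX (i + 1) (-1)
      else (b.addXb (i + 1) 1).addXb i (-1) := rfl

theorem rawE_D2 {n : ℕ} (i : ℕ) (b : Coord n) :
    rawE .D2 i b =
    if i = 0 then
      if b.X 1 > b.Xb 1 then b.addX 1 (-1) else b.addXb 1 1
    else if i = n then
      if b.X 0 = 1 then (b.addX n 1).addX 0 (-1) else (b.addX 0 1).addXb n (-1)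
    else
      if b.X (i + 1) > b.Xb (i + 1) then (b.addX i 1).addX (i + 1) (-1)
      else (b.addXb (i + 1) 1).addXb i (-1) := rfl

theorem rawF_A1 {n : ℕ} (i : ℕ) (b : Coord n) :
    rawF .A1 i b =
      (b.addX i 1).addX ((i + n) % (n + 1)) (-1) := rfl

theorem rawF_B1 {n : ℕ} (i : ℕ) (b : Coord n) :
    rawF .B1 i b =
    if i = 0 then
      if b.X 2 ≥ b.Xb 2 then (b.addX 2 1).addXb 1 (-1) else (b.addX 1 1).addXb 2 (-1)
    else if i = n then
      if b.X 0 = 0 then (b.addX n (-1)).addX 0 1 else (b.addX 0 (-1)).addXb n 1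
    else
      if b.X (i + 1) ≥ b.Xb (i + 1) then (b.addX i (-1)).addX (i + 1) 1
      else (b.addXb (i + 1) (-1)).addXb i 1 := rfl

theorem rawF_A2odd {n : ℕ} (i : ℕ) (b : Coord n) :
    rawF .A2odd i b =
    if i = 0 then
      if b.X 2 ≥ b.Xb 2 then (b.addX 2 1).addXb 1 (-1) else (b.addX 1 1).addXb 2 (-1)
    else if i = n then
      (b.addX n (-1)).addXb n 1
    else
      if b.X (i + 1) ≥ b.Xb (i + 1) then (b.addX i (-1)).addX (i + 1) 1
      else (b.addXb (i + 1) (-1)).addXb i 1 := rfl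

theorem rawF_C1 {n : ℕ} (i : ℕ) (b : Coord n) :
    rawF .C1 i b =
    if i = 0 then
      if b.X 1 ≥ b.Xb 1 then b.addX 1 2
      else if b.X 1 = b.Xb 1 - 1 then (b.addX 1 1).addXb 1 (-1) else b.addXb 1 (-2)
    else if i = n then
      (b.addX n (-1)).addXb n 1
    else
      if b.X (i + 1) ≥ b.Xb (i + 1) then (b.addX i (-1)).addX (i + 1) 1
      else (b.addXb (i + 1) (-1)).addXb i 1 := rfl

theorem rawF_A2even {n : ℕ} (i : ℕ) (b : Coord n) :
    rawF .A2even i b =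
    if i = 0 then
      if b.X 1 ≥ b.Xb 1 then b.addX 1 1 else b.addXb 1 (-1)
    else if i = n then
      (b.addX n (-1)).addXb n 1
    else
      if b.X (i + 1) ≥ b.Xb (i + 1) then (b.addX i (-1)).addX (i + 1) 1
      else (b.addXb (i + 1) (-1)).addXb i 1 := rfl

theorem rawF_D2 {n : ℕ} (i : ℕ) (b : Coord n) :
    rawF .D2 i b =
    if i = 0 then
      if b.X 1 ≥ b.Xb 1 then b.addX 1 1 else b.addXb 1 (-1)
    else if i = n then
      if b.X 0 = 0 then (b.addX n (-1)).addX 0 1 else (b.addX 0 (-1)).addXb n 1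
    else
      if b.X (i + 1) ≥ b.Xb (i + 1) then (b.addX i (-1)).addX (i + 1) 1
      else (b.addXb (i + 1) (-1)).addXb i 1 := rfl

theorem oldEps_A1 {n : ℕ} (l i : ℕ) (b : Coord n) :
    oldEps .A1 l i b =
      b.X i := rfl

theorem oldEps_B1 {n : ℕ} (l i : ℕ) (b : Coord n) :
    oldEps .B1 l i b =
    if i = 0 then
      b.X 1 + pos (b.X 2 - b.Xb 2)
    else if i = n then
      2 * b.Xb n + b.X 0
    else
      b.Xb i + pos (b.X (i + 1) - b.Xb (i + 1)) := rfl

theorem oldEps_A2odd {n : ℕ} (l i : ℕ) (b : Coord n) :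
    oldEps .A2odd l i b =
    if i = 0 then
      b.X 1 + pos (b.X 2 - b.Xb 2)
    else if i = n then
      b.Xb n
    else
      b.Xb i + pos (b.X (i + 1) - b.Xb (i + 1)) := rfl

theorem oldEps_C1 {n : ℕ} (l i : ℕ) (b : Coord n) :
    oldEps .C1 l i b =
    if i = 0 then
      l - b.total / 2 + pos (b.X 1 - b.Xb 1)
    else if i = n then
      b.Xb n
    else
      b.Xb i + pos (b.X (i + 1) - b.Xb (i + 1)) := rfl

theorem oldEps_A2even {n : ℕ} (l i : ℕ) (b : Coord n) :
    oldEps .A2even l i b =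
    if i = 0 then
      l - b.total + 2 * pos (b.X 1 - b.Xb 1)
    else if i = n then
      b.Xb n
    else
      b.Xb i + pos (b.X (i + 1) - b.Xb (i + 1)) := rfl

theorem oldEps_D2 {n : ℕ} (l i : ℕ) (b : Coord n) :
    oldEps .D2 l i b =
    if i = 0 then
      l - b.total + 2 * pos (b.X 1 - b.Xb 1)
    else if i = n then
      2 * b.Xb n + b.X 0
    else
      b.Xb i + pos (b.X (i + 1) - b.Xb (i + 1)) := rfl

theorem oldPhi_A1 {n : ℕ} (l i : ℕ) (b : Coord n) :
    oldPhi .A1 l i b =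
      b.X ((i + n) % (n + 1)) := rfl

theorem oldPhi_B1 {n : ℕ} (l i : ℕ) (b : Coord n) :
    oldPhi .B1 l i b =
    if i = 0 then
      b.Xb 1 + pos (b.Xb 2 - b.X 2)
    else if i = n then
      2 * b.X n + b.X 0
    else
      b.X i + pos (b.Xb (i + 1) - b.X (i + 1)) := rfl

theorem oldPhi_A2odd {n : ℕ} (l i : ℕ) (b : Coord n) :
    oldPhi .A2odd l i b =
    if i = 0 then
      b.Xb 1 + pos (b.Xb 2 - b.X 2)
    else if i = n then
      b.X n
    else
      b.X i + pos (b.Xb (i + 1) - b.X (i + 1)) := rfl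

theorem oldPhi_C1 {n : ℕ} (l i : ℕ) (b : Coord n) :
    oldPhi .C1 l i b =
    if i = 0 then
      l - b.total / 2 + pos (b.Xb 1 - b.X 1)
    else if i = n then
      b.X n
    else
      b.X i + pos (b.Xb (i + 1) - b.X (i + 1)) := rfl

theorem oldPhi_A2even {n : ℕ} (l i : ℕ) (b : Coord n) :
    oldPhi .A2even l i b =
    if i = 0 then
      l - b.total + 2 * pos (b.Xb 1 - b.X 1)
    else if i = n then
      b.X n
    else
      b.X i + pos (b.Xb (i + 1) - b.X (i + 1)) := rfl

theorem oldPhi_D2 {n : ℕ} (l i : ℕ) (b : Coord n) :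
    oldPhi .D2 l i b =
    if i = 0 then
      l - b.total + 2 * pos (b.Xb 1 - b.X 1)
    else if i = n then
      2 * b.X n + b.X 0
    else
      b.X i + pos (b.Xb (i + 1) - b.X (i + 1)) := rfl

theorem pred_mod_spec {n i : ℕ} (hi : i ≤ n) :
    (i = 0 ∧ (i + n) % (n + 1) = n) ∨ (0 < i ∧ (i + n) % (n + 1) = i - 1) := by
  rcases Nat.eq_zero_or_pos i with rfl | h
  · left
    rw [Nat.mod_eq_of_lt] <;> omega
  · right
    have : i + n = (i - 1) + (n + 1) := by omega
    rw [this, Nat.add_mod_right, Nat.mod_eq_of_lt] <;> omega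

end Equations

set_option linter.unusedSimpArgs false

/-! ### The raw maps on coordinates: membership, inversion, change of ε -/

section RawMaps
variable {n : ℕ}

/-- The raw map can leave the crystal only by making a coordinate negative or by exceeding the bound
on the total, and ε_i vanishes exactly then. This is the first half of the statement that ε_i is a
string length. -/
theorem mem_rawE {t : AffineType} {l i : ℕ} {b : Coord n} (hn : minRank t ≤ n) (hi : i ≤ n)
    (hb : b.Mem t l) : (rawE t i b).Mem t l ↔ 0 < oldEps t l i b := by
  rw [Coord.mem_iff] at hb ⊢
  obtain ⟨hx, hxb, h0, hs⟩ := hb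
  cases t
  case A1 =>
    simp only [minRank] at hn
    have := pred_mod_spec hi
    have hle : (i + n) % (n + 1) ≤ n := Nat.lt_succ_iff.mp (Nat.mod_lt _ (by omega))
    simp only [rawE_A1, oldEps_A1, Coord.ShapeX, Coord.X_addX, Coord.Xb_addX, Coord.total_addX,
      hi, hle] at hs ⊢
    grind
  all_goals
    simp only [minRank] at hn
    simp only [rawE_B1, rawE_C1, rawE_A2odd, rawE_A2even, rawE_D2,
      oldEps_B1, oldEps_C1, oldEps_A2odd, oldEps_A2even, oldEps_D2,
      pos, Coord.ShapeX] at hs ⊢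
    split_ifs <;> try subst i
    all_goals
      simp (disch := omega) only [Coord.X_addX, Coord.Xb_addX, Coord.X_addXb, Coord.Xb_addXb,
        Coord.total_addX, Coord.total_addXb]
      grind

theorem mem_rawF {t : AffineType} {l i : ℕ} {b : Coord n} (hn : minRank t ≤ n) (hi : i ≤ n)
    (hb : b.Mem t l) : (rawF t i b).Mem t l ↔ 0 < oldPhi t l i b := by
  rw [Coord.mem_iff] at hb ⊢
  obtain ⟨hx, hxb, h0, hs⟩ := hb
  cases t
  case A1 =>
    simp only [minRank] at hn
    have := pred_mod_spec hi
    have hle : (i + n) % (n + 1) ≤ n := Nat.lt_succ_iff.mp (Nat.mod_lt _ (by omega))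
    simp only [rawF_A1, oldPhi_A1, Coord.ShapeX, Coord.X_addX, Coord.Xb_addX, Coord.total_addX,
      hi, hle] at hs ⊢
    grind
  all_goals
    simp only [minRank] at hn
    simp only [rawF_B1, rawF_C1, rawF_A2odd, rawF_A2even, rawF_D2,
      oldPhi_B1, oldPhi_C1, oldPhi_A2odd, oldPhi_A2even, oldPhi_D2,
      pos, Coord.ShapeX] at hs ⊢
    split_ifs <;> try subst i
    all_goals
      simp (disch := omega) only [Coord.X_addX, Coord.Xb_addX, Coord.X_addXb, Coord.Xb_addXb,
        Coord.total_addX, Coord.total_addXb]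
      grind

/-- The strict and weak inequalities in the two case distinctions match: after any branch of ẽ_i the
test for f̃_i selects the opposite branch. The result of `rawE` need not lie in the crystal for
this. -/
theorem rawF_rawE {t : AffineType} {l i : ℕ} {b : Coord n} (hn : minRank t ≤ n) (hi : i ≤ n)
    (hb : b.Mem t l) : rawF t i (rawE t i b) = b := by
  rw [Coord.mem_iff] at hb
  obtain ⟨hx, hxb, h0, hs⟩ := hb
  cases t
  case A1 =>
    have := pred_mod_spec hi
    apply Coord.ext_of_XXb <;> intro k hk <;>
      simp only [rawE_A1, rawF_A1, Coord.X_addX, Coord.Xb_addX] <;> grind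
  all_goals
    simp only [minRank] at hn
    simp only [rawE_B1, rawE_C1, rawE_A2odd, rawE_A2even, rawE_D2, Coord.ShapeX] at hs ⊢
    simp only [rawF_B1, rawF_C1, rawF_A2odd, rawF_A2even, rawF_D2]
    by_cases hi0 : i = 0
    · subst hi0
      simp only [if_true]
      split_ifs <;>
        (simp (disch := omega) only [Coord.X_addX, Coord.Xb_addX, Coord.X_addXb,
            Coord.Xb_addXb] at *
         apply Coord.ext_of_XXb <;> intro k hk <;>
          simp (disch := omega) only [Coord.X_addX, Coord.Xb_addX, Coord.X_addXb,
              Coord.Xb_addXb] <;> grind)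
    simp only [hi0, if_false]
    by_cases hin : i = n
    · subst hin
      simp only [if_true]
      apply Coord.ext_of_XXb <;> intro k hk <;> (try split_ifs) <;>
        simp (disch := omega) only [Coord.X_addX, Coord.Xb_addX, Coord.X_addXb,
            Coord.Xb_addXb] at * <;> grind
    · simp only [hin, if_false]
      apply Coord.ext_of_XXb <;> intro k hk <;> split_ifs <;>
        simp (disch := omega) only [Coord.X_addX, Coord.Xb_addX, Coord.X_addXb,
            Coord.Xb_addXb] at * <;> grind

theorem rawE_rawF {t : AffineType} {l i : ℕ} {b : Coord n} (hn : minRank t ≤ n) (hi : i ≤ n)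
    (hb : b.Mem t l) : rawE t i (rawF t i b) = b := by
  rw [Coord.mem_iff] at hb
  obtain ⟨hx, hxb, h0, hs⟩ := hb
  cases t
  case A1 =>
    have := pred_mod_spec hi
    apply Coord.ext_of_XXb <;> intro k hk <;>
      simp only [rawF_A1, rawE_A1, Coord.X_addX, Coord.Xb_addX] <;> grind
  all_goals
    simp only [minRank] at hn
    simp only [rawF_B1, rawF_C1, rawF_A2odd, rawF_A2even, rawF_D2, Coord.ShapeX] at hs ⊢
    simp only [rawE_B1, rawE_C1, rawE_A2odd, rawE_A2even, rawE_D2]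
    by_cases hi0 : i = 0
    · subst hi0
      simp only [if_true]
      split_ifs <;>
        (simp (disch := omega) only [Coord.X_addX, Coord.Xb_addX, Coord.X_addXb,
            Coord.Xb_addXb] at *
         apply Coord.ext_of_XXb <;> intro k hk <;>
          simp (disch := omega) only [Coord.X_addX, Coord.Xb_addX, Coord.X_addXb,
              Coord.Xb_addXb] <;> grind)
    simp only [hi0, if_false]
    by_cases hin : i = n
    · subst hin
      simp only [if_true]
      apply Coord.ext_of_XXb <;> intro k hk <;> (try split_ifs) <;>
        simp (disch := omega) only [Coord.X_addX, Coord.Xb_addX, Coord.X_addXb,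
            Coord.Xb_addXb] at * <;> grind
    · simp only [hin, if_false]
      apply Coord.ext_of_XXb <;> intro k hk <;> split_ifs <;>
        simp (disch := omega) only [Coord.X_addX, Coord.Xb_addX, Coord.X_addXb,
            Coord.Xb_addXb] at * <;> grind

theorem oldEps_rawE {t : AffineType} {l i : ℕ} {b : Coord n} (hn : minRank t ≤ n) (hi : i ≤ n)
    (hb : b.Mem t l) : oldEps t l i (rawE t i b) = oldEps t l i b - 1 := by
  rw [Coord.mem_iff] at hb
  obtain ⟨hx, hxb, h0, hs⟩ := hb
  cases t
  case A1 =>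
    simp only [minRank] at hn
    have := pred_mod_spec hi
    simp only [rawE_A1, oldEps_A1, Coord.X_addX]
    grind
  all_goals
    simp only [minRank] at hn
    simp only [rawE_B1, rawE_C1, rawE_A2odd, rawE_A2even, rawE_D2, Coord.ShapeX] at hs ⊢
    simp only [oldEps_B1, oldEps_C1, oldEps_A2odd, oldEps_A2even, oldEps_D2, pos]
    by_cases hi0 : i = 0
    · subst hi0
      simp only [if_true]
      split_ifs <;>
        (simp (disch := omega) only [Coord.X_addX, Coord.Xb_addX, Coord.X_addXb, Coord.Xb_addXb,
          Coord.total_addX, Coord.total_addXb]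
         grind)
    simp only [hi0, if_false]
    by_cases hin : i = n
    · subst hin
      simp only [if_true]
      (try split_ifs) <;>
        simp (disch := omega) only [Coord.X_addX, Coord.Xb_addX, Coord.X_addXb,
            Coord.Xb_addXb] <;> grind
    · simp only [hin, if_false]
      split_ifs <;>
        simp (disch := omega) only [Coord.X_addX, Coord.Xb_addX, Coord.X_addXb,
            Coord.Xb_addXb] <;> grind

end RawMaps

end YoungSlice

/-! ### Weights, and the crystal axioms for B^l -/

namespace YoungSlice
variable {n : ℕ}
set_option linter.unusedSimpArgs false

/-- The pairing of the weight with the `j`-th coroot in terms of the differences `x_k - x̄_k`. -/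
theorem oldPhi_sub_oldEps {t : AffineType} (ht : t ≠ .A1) (l j : ℕ) (b : Coord n) :
    oldPhi t l j b - oldEps t l j b =
      if j = 0 then
        match (generalizing := false) t with
        | .B1 | .A2odd => -(b.X 1 - b.Xb 1) - (b.X 2 - b.Xb 2)
        | .C1 => -(b.X 1 - b.Xb 1)
        | _ => -2 * (b.X 1 - b.Xb 1)
      else if j = n then (match (generalizing := false) t with | .B1 | .D2 => 2 | _ => 1) * (b.X n - b.Xb n)
      else b.X j - b.Xb j - (b.X (j + 1) - b.Xb (j + 1)) := by
  cases t
  case A1 => exact absurd rfl ht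
  all_goals
    simp only [oldEps_B1, oldEps_C1, oldEps_A2odd, oldEps_A2even, oldEps_D2, oldPhi_B1, oldPhi_C1,
      oldPhi_A2odd, oldPhi_A2even, oldPhi_D2, pos]
    split_ifs <;> omega

/-- Whichever branch `rawE` takes, the differences x_k - x̄_k change in the same way, since raising
x_k and lowering x̄_k have the same effect. As the weight depends on these differences only, its
change is independent of the branch. -/
theorem diff_rawE {t : AffineType} {l i k : ℕ} {b : Coord n} (ht : t ≠ .A1) (hn : minRank t ≤ n)
    (hi : i ≤ n) (hk : 0 < k) (hkn : k ≤ n) (hb : b.Mem t l) :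
    (rawE t i b).X k - (rawE t i b).Xb k = b.X k - b.Xb k +
      if i = 0 then
        match (generalizing := false) t with
        | .B1 | .A2odd => if k ≤ 2 then -1 else 0
        | .C1 => if k = 1 then -2 else 0
        | _ => if k = 1 then -1 else 0
      else if i = n then
        (if k = n then (match (generalizing := false) t with | .B1 | .D2 => 1 | _ => 2) else 0)
      else if k = i then 1 else if k = i + 1 then -1 else 0 := by
  rw [Coord.mem_iff] at hb
  obtain ⟨hx, hxb, h0, hs⟩ := hb
  cases t
  case A1 => exact absurd rfl ht
  all_goals
    simp only [minRank] at hn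
    simp only [rawE_B1, rawE_C1, rawE_A2odd, rawE_A2even, rawE_D2]
    by_cases hi0 : i = 0
    · subst hi0
      simp only [if_true]
      clear hx hxb
      split_ifs <;> simp (disch := omega) only [Coord.X_addX, Coord.Xb_addX, Coord.X_addXb,
        Coord.Xb_addXb] <;> grind
    simp only [hi0, if_false]
    by_cases hin : i = n
    · subst hin
      simp only [if_true]
      (try split_ifs) <;> simp (disch := omega) only [Coord.X_addX, Coord.Xb_addX, Coord.X_addXb,
        Coord.Xb_addXb] <;> grind
    · simp only [hin, if_false]
      clear hx hxb
      split_ifs <;> simp (disch := omega) only [Coord.X_addX, Coord.Xb_addX, Coord.X_addXb,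
        Coord.Xb_addXb] <;> grind

/-- By `oldPhi_sub_oldEps` the pairing is linear in the differences x_k - x̄_k, and `diff_rawE`
gives their change; what remains is a comparison with the entries of the Cartan matrix. -/
theorem wt_rawE {t : AffineType} {l : ℕ} {b : Coord n} (hn : minRank t ≤ n) (i j : Fin (n + 1))
    (hb : b.Mem t l) :
    oldPhi t l j (rawE t i b) - oldEps t l j (rawE t i b) =
      oldPhi t l j b - oldEps t l j b + cartan t n j i := by
  obtain ⟨i, hi⟩ := i
  obtain ⟨j, hj⟩ := j
  by_cases ht : t = .A1
  · subst ht
    simp only [minRank] at hn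
    have h1 := pred_mod_spec (Nat.lt_succ_iff.mp hi)
    have h2 := pred_mod_spec (Nat.lt_succ_iff.mp hj)
    -- The Cartan matrix is written with cyclic successors, the operators with cyclic predecessors.
    have h3 : (j + 1) % (n + 1) = i ↔ (i + n) % (n + 1) = j := by
      rcases Nat.lt_or_ge j n with h | h
      · rw [Nat.mod_eq_of_lt (by omega)]; omega
      · have : j = n := by omega
        subst this
        simp only [Nat.mod_self]; omega
    have h4 : (i + 1) % (n + 1) = j ↔ (j + n) % (n + 1) = i := by
      rcases Nat.lt_or_ge i n with h | h
      · rw [Nat.mod_eq_of_lt (by omega)]; omega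
      · have : i = n := by omega
        subst this
        simp only [Nat.mod_self]; omega
    simp only [rawE_A1, oldPhi_A1, oldEps_A1, Coord.X_addX, cartan, h3, h4]
    grind
  have hd := fun k h1 h2 => diff_rawE (k := k) ht hn (Nat.lt_succ_iff.mp hi) h1 h2 hb
  rw [oldPhi_sub_oldEps ht, oldPhi_sub_oldEps ht]
  have hdj := hd j
  have hdj1 := hd (j + 1)
  have hdn := hd n
  have hd1 := hd 1
  have hd2 := hd 2
  clear hd
  cases t
  case A1 => exact absurd rfl ht
  all_goals
    simp only [minRank] at hn
    simp only [cartan]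
    simp only at hdj hdj1 hdn hd1 hd2 ⊢
    by_cases hj0 : j = 0
    · subst hj0
      simp only [if_true]
      clear hdj hdj1 hdn
      grind
    by_cases hjn : j = n
    · subst hjn
      simp only [hj0, if_true, if_false]
      clear hdj hdj1 hd1 hd2
      grind
    · simp only [hj0, hjn, if_false]
      clear hdn hd1 hd2
      grind

theorem toPerfect_eq_some {t : AffineType} {l : ℕ} {b : Coord n} {b' : Perfect t n l} :
    toPerfect t l b = some b' ↔ b = b'.1 := by
  unfold toPerfect
  split_ifs with h
  · exact ⟨fun h' => congrArg Subtype.val (Option.some.inj h'),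
      fun h' => congrArg some (Subtype.ext h')⟩
  · exact ⟨fun h' => (nomatch h'), fun h' => absurd (h' ▸ b'.2 : b.Mem t l) h⟩

theorem toPerfect_eq_none {t : AffineType} {l : ℕ} {b : Coord n} :
    toPerfect t l b = none ↔ ¬ b.Mem t l := by
  unfold toPerfect
  split_ifs with h <;> simp [h]

theorem perfect_e_f {t : AffineType} {l : ℕ} (hn : minRank t ≤ n) (i : Fin (n + 1))
    (b b' : Perfect t n l) :
    (perfectCrystal t n l).f i b = some b' ↔ (perfectCrystal t n l).e i b' = some b := by
  have hi := Nat.lt_succ_iff.mp i.isLt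
  simp only [perfectCrystal, toPerfect_eq_some]
  constructor
  · intro h
    rw [← h, rawE_rawF hn hi b.2]
  · intro h
    rw [← h, rawF_rawE hn hi b'.2]

/-- Only ẽ_i has to be examined: the statements for f̃_i follow because the two are partial
inverses. -/
theorem isCrystal_perfect {t : AffineType} (l : ℕ) (hn : minRank t ≤ n) :
    IsCrystal (cartan t n) (perfectCrystal t n l) := by
  have hef := perfect_e_f (l := l) hn
  have hwt : ∀ i b b', (perfectCrystal t n l).e i b = some b' → ∀ j,
      (perfectCrystal t n l).wt b' j = (perfectCrystal t n l).wt b j + cartan t n j i := by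
    intro i b b' h j
    simp only [perfectCrystal, toPerfect_eq_some] at h ⊢
    rw [← h]
    exact wt_rawE hn i j b.2
  have heps : ∀ (i : Fin (n + 1)) (b b' : Perfect t n l), (perfectCrystal t n l).e i b = some b' →
      oldEps t l i b.1 = oldEps t l i b'.1 + 1 := by
    intro i b b' h
    simp only [perfectCrystal, toPerfect_eq_some] at h
    rw [← h, oldEps_rawE hn (Nat.lt_succ_iff.mp i.isLt) b.2]
    ring
  -- Since ẽ_i raises φ_i - ε_i by a_ii = 2 and lowers ε_i by 1, it raises φ_i by 1.
  have hdiag : ∀ i, cartan t n i i = 2 := fun i => by simp [cartan]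
  have hphi : ∀ (i : Fin (n + 1)) (b b' : Perfect t n l), (perfectCrystal t n l).e i b = some b' →
      oldPhi t l i b'.1 = oldPhi t l i b.1 + 1 := by
    intro i b b' h
    have h1 := heps i b b' h
    have h2 := hwt i b b' h i
    simp only [hdiag, perfectCrystal] at h2
    linarith
  constructor
  · intro i b
    simp only [perfectCrystal]
    rw [← WithBot.coe_add]
    congr 1
    ring
  · exact hwt
  · intro i b b' h j
    rw [hef] at h
    have := hwt i b' b h j
    linarith
  · intro i b b' h
    exact congrArg _ (heps i b b' h)
  · intro i b b' h
    exact congrArg _ (hphi i b b' h)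
  · intro i b b' h
    rw [hef] at h
    exact congrArg _ (heps i b' b h)
  · intro i b b' h
    rw [hef] at h
    exact congrArg _ (hphi i b' b h)
  · exact hef
  · intro i b h
    exact absurd h (WithBot.coe_ne_bot)

end YoungSlice

/-! ### Labels, and the moves of the Kashiwara operators on label counts -/

namespace YoungSlice

/-- Labels for the possible tops of a column, indexed by natural numbers. -/
inductive Lab
  | u (i : ℕ)
  | v (i : ℕ)
  | w
deriving DecidableEq

/-- How many layers with a given label the image of `b` has. -/
def labMult (t : AffineType) {n : ℕ} (l : ℕ) (b : Coord n) : Lab → ℤ :=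
  match t with
  | .A1 => fun
      | .u i => b.X i
      | _ => 0
  | .B1 | .A2odd => fun
      | .u i => if i = 0 then b.X 0 + 2 * b.overlap n
          else if i ≤ n then pos (b.X i - b.Xb i) + b.overlap (i - 1) else 0
      | .v i => if i = 0 then 0
          else if i ≤ n then pos (b.Xb i - b.X i) + b.overlap (i - 1) else 0
      | .w => 0
  | _ => fun
      | .u i => b.X i
      | .v i => b.Xb i
      | .w => numLayers t l - b.total

/-- The effect of the Kashiwara operators of one color on labels: `ẽ` turns `q` into `p` or `s` into
`r`, and `f̃` goes the other way.  If `split` holds, layers labelled `q` and `r` are broken in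
pairs.  Labels which do not occur are `v 0`. -/
structure LabMoves where
  q : Lab
  p : Lab
  s : Lab
  r : Lab
  split : Bool

def labMoves (t : AffineType) (n i : ℕ) : LabMoves :=
  match t with
  | .A1 => ⟨.u i, .u ((i + n) % (n + 1)), .v 0, .v 0, false⟩
  | .B1 | .A2odd =>
      if i = 0 then ⟨.u 1, .v 2, .u 2, .v 1, false⟩
      else if i = 1 then ⟨.v 1, .v 2, .u 2, .u 1, false⟩
      else if i = n then ⟨.v n, .u 0, .u 0, .u n, true⟩
      else ⟨.v i, .v (i + 1), .u (i + 1), .u i, true⟩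
  | _ =>
      if i = 0 then ⟨.u 1, .w, .w, .v 1, true⟩
      else if i = n then
        match t with
        | .D2 => ⟨.u 0, .u n, .v n, .u 0, false⟩
        | _ => ⟨.v n, .u n, .v 0, .v 0, false⟩
      else ⟨.u (i + 1), .u i, .v i, .v (i + 1), true⟩

/-- One layer labelled `a` is turned into a layer labelled `b`. -/
def relabel (a b : Lab) (g : Lab → ℤ) (x : Lab) : ℤ :=
  g x - (if x = a then 1 else 0) + (if x = b then 1 else 0)

/-- With splitting, each r-layer uses up one q-layer, so the test asks whether an intact q-layer is
left; without splitting it asks whether there is a q-layer at all. Nothing prevents the result from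
being negative; `canE` says when the move is genuine. -/
def LabMoves.stepE (m : LabMoves) (g : Lab → ℤ) : Lab → ℤ :=
  if (if m.split then g m.r else 0) < g m.q then relabel m.q m.p g else relabel m.s m.r g

/-- This is definitionally `stepE` for `m.flip`, so that what is proved about removing blocks for
arbitrary moves applies to adding them. -/
def LabMoves.stepF (m : LabMoves) (g : Lab → ℤ) : Lab → ℤ :=
  if (if m.split then g m.q else 0) < g m.r then relabel m.r m.s g else relabel m.p m.q g

/-- The moves with the roles of `ẽ_i` and `f̃_i` exchanged. -/
def LabMoves.flip (m : LabMoves) : LabMoves := ⟨m.r, m.s, m.p, m.q, m.split⟩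

theorem LabMoves.stepE_apply (m : LabMoves) (g : Lab → ℤ) (x : Lab) :
    m.stepE g x = if (if m.split then g m.r else 0) < g m.q then
      g x - (if x = m.q then 1 else 0) + (if x = m.p then 1 else 0)
    else g x - (if x = m.s then 1 else 0) + (if x = m.r then 1 else 0) := by
  simp only [LabMoves.stepE, ite_apply, relabel]

theorem LabMoves.stepF_apply (m : LabMoves) (g : Lab → ℤ) (x : Lab) :
    m.stepF g x = if (if m.split then g m.q else 0) < g m.r then
      g x - (if x = m.r then 1 else 0) + (if x = m.s then 1 else 0)
    else g x - (if x = m.p then 1 else 0) + (if x = m.q then 1 else 0) := by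
  simp only [LabMoves.stepF, ite_apply, relabel]

/-- `ẽ_i` is not `0` on a slice with the given numbers of labels. -/
def LabMoves.canE (m : LabMoves) (g : Lab → ℤ) : Prop :=
  (if m.split then g m.r else 0) < g m.q ∨ 0 < g m.s

def LabMoves.canF (m : LabMoves) (g : Lab → ℤ) : Prop :=
  (if m.split then g m.q else 0) < g m.r ∨ 0 < g m.p

section
variable {n : ℕ} (l i : ℕ) (b : Coord n)

theorem labMult_A1 : labMult .A1 l b = fun
      | .u i => b.X i
      | _ => 0 := rfl

theorem labMult_fork {t : AffineType} (ht : t = .B1 ∨ t = .A2odd) : labMult t l b = fun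
      | .u i => if i = 0 then b.X 0 + 2 * b.overlap n
          else if i ≤ n then pos (b.X i - b.Xb i) + b.overlap (i - 1) else 0
      | .v i => if i = 0 then 0
          else if i ≤ n then pos (b.Xb i - b.X i) + b.overlap (i - 1) else 0
      | .w => 0 := by
  rcases ht with rfl | rfl <;> rfl

theorem labMult_line {t : AffineType} (ht : t = .C1 ∨ t = .A2even ∨ t = .D2) :
    labMult t l b = fun
      | .u i => b.X i
      | .v i => b.Xb i
      | .w => numLayers t l - b.total := by
  rcases ht with rfl | rfl | rfl <;> rfl

theorem labMoves_fork {t : AffineType} (ht : t = .B1 ∨ t = .A2odd) : labMoves t n i =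
      if i = 0 then ⟨.u 1, .v 2, .u 2, .v 1, false⟩
      else if i = 1 then ⟨.v 1, .v 2, .u 2, .u 1, false⟩
      else if i = n then ⟨.v n, .u 0, .u 0, .u n, true⟩
      else ⟨.v i, .v (i + 1), .u (i + 1), .u i, true⟩ := by
  rcases ht with rfl | rfl <;> rfl

theorem labMoves_C1 : labMoves .C1 n i =
      if i = 0 then ⟨.u 1, .w, .w, .v 1, true⟩
      else if i = n then ⟨.v n, .u n, .v 0, .v 0, false⟩
      else ⟨.u (i + 1), .u i, .v i, .v (i + 1), true⟩ := rfl

theorem labMoves_A2even : labMoves .A2even n i =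
      if i = 0 then ⟨.u 1, .w, .w, .v 1, true⟩
      else if i = n then ⟨.v n, .u n, .v 0, .v 0, false⟩
      else ⟨.u (i + 1), .u i, .v i, .v (i + 1), true⟩ := rfl

theorem labMoves_D2 : labMoves .D2 n i =
      if i = 0 then ⟨.u 1, .w, .w, .v 1, true⟩
      else if i = n then ⟨.u 0, .u n, .v n, .u 0, false⟩
      else ⟨.u (i + 1), .u i, .v i, .v (i + 1), true⟩ := rfl

end

section
variable {n : ℕ}

set_option linter.unusedSimpArgs false

/-- Both sides amount to ε_i > 0. For the two-block colors a single application of the move is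
tested; parity guarantees the second one. -/
theorem canE_labMult {t : AffineType} {l i : ℕ} {b : Coord n} (hn : minRank t ≤ n) (hi : i ≤ n)
    (hb : b.Mem t l) : (rawE t i b).Mem t l ↔ (labMoves t n i).canE (labMult t l b) := by
  rw [mem_rawE hn hi hb]
  rw [Coord.mem_iff] at hb
  obtain ⟨hx, hxb, h0, hs⟩ := hb
  cases t
  case A1 =>
    simp [LabMoves.canE, labMult_A1, oldEps_A1, labMoves]
  case B1 =>
    simp only [minRank] at hn
    simp only [LabMoves.canE, labMult_fork, labMoves_fork, oldEps_B1, Coord.overlap, pos,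
      Coord.ShapeX, true_or, or_true] at hs ⊢
    split_ifs <;> simp at * <;> grind
  case A2odd =>
    simp only [minRank] at hn
    simp only [LabMoves.canE, labMult_fork, labMoves_fork, oldEps_A2odd, Coord.overlap, pos,
      Coord.ShapeX, true_or, or_true] at hs ⊢
    split_ifs <;> simp at * <;> grind
  all_goals
    simp only [minRank] at hn
    simp only [LabMoves.canE, labMult_line, labMoves_C1, labMoves_A2even, labMoves_D2, oldEps_C1,
      oldEps_A2even, oldEps_D2, pos, Coord.ShapeX, true_or, or_true, numLayers] at hs ⊢
    split_ifs <;> simp at * <;> grind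

theorem canF_labMult {t : AffineType} {l i : ℕ} {b : Coord n} (hn : minRank t ≤ n) (hi : i ≤ n)
    (hb : b.Mem t l) : (rawF t i b).Mem t l ↔ (labMoves t n i).canF (labMult t l b) := by
  rw [mem_rawF hn hi hb]
  rw [Coord.mem_iff] at hb
  obtain ⟨hx, hxb, h0, hs⟩ := hb
  cases t
  case A1 =>
    simp [LabMoves.canF, labMult_A1, oldPhi_A1, labMoves]
  case B1 =>
    simp only [minRank] at hn
    simp only [LabMoves.canF, labMult_fork, labMoves_fork, oldPhi_B1, Coord.overlap, pos,
      Coord.ShapeX, true_or, or_true] at hs ⊢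
    split_ifs <;> simp at * <;> grind
  case A2odd =>
    simp only [minRank] at hn
    simp only [LabMoves.canF, labMult_fork, labMoves_fork, oldPhi_A2odd, Coord.overlap, pos,
      Coord.ShapeX, true_or, or_true] at hs ⊢
    split_ifs <;> simp at * <;> grind
  all_goals
    simp only [minRank] at hn
    simp only [LabMoves.canF, labMult_line, labMoves_C1, labMoves_A2even, labMoves_D2, oldPhi_C1,
      oldPhi_A2even, oldPhi_D2, pos, Coord.ShapeX, true_or, or_true, numLayers] at hs ⊢
    split_ifs <;> simp at * <;> grind

end

end YoungSlice

/-! ### The coordinate operators are the moves on label counts -/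

namespace YoungSlice
variable {n : ℕ}
set_option linter.unusedSimpArgs false
set_option linter.unnecessarySeqFocus false

theorem labMult_fork_u {t : AffineType} (ht : t = .B1 ∨ t = .A2odd) (l : ℕ) (b : Coord n) (k : ℕ) :
    labMult t l b (.u k) = if k = 0 then b.X 0 + 2 * b.overlap n
          else if k ≤ n then pos (b.X k - b.Xb k) + b.overlap (k - 1) else 0 := by
  rw [labMult_fork l b ht]

theorem labMult_fork_v {t : AffineType} (ht : t = .B1 ∨ t = .A2odd) (l : ℕ) (b : Coord n) (k : ℕ) :
    labMult t l b (.v k) = if k = 0 then 0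
          else if k ≤ n then pos (b.Xb k - b.X k) + b.overlap (k - 1) else 0 := by
  rw [labMult_fork l b ht]

theorem labMult_fork_w {t : AffineType} (ht : t = .B1 ∨ t = .A2odd) (l : ℕ) (b : Coord n) :
    labMult t l b .w = 0 := by
  rw [labMult_fork l b ht]

/-- The middle moves in types `B` and `A_{odd}^{(2)}`, in terms of labels. -/
theorem labMult_fork_mid {t : AffineType} (ht : t = .B1 ∨ t = .A2odd) {l i : ℕ} {b b' : Coord n}
    (h0 : 0 < i) (hn : i < n)
    (hb' : (b.Xb (i + 1) < b.X (i + 1) ∧ (∀ k, b'.Xb k = b.Xb k) ∧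
      (∀ k, b'.X k = if k = i then b.X k + 1 else if k = i + 1 then b.X k - 1 else b.X k)) ∨
      (b.X (i + 1) ≤ b.Xb (i + 1) ∧ (∀ k, b'.X k = b.X k) ∧
      (∀ k, b'.Xb k = if k = i then b.Xb k - 1 else if k = i + 1 then b.Xb k + 1 else b.Xb k)))
    (a : Lab) :
    labMult t l b' a = if b.X i < b.Xb i then
      labMult t l b a - (if a = .v i then 1 else 0) + (if a = .v (i + 1) then 1 else 0)
      else labMult t l b a - (if a = .u (i + 1) then 1 else 0) + (if a = .u i then 1 else 0) := by
  cases a with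
  | w => simp [labMult_fork_w ht]
  | u k =>
    simp only [labMult_fork_u ht, Lab.u.injEq, reduceCtorEq, if_false, Coord.overlap, pos]
    -- The number of 𝐮_k depends on the coordinates of index k and on the overlap of index k - 1, so
    -- a change at i and i + 1 is felt only for k = i, i + 1, i + 2, and for k = 0 through the
    -- overlap of index n. In both branches the overlap at i + 1 is unchanged; the branches differ
    -- in the overlap at i, and this is balanced by the positive parts at i + 1.
    by_cases h1 : k = 0
    · grind
    by_cases h2 : k = i
    · grind
    by_cases h3 : k = i + 1
    · grind
    by_cases h4 : k = i + 2
    · grind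
    grind
  | v k =>
    simp only [labMult_fork_v ht, Lab.v.injEq, reduceCtorEq, if_false, Coord.overlap, pos]
    by_cases h1 : k = 0
    · grind
    by_cases h2 : k = i
    · grind
    by_cases h3 : k = i + 1
    · grind
    by_cases h4 : k = i + 2
    · grind
    grind

/-- The same compensation as in `labMult_fork_mid`: the branch compares x_2 with x̄_2, but its
effect on the counts depends only on comparing x_1 with x̄_1. -/
theorem labMult_fork_zero {t : AffineType} (ht : t = .B1 ∨ t = .A2odd) {l : ℕ} {b b' : Coord n}
    (hn : 3 ≤ n)
    (hb' : (b.Xb 2 < b.X 2 ∧ (∀ k, b'.Xb k = if k = 1 then b.Xb k + 1 else b.Xb k) ∧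
      (∀ k, b'.X k = if k = 2 then b.X k - 1 else b.X k)) ∨
      (b.X 2 ≤ b.Xb 2 ∧ (∀ k, b'.X k = if k = 1 then b.X k - 1 else b.X k) ∧
      (∀ k, b'.Xb k = if k = 2 then b.Xb k + 1 else b.Xb k)))
    (a : Lab) :
    labMult t l b' a = if b.Xb 1 < b.X 1 then
      labMult t l b a - (if a = .u 1 then 1 else 0) + (if a = .v 2 then 1 else 0)
      else labMult t l b a - (if a = .u 2 then 1 else 0) + (if a = .v 1 then 1 else 0) := by
  cases a with
  | w => simp [labMult_fork_w ht]
  | u k =>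
    simp only [labMult_fork_u ht, Lab.u.injEq, reduceCtorEq, if_false, Coord.overlap, pos]
    by_cases h1 : k = 0
    · grind
    by_cases h2 : k = 1
    · grind
    by_cases h3 : k = 2
    · grind
    by_cases h4 : k = 3
    · grind
    grind
  | v k =>
    simp only [labMult_fork_v ht, Lab.v.injEq, reduceCtorEq, if_false, Coord.overlap, pos]
    by_cases h1 : k = 0
    · grind
    by_cases h2 : k = 1
    · grind
    by_cases h3 : k = 2
    · grind
    by_cases h4 : k = 3
    · grind
    grind

/-- The number of 𝐮_0 is x_0 + 2 min(x_n, x̄_n). It moves by one in the same direction in both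
branches: x_0 carries the parity, and the minimum changes when x_0 is unsuitable. -/
theorem labMult_B1_top {l : ℕ} {b b' : Coord n} (hn : 3 ≤ n)
    (hb' : (b.X 0 = 1 ∧ (∀ k, b'.Xb k = b.Xb k) ∧
      (∀ k, b'.X k = if k = n then b.X k + 1 else if k = 0 then b.X k - 1 else b.X k)) ∨
      (b.X 0 = 0 ∧ (∀ k, b'.X k = if k = 0 then b.X k + 1 else b.X k) ∧
      (∀ k, b'.Xb k = if k = n then b.Xb k - 1 else b.Xb k)))
    (a : Lab) :
    labMult .B1 l b' a = if b.X n < b.Xb n then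
      labMult .B1 l b a - (if a = .v n then 1 else 0) + (if a = .u 0 then 1 else 0)
      else labMult .B1 l b a - (if a = .u 0 then 1 else 0) + (if a = .u n then 1 else 0) := by
  have ht : AffineType.B1 = .B1 ∨ AffineType.B1 = .A2odd := .inl rfl
  cases a with
  | w => simp [labMult_fork_w ht]
  | u k =>
    simp only [labMult_fork_u ht, Lab.u.injEq, reduceCtorEq, if_false, Coord.overlap, pos]
    by_cases h1 : k = 0
    · grind
    by_cases h2 : k = n
    · grind
    grind
  | v k =>
    simp only [labMult_fork_v ht, Lab.v.injEq, reduceCtorEq, if_false, Coord.overlap, pos]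
    by_cases h1 : k = 0
    · grind
    by_cases h2 : k = n
    · grind
    grind

/-- Here x_n - x̄_n rises by 2. It stays nonpositive, passes from -1 to 1, or starts nonnegative;
these are the three combinations of two successive moves 𝐯_n → 𝐮_0 and 𝐮_0 → 𝐮_n. -/
theorem labMult_A2odd_top {l : ℕ} {b b' : Coord n} (hn : 3 ≤ n)
    (hX : ∀ k, b'.X k = if k = n then b.X k + 1 else b.X k)
    (hXb : ∀ k, b'.Xb k = if k = n then b.Xb k - 1 else b.Xb k) (a : Lab) :
    labMult .A2odd l b' a =
      if b.X n + 1 < b.Xb n then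
        labMult .A2odd l b a - (if a = .v n then 2 else 0) + (if a = .u 0 then 2 else 0)
      else if b.X n < b.Xb n then
        labMult .A2odd l b a - (if a = .v n then 1 else 0) + (if a = .u n then 1 else 0)
      else labMult .A2odd l b a - (if a = .u 0 then 2 else 0) + (if a = .u n then 2 else 0) := by
  have ht : AffineType.A2odd = .B1 ∨ AffineType.A2odd = .A2odd := .inr rfl
  cases a with
  | w => simp [labMult_fork_w ht]
  | u k =>
    simp only [labMult_fork_u ht, Lab.u.injEq, reduceCtorEq, if_false, Coord.overlap, pos]
    by_cases h1 : k = 0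
    · grind
    by_cases h2 : k = n
    · grind
    grind
  | v k =>
    simp only [labMult_fork_v ht, Lab.v.injEq, reduceCtorEq, if_false, Coord.overlap, pos]
    by_cases h1 : k = 0
    · grind
    by_cases h2 : k = n
    · grind
    grind

/-- The overlap enters both counts and cancels. Hence the test in `stepE` between 𝐮_k and 𝐯_k is the
comparison of x_k with x̄_k. -/
theorem labMult_fork_lt {t : AffineType} (ht : t = .B1 ∨ t = .A2odd) (l : ℕ) (b : Coord n) {k : ℕ}
    (h0 : 0 < k) (hk : k ≤ n) :
    labMult t l b (.v k) - labMult t l b (.u k) = b.Xb k - b.X k := by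
  rw [labMult_fork_u ht, labMult_fork_v ht]
  simp only [pos]
  grind

theorem labMult_rawE_fork {t : AffineType} (ht : t = .B1 ∨ t = .A2odd) {l i : ℕ} {b : Coord n}
    (hn : minRank t ≤ n) (hi : i ≤ n) (hb : b.Mem t l) :
    labMult t l (rawE t i b) =
      if isDouble t n i then (labMoves t n i).stepE ((labMoves t n i).stepE (labMult t l b))
      else (labMoves t n i).stepE (labMult t l b) := by
  have hn3 : 3 ≤ n := by rcases ht with rfl | rfl <;> exact hn
  rw [Coord.mem_iff] at hb
  obtain ⟨hx, hxb, h0, hs⟩ := hb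
  by_cases hi0 : i = 0
  · subst hi0
    have hr : rawE t 0 b =
        if b.X 2 > b.Xb 2 then (b.addX 2 (-1)).addXb 1 1 else (b.addX 1 (-1)).addXb 2 1 := by
      rcases ht with rfl | rfl <;> rfl
    have hd : isDouble t n 0 = false := by
      rcases ht with rfl | rfl <;> simp [isDouble]; omega
    have hm : labMoves t n 0 = ⟨.u 1, .v 2, .u 2, .v 1, false⟩ := by
      rw [labMoves_fork _ ht]; rfl
    simp only [hd, hm, Bool.false_eq_true, if_false]
    funext a
    rw [LabMoves.stepE_apply, labMult_fork_zero ht hn3 (b := b) (b' := rawE t 0 b)]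
    · have : 0 < labMult t l b (.u 1) ↔ b.Xb 1 < b.X 1 := by
        rw [labMult_fork_u ht]; simp only [Coord.overlap, pos]; grind
      simp only [this, Bool.false_eq_true, if_false]
    · rw [hr]
      split_ifs with h
      · refine .inl ⟨h, fun k => ?_, fun k => ?_⟩ <;>
          simp only [Coord.X_addX, Coord.Xb_addX, Coord.X_addXb, Coord.Xb_addXb] <;> grind
      · refine .inr ⟨not_lt.mp h, fun k => ?_, fun k => ?_⟩ <;>
          simp only [Coord.X_addX, Coord.Xb_addX, Coord.X_addXb, Coord.Xb_addXb] <;> grind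
  by_cases hin : i = n
  · subst hin
    have hm : labMoves t i i = ⟨.v i, .u 0, .u 0, .u i, true⟩ := by
      rw [labMoves_fork _ ht, if_neg hi0, if_neg (by omega), if_pos rfl]
    have hlt := labMult_fork_lt ht l b (Nat.pos_of_ne_zero hi0) le_rfl
    rcases ht with rfl | rfl
    · have hd : isDouble .B1 i i = false := rfl
      have hr : rawE .B1 i b = if b.X 0 = 1 then (b.addX i 1).addX 0 (-1)
          else (b.addX 0 1).addXb i (-1) := by
        rw [rawE_B1, if_neg hi0, if_pos rfl]
      simp only [hd, hm, Bool.false_eq_true, if_false]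
      funext a
      rw [LabMoves.stepE_apply, labMult_B1_top hn3 (b := b) (b' := rawE .B1 i b)]
      · grind
      · rw [hr]
        have := hs.1
        have := hx 0
        split_ifs with h
        · refine .inl ⟨h, fun k => ?_, fun k => ?_⟩ <;>
            simp only [Coord.X_addX, Coord.Xb_addX, Coord.X_addXb, Coord.Xb_addXb] <;> grind
        · refine .inr ⟨by omega, fun k => ?_, fun k => ?_⟩ <;>
            simp only [Coord.X_addX, Coord.Xb_addX, Coord.X_addXb, Coord.Xb_addXb] <;> grind
    · have hd : isDouble .A2odd i i = true := by simp [isDouble]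
      have hr : rawE .A2odd i b = (b.addX i 1).addXb i (-1) := by
        rw [rawE_A2odd, if_neg hi0, if_pos rfl]
      simp only [hd, hm, if_true]
      funext a
      rw [LabMoves.stepE_apply, labMult_A2odd_top hn3 (b := b) (b' := rawE .A2odd i b)]
      · simp only [LabMoves.stepE_apply, if_true]
        grind
      · intro k
        rw [hr]
        simp only [Coord.X_addX, Coord.Xb_addX, Coord.X_addXb, Coord.Xb_addXb]; grind
      · intro k
        rw [hr]
        simp only [Coord.X_addX, Coord.Xb_addX, Coord.X_addXb, Coord.Xb_addXb]; grind
  · have hr : rawE t i b =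
        if b.X (i + 1) > b.Xb (i + 1) then (b.addX i 1).addX (i + 1) (-1)
        else (b.addXb (i + 1) 1).addXb i (-1) := by
      rcases ht with rfl | rfl
      · rw [rawE_B1, if_neg hi0, if_neg hin]
      · rw [rawE_A2odd, if_neg hi0, if_neg hin]
    have hd : isDouble t n i = false := by
      rcases ht with rfl | rfl <;> simp [isDouble, hin]
    -- Color 1 has the same moves as the colors up to n - 1, only without splitting. This makes no
    -- difference to the test, since 𝐮_1 and 𝐯_1 do not occur together.
    have hm : labMoves t n i = ⟨.v i, .v (i + 1), .u (i + 1), .u i, decide (i ≠ 1)⟩ := by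
      rw [labMoves_fork _ ht]
      split_ifs with h
      · subst h; rfl
      · simp [h]
    simp only [hd, hm, Bool.false_eq_true, if_false]
    have hlt := labMult_fork_lt ht l b (Nat.pos_of_ne_zero hi0) hi
    funext a
    rw [LabMoves.stepE_apply, labMult_fork_mid ht (Nat.pos_of_ne_zero hi0) (by omega) (b := b)
      (b' := rawE t i b)]
    · have : (if decide (i ≠ 1) = true then labMult t l b (.u i) else 0) < labMult t l b (.v i) ↔
          b.X i < b.Xb i := by
        by_cases h1 : i = 1
        · subst h1
          rw [labMult_fork_v ht]; simp [Coord.overlap, pos]; grind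
        · simp only [h1, ne_eq, not_false_eq_true, decide_true, if_true]
          omega
      simp only [this]
    · rw [hr]
      split_ifs with h
      · refine .inl ⟨h, fun k => ?_, fun k => ?_⟩ <;>
          simp only [Coord.X_addX, Coord.Xb_addX, Coord.X_addXb, Coord.Xb_addXb] <;> grind
      · refine .inr ⟨not_lt.mp h, fun k => ?_, fun k => ?_⟩ <;>
          simp only [Coord.X_addX, Coord.Xb_addX, Coord.X_addXb, Coord.Xb_addXb] <;> grind

/-- That the result lies in the crystal is needed: otherwise `stepE` makes the empty move from the
dummy label to itself, whereas `rawE` makes a coordinate negative. -/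
theorem labMult_rawE_A1 {l i : ℕ} {b : Coord n} (hn : minRank .A1 ≤ n) (hi : i ≤ n)
    (hb : b.Mem .A1 l) (hb' : (rawE .A1 i b).Mem .A1 l) :
    labMult .A1 l (rawE .A1 i b) = (labMoves .A1 n i).stepE (labMult .A1 l b) := by
  rw [canE_labMult hn hi hb] at hb'
  have := pred_mod_spec hi
  funext a
  simp only [labMult_A1, labMoves, LabMoves.stepE_apply, LabMoves.canE, isDouble, decide_true,
      decide_false, eq_self, reduceIte, Bool.false_eq_true] at hb' ⊢
  cases a <;> simp [rawE_A1, Coord.X_addX] at hb' ⊢ <;> grind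

set_option maxHeartbeats 2000000 in
theorem labMult_rawE_line {t : AffineType} (ht : t = .C1 ∨ t = .A2even ∨ t = .D2)
    {l i : ℕ} {b : Coord n} (hn : minRank t ≤ n) (hi : i ≤ n) (hb : b.Mem t l) (hb' : (rawE t i b).Mem t l) :
    labMult t l (rawE t i b) =
      if isDouble t n i then (labMoves t n i).stepE ((labMoves t n i).stepE (labMult t l b))
      else (labMoves t n i).stepE (labMult t l b) := by
  rw [canE_labMult hn hi hb] at hb'
  funext a
  rw [Coord.mem_iff] at hb
  obtain ⟨hx, hxb, h0, hs⟩ := hb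
  cases t
  case A1 => simp at ht
  case B1 => simp at ht
  case A2odd => simp at ht
  all_goals
    simp only [minRank] at hn
    simp only [labMult_line, labMoves_C1, labMoves_A2even, labMoves_D2, Coord.ShapeX, true_or,
        or_true, numLayers, rawE_C1, rawE_A2even, rawE_D2, Bool.false_eq_true, if_false] at hs hb' ⊢
    by_cases hi0 : i = 0
    · subst hi0
      simp only [if_true, if_false, reduceIte, LabMoves.stepE_apply, LabMoves.canE, isDouble,
          decide_true, decide_false, eq_self, reduceIte, Bool.false_eq_true] at hb' ⊢
      cases a <;> split_ifs <;>
        (try simp (disch := omega) only [Coord.X_addX, Coord.Xb_addX, Coord.X_addXb,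
          Coord.Xb_addXb, Coord.total_addX, Coord.total_addXb]) <;>
        (try simp at *) <;> grind
    by_cases hin : i = n
    · subst hin
      simp only [if_true, hi0, if_false, LabMoves.stepE_apply, LabMoves.canE, isDouble,
          decide_true, decide_false, eq_self, reduceIte, Bool.false_eq_true] at hb' ⊢
      cases a <;> split_ifs <;>
        (try simp (disch := omega) only [Coord.X_addX, Coord.Xb_addX, Coord.X_addXb,
          Coord.Xb_addXb, Coord.total_addX, Coord.total_addXb]) <;>
        (try simp at *) <;> grind
    · simp only [if_true, hi0, hin, if_false, LabMoves.stepE_apply, LabMoves.canE, isDouble,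
          decide_true, decide_false, eq_self, reduceIte, Bool.false_eq_true] at hb' ⊢
      cases a <;> split_ifs <;>
        (try simp (disch := omega) only [Coord.X_addX, Coord.Xb_addX, Coord.X_addXb,
          Coord.Xb_addXb, Coord.total_addX, Coord.total_addXb]) <;>
        (try simp at *) <;> grind


theorem labMult_rawE {t : AffineType} {l i : ℕ} {b : Coord n} (hn : minRank t ≤ n) (hi : i ≤ n)
    (hb : b.Mem t l) (hb' : (rawE t i b).Mem t l) :
    labMult t l (rawE t i b) =
      if isDouble t n i then (labMoves t n i).stepE ((labMoves t n i).stepE (labMult t l b))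
      else (labMoves t n i).stepE (labMult t l b) := by
  cases t
  case A1 => exact labMult_rawE_A1 hn hi hb hb'
  case B1 => exact labMult_rawE_fork (.inl rfl) hn hi hb
  case A2odd => exact labMult_rawE_fork (.inr rfl) hn hi hb
  case C1 => exact labMult_rawE_line (.inl rfl) hn hi hb hb'
  case A2even => exact labMult_rawE_line (.inr (.inl rfl)) hn hi hb hb'
  case D2 => exact labMult_rawE_line (.inr (.inr rfl)) hn hi hb hb'

/-- The two branches are governed by whether q outnumbers r. After q → p the count of q is still at
least that of r, so f̃ takes p → q; after s → r the count of r exceeds that of q, so f̃ takes r → s.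
No positivity is needed. -/
theorem LabMoves.stepF_stepE_of_split {m : LabMoves} (hs : m.split = true) (h1 : m.q ≠ m.p)
    (h2 : m.s ≠ m.r) (h3 : m.p ≠ m.r) (h4 : m.q ≠ m.s) (h5 : m.q ≠ m.r) (g : Lab → ℤ) :
    m.stepF (m.stepE g) = g := by
  funext x
  simp only [LabMoves.stepF_apply, LabMoves.stepE_apply, hs, if_true]
  grind

/-- Without splitting the branches are recognized by the presence of q or of r. After q → p no r may
remain, and s → r must really create an r. -/
theorem LabMoves.stepF_stepE_of_not_split {m : LabMoves} (hs : m.split = false)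
    {g : Lab → ℤ} (hE : m.canE g) (hr : 0 ≤ g m.r) (hqr : 0 < g m.q → relabel m.q m.p g m.r ≤ 0)
    (hsr : m.s ≠ m.r ∨ g m.s ≤ 0) :
    m.stepF (m.stepE g) = g := by
  funext x
  simp only [LabMoves.canE, hs, Bool.false_eq_true, if_false] at hE
  simp only [relabel] at hqr
  simp only [LabMoves.stepF_apply, LabMoves.stepE_apply, hs, Bool.false_eq_true, if_false]
  by_cases h : 0 < g m.q
  · have := hqr h
    simp only [h, if_true]
    grind
  · simp only [h, if_false]
    grind

theorem isDouble_split {t : AffineType} {i : ℕ} (hn : minRank t ≤ n)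
    (h : isDouble t n i = true) : (labMoves t n i).split = true := by
  cases t <;> simp only [isDouble, Bool.false_eq_true, decide_eq_true_eq] at h
  · subst h; rfl
  · subst h
    simp only [minRank] at hn
    rw [labMoves_fork _ (.inr rfl), if_neg (by omega), if_neg (by omega), if_pos rfl]

theorem labMoves_split_ne {t : AffineType} {i : ℕ} (hs : (labMoves t n i).split = true) :
    (labMoves t n i).q ≠ (labMoves t n i).p ∧ (labMoves t n i).s ≠ (labMoves t n i).r ∧
    (labMoves t n i).p ≠ (labMoves t n i).r ∧ (labMoves t n i).q ≠ (labMoves t n i).s ∧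
    (labMoves t n i).q ≠ (labMoves t n i).r := by
  cases t
  case A1 => simp [labMoves] at hs
  all_goals
    simp only [labMoves] at hs ⊢
    split_ifs at hs ⊢ <;> simp_all <;> omega

theorem labMult_nonneg {t : AffineType} {l : ℕ} {b : Coord n} (hb : b.Mem t l) (a : Lab) :
    0 ≤ labMult t l b a := by
  rw [Coord.mem_iff] at hb
  obtain ⟨hx, hxb, h0, hs⟩ := hb
  cases t
  case A1 => rw [labMult_A1]; cases a <;> simp [hx]
  case B1 => rw [labMult_fork _ _ (.inl rfl)]; cases a <;> simp only [Coord.overlap, pos] <;> grind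
  case A2odd =>
    rw [labMult_fork _ _ (.inr rfl)]; cases a <;> simp only [Coord.overlap, pos] <;> grind
  all_goals
    rw [labMult_line _ _ (by simp)]
    simp only [Coord.ShapeX] at hs
    cases a <;> simp only [numLayers, hx, hxb] <;> grind

/-- Without splitting this uses properties of actual counts: 𝐮_1 and 𝐯_1 exclude each other for B
and A_odd, and 𝐮_0 occurs at most once for D, where it is both q and r for i = n. -/
theorem stepF_stepE_labMult {t : AffineType} {l i : ℕ} {b : Coord n} (hn : minRank t ≤ n)
    (hb : b.Mem t l) (hE : (labMoves t n i).canE (labMult t l b)) :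
    (labMoves t n i).stepF ((labMoves t n i).stepE (labMult t l b)) = labMult t l b := by
  cases hs : (labMoves t n i).split
  case true =>
    obtain ⟨h1, h2, h3, h4, h5⟩ := labMoves_split_ne hs
    exact LabMoves.stepF_stepE_of_split hs h1 h2 h3 h4 h5 _
  refine LabMoves.stepF_stepE_of_not_split hs hE (labMult_nonneg hb _) ?_ ?_
  all_goals
    clear hE
    rw [Coord.mem_iff] at hb
    obtain ⟨hx, hxb, h0, hsh⟩ := hb
    try unfold relabel
    cases t
    case A1 => simp [labMoves, labMult_A1]
    case B1 =>
      simp only [minRank] at hn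
      simp only [labMoves] at hs ⊢
      split_ifs at hs ⊢ <;>
        simp only [labMult_fork l b (t := .B1) (.inl rfl), Coord.overlap, pos] <;> grind
    case A2odd =>
      simp only [minRank] at hn
      simp only [labMoves] at hs ⊢
      split_ifs at hs ⊢ <;>
        simp only [labMult_fork l b (t := .A2odd) (.inr rfl), Coord.overlap, pos] <;> grind
    all_goals
      simp only [minRank, Coord.ShapeX] at hn hsh
      simp only [labMoves] at hs ⊢
      rw [labMult_line l b (by simp)]
      split_ifs at hs ⊢ <;> grind

/-- No new case analysis: b is the image of f̃_i b under ẽ_i, and the moves of ẽ_i can be undone. -/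
theorem labMult_rawF {t : AffineType} {l i : ℕ} {b : Coord n} (hn : minRank t ≤ n) (hi : i ≤ n)
    (hb : b.Mem t l) (hb' : (rawF t i b).Mem t l) :
    labMult t l (rawF t i b) =
      if isDouble t n i then (labMoves t n i).stepF ((labMoves t n i).stepF (labMult t l b))
      else (labMoves t n i).stepF (labMult t l b) := by
  have h1 : rawE t i (rawF t i b) = b := rawE_rawF hn hi hb
  have h2 : (rawE t i (rawF t i b)).Mem t l := h1.symm ▸ hb
  have h3 := labMult_rawE hn hi hb' h2
  rw [h1] at h3
  rw [h3]
  split_ifs with hd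
  -- For two-block colors the intermediate count need not belong to any element of the crystal, so
  -- the inversion valid for arbitrary functions is used.
  · obtain ⟨e1, e2, e3, e4, e5⟩ := labMoves_split_ne (isDouble_split hn hd)
    rw [LabMoves.stepF_stepE_of_split (isDouble_split hn hd) e1 e2 e3 e4 e5,
      LabMoves.stepF_stepE_of_split (isDouble_split hn hd) e1 e2 e3 e4 e5]
  · rw [stepF_stepE_labMult hn hb' ((canE_labMult hn hi hb').mp h2)]

end YoungSlice

/-! ### Labels of columns, and the effect of adding or removing a block -/

namespace YoungSlice

set_option linter.unusedSimpArgs false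
set_option linter.unnecessarySeqFocus false

/-- The label of (the top of) a column. -/
def Column.lab : (t : AffineType) → (n : ℕ) → Pattern t n → Column → Lab
  | .A1, n, p, c => .u ((Fin.val (n := n + 1) p + c.full + n) % (n + 1))
  | .B1, n, p, c =>
      match c.half with
      | some s => if (row .B1 n p c.full).sideColor s = some 0 then .u 1 else .v 1
      | none =>
        let k := c.full % (2 * n - 1)
        if k = 0 then .v 2 else if k < n then .u (k + 1) else if k = n then .u 0
        else .v (2 * n + 1 - k)
  | .A2odd, n, p, c =>
      match c.half with
      | some s => if (row .A2odd n p c.full).sideColor s = some 0 then .u 1 else .v 1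
      | none =>
        let k := c.full % (2 * n - 1)
        if k = 0 then .v 2 else if k < n then .u (k + 1) else if k = n then .u 0
        else .v (2 * n + 1 - k)
  | .C1, n, _, c =>
      let k := c.full % (2 * n + 1)
      if k = 0 then .v 1 else if k = 1 then .w else if k ≤ n + 1 then .u (k - 1)
      else .v (2 * n + 2 - k)
  | .A2even, n, _, c =>
      let k := c.full % (2 * n + 1)
      if k = 0 then .v 1 else if k = 1 then .w else if k ≤ n + 1 then .u (k - 1)
      else .v (2 * n + 2 - k)
  | .D2, n, _, c =>
      let k := c.full % (2 * n + 2)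
      if k = 0 then .v 1 else if k = 1 then .w else if k ≤ n + 1 then .u (k - 1)
      else if k = n + 2 then .u 0 else .v (2 * n + 3 - k)

theorem succ_mod_cases {P : ℕ} (hP : 0 < P) (r : ℕ) :
    (r % P + 1 = P ∧ (r + 1) % P = 0) ∨ (r % P + 1 < P ∧ (r + 1) % P = r % P + 1) := by
  have h := Nat.mod_lt r hP
  rw [Nat.add_mod r 1 P]
  rcases Nat.lt_or_ge (r % P + 1) P with h1 | h1
  · right
    refine ⟨h1, ?_⟩
    rw [Nat.mod_eq_of_lt (show 1 < P by omega), Nat.mod_eq_of_lt h1]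
  · left
    have : r % P + 1 = P := by omega
    refine ⟨this, ?_⟩
    rcases Nat.lt_or_ge 1 P with h2 | h2
    · rw [Nat.mod_eq_of_lt h2, this, Nat.mod_self]
    · have : P = 1 := by omega
      subst this
      exact Nat.mod_one _

theorem period_pos {t : AffineType} {n : ℕ} (hn : minRank t ≤ n) : 0 < period t n := by
  cases t <;> simp only [period, minRank] at * <;> omega

-- A comparison of residues of the height modulo the period. The two types left out share rows,
-- labels and moves with B and A_even.
set_option maxHeartbeats 1000000 in
theorem remove_lab_of_ne {t : AffineType} {n : ℕ} (ht : t ≠ .A2odd ∧ t ≠ .C1)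
    (hn : minRank t ≤ n) (p : Pattern t n) {i : ℕ}
    (hi : i ≤ n) {c c' : Column} (h : c.remove t n p i = some c') :
    (c.lab t n p = (labMoves t n i).q ∧ c'.lab t n p = (labMoves t n i).p) ∨
    (c.lab t n p = (labMoves t n i).s ∧ c'.lab t n p = (labMoves t n i).r) := by
  obtain ⟨full, half⟩ := c
  have hP := period_pos hn
  cases t <;> simp only [minRank, period] at hn hP
  case A2odd => exact absurd rfl ht.1
  case C1 => exact absurd rfl ht.2
  case A1 =>
    left
    cases half with
    | some s => simp [Column.remove, row, Row.sideColor] at h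
    | none =>
      cases full with
      | zero => simp [Column.remove] at h
      | succ r =>
        simp only [Column.remove, row, Option.ite_none_right_eq_some, Option.some.injEq] at h
        obtain ⟨h1, rfl⟩ := h
        simp only [Column.lab, labMoves, ← h1, Lab.u.injEq, Nat.mod_add_mod, and_true]
        rw [show Fin.val (n := n + 1) p + (r + 1) + n = Fin.val (n := n + 1) p + r + (n + 1) by ring,
          Nat.add_mod_right]
  case B1 =>
    rw [labMoves_fork _ (by simp)]
    change Bool at p
    cases half with
    | some s =>
      simp only [Column.remove, row, forkRow, Column.lab] at h ⊢
      split_ifs at h <;> cases p <;> cases s <;> simp [Row.sideColor] at * <;> grind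
    | none =>
      cases full with
      | zero => simp [Column.remove] at h
      | succ r =>
        have h1 := succ_mod_cases hP r
        have h2 := Nat.mod_lt r hP
        simp only [Column.remove, row, forkRow] at h
        simp only [Column.lab, row, forkRow]
        by_cases hk0 : r % (2 * n - 1) = 0
        · cases p <;> simp only [hk0, if_true, Bool.false_eq_true, if_false] at h ⊢ <;>
            split_ifs at h <;> cases h <;>
            simp [Row.sideColor, hk0] <;> grind
        · simp only [hk0, if_false] at h
          split_ifs at h <;> simp only [Option.ite_none_right_eq_some, Option.some.injEq] at h <;>
            obtain ⟨rfl, rfl⟩ := h <;> simp only [Column.lab] <;> grind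
  all_goals
    simp only [labMoves_C1, labMoves_A2even, labMoves_D2]
    cases half with
    | some s => simp [Column.remove, row, Row.sideColor] at h
    | none =>
      cases full with
      | zero => simp [Column.remove] at h
      | succ r =>
        have h1 := succ_mod_cases hP r
        have h2 := Nat.mod_lt r hP
        simp only [Column.remove, row, Option.ite_none_right_eq_some, Option.some.injEq] at h
        obtain ⟨h, rfl⟩ := h
        simp only [Column.lab]
        clear hP
        generalize r % _ = k at *
        generalize (r + 1) % _ = k' at *
        subst h
        split_ifs <;> grind

/-- What removing an `i`-block from a column does to the labels. -/
theorem remove_lab {t : AffineType} {n : ℕ} (hn : minRank t ≤ n) (p : Pattern t n) {i : ℕ}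
    (hi : i ≤ n) {c c' : Column} (h : c.remove t n p i = some c') :
    (c.lab t n p = (labMoves t n i).q ∧ c'.lab t n p = (labMoves t n i).p) ∨
    (c.lab t n p = (labMoves t n i).s ∧ c'.lab t n p = (labMoves t n i).r) := by
  cases t
  -- The rows, labels and moves involved agree definitionally for the two types; the same holds for
  -- C and A_even in the next case.
  case A2odd => exact remove_lab_of_ne (t := .B1) (by simp) hn p hi h
  case C1 => exact remove_lab_of_ne (t := .A2even) (by simp) (Nat.le_of_succ_le hn) p hi h
  all_goals exact remove_lab_of_ne (by simp) hn p hi h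

set_option maxHeartbeats 1000000 in
theorem add_lab_of_ne {t : AffineType} {n : ℕ} (ht : t ≠ .A2odd ∧ t ≠ .C1)
    (hn : minRank t ≤ n) (p : Pattern t n) {i : ℕ}
    (hi : i ≤ n) {c c' : Column} (h : c.add t n p i = some c') :
    (c.lab t n p = (labMoves t n i).r ∧ c'.lab t n p = (labMoves t n i).s) ∨
    (c.lab t n p = (labMoves t n i).p ∧ c'.lab t n p = (labMoves t n i).q) := by
  obtain ⟨r, half⟩ := c
  have hP := period_pos hn
  have h1 := succ_mod_cases hP r
  have h2 := Nat.mod_lt r hP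
  cases t <;> simp only [minRank, period] at hn hP h1 h2
  case A2odd => exact absurd rfl ht.1
  case C1 => exact absurd rfl ht.2
  case A1 =>
    right
    cases half with
    | some s => simp [Column.add, row, Row.sideColor] at h
    | none =>
      simp only [Column.add, row, Option.ite_none_right_eq_some, Option.some.injEq] at h
      obtain ⟨h1, rfl⟩ := h
      simp only [Column.lab, labMoves, ← h1, Lab.u.injEq, Nat.mod_add_mod, true_and]
      rw [show Fin.val (n := n + 1) p + (r + 1) + n = Fin.val (n := n + 1) p + r + (n + 1) by ring,
        Nat.add_mod_right]
  case B1 =>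
    rw [labMoves_fork _ (by simp)]
    change Bool at p
    cases half with
    | some s =>
      simp only [Column.add, row, forkRow, Column.lab] at h ⊢
      split_ifs at h <;> cases p <;> cases s <;> simp [Row.sideColor] at * <;>
        obtain ⟨rfl, rfl⟩ := h <;> simp only [Column.lab] <;> grind
    | none =>
      simp only [Column.add, row, forkRow] at h
      simp only [Column.lab, row, forkRow]
      by_cases hk0 : r % (2 * n - 1) = 0
      · cases p <;> simp only [hk0, if_true, Bool.false_eq_true, if_false] at h ⊢ <;>
          split_ifs at h <;> cases h <;>
          simp [Row.sideColor, hk0] <;> grind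
      · simp only [hk0, if_false] at h
        split_ifs at h <;> simp only [Option.ite_none_right_eq_some, Option.some.injEq] at h <;>
          obtain ⟨rfl, rfl⟩ := h <;> simp only [Column.lab] <;> grind
  all_goals
    simp only [labMoves_C1, labMoves_A2even, labMoves_D2]
    cases half with
    | some s => simp [Column.add, row, Row.sideColor] at h
    | none =>
      simp only [Column.add, row, Option.ite_none_right_eq_some, Option.some.injEq] at h
      obtain ⟨h, rfl⟩ := h
      simp only [Column.lab]
      clear hP
      generalize r % _ = k at *
      generalize (r + 1) % _ = k' at *
      subst h
      split_ifs <;> grind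

/-- What adding an `i`-block to a column does to the labels. -/
theorem add_lab {t : AffineType} {n : ℕ} (hn : minRank t ≤ n) (p : Pattern t n) {i : ℕ}
    (hi : i ≤ n) {c c' : Column} (h : c.add t n p i = some c') :
    (c.lab t n p = (labMoves t n i).r ∧ c'.lab t n p = (labMoves t n i).s) ∨
    (c.lab t n p = (labMoves t n i).p ∧ c'.lab t n p = (labMoves t n i).q) := by
  cases t
  case A2odd => exact add_lab_of_ne (t := .B1) (by simp) hn p hi h
  case C1 => exact add_lab_of_ne (t := .A2even) (by simp) (Nat.le_of_succ_le hn) p hi h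
  all_goals exact add_lab_of_ne (by simp) hn p hi h

set_option maxHeartbeats 1000000 in
theorem exists_remove_of_ne {t : AffineType} {n : ℕ} (ht : t ≠ .A2odd ∧ t ≠ .C1)
    (hn : minRank t ≤ n) (p : Pattern t n) {i : ℕ}
    (hi : i ≤ n) {c : Column} (hv : c.Valid t n p) (hpos : 0 < c.full)
    (h : c.lab t n p = (labMoves t n i).q ∨ c.lab t n p = (labMoves t n i).s) :
    (c.remove t n p i).isSome = true := by
  obtain ⟨full, half⟩ := c
  obtain ⟨r, rfl⟩ : ∃ r, full = r + 1 := ⟨full - 1, by simp only at hpos; omega⟩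
  have hP := period_pos hn
  have h1 := succ_mod_cases hP r
  have h2 := Nat.mod_lt r hP
  cases t <;> simp only [minRank, period] at hn hP h1 h2
  case A2odd => exact absurd rfl ht.1
  case C1 => exact absurd rfl ht.2
  case A1 =>
    cases half with
    | some s => simp [Column.Valid, row, Row.isPair] at hv
    | none =>
      simp only [Column.remove, row, Option.isSome_ite]
      simp only [Column.lab, labMoves, Lab.u.injEq, reduceCtorEq, or_false] at h
      rw [← h, show Fin.val (n := n + 1) p + (r + 1) + n = Fin.val (n := n + 1) p + r + (n + 1) by
        ring, Nat.add_mod_right]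
  case B1 =>
    rw [labMoves_fork _ (by simp)] at h
    change Bool at p
    cases half with
    | some s =>
      simp only [Column.Valid, row, forkRow, Column.lab, Column.remove, reduceCtorEq, false_or]
        at h hv ⊢
      by_cases hk0 : (r + 1) % (2 * n - 1) = 0
      · cases p <;> cases s <;>
          simp only [hk0, if_true, Bool.false_eq_true, if_false, Row.sideColor] at h ⊢ <;> grind
      · simp only [hk0, if_false] at hv
        split_ifs at hv <;> simp [Row.isPair] at hv
    | none =>
      simp only [Column.remove, row, forkRow, Column.lab] at h ⊢
      by_cases hk0 : r % (2 * n - 1) = 0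
      · cases p <;> simp only [hk0, if_true, Bool.false_eq_true, if_false] at h ⊢ <;> grind
      · simp only [hk0, if_false]
        clear hv
        generalize r % (2 * n - 1) = k at *
        generalize (r + 1) % (2 * n - 1) = k' at *
        by_cases hk1 : k + 1 < n
        · simp only [hk1, if_true, Option.isSome_ite]; grind
        by_cases hk2 : k ≤ n
        · simp only [hk1, hk2, if_true, if_false, Option.isSome_ite]; grind
        · simp only [hk1, hk2, if_false, Option.isSome_ite]; grind
  all_goals
    simp only [labMoves_C1, labMoves_A2even, labMoves_D2] at h
    cases half with
    | some s => simp [Column.Valid, row, Row.isPair] at hv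
    | none =>
      simp only [Column.remove, row, Option.isSome_ite]
      simp only [Column.lab] at h
      clear hP hv
      generalize r % _ = k at *
      generalize (r + 1) % _ = k' at *
      split_ifs at h ⊢ <;> grind

/-- Which columns have an `i`-block on top. -/
theorem exists_remove {t : AffineType} {n : ℕ} (hn : minRank t ≤ n) (p : Pattern t n) {i : ℕ}
    (hi : i ≤ n) {c : Column} (hv : c.Valid t n p) (hpos : 0 < c.full)
    (h : c.lab t n p = (labMoves t n i).q ∨ c.lab t n p = (labMoves t n i).s) :
    (c.remove t n p i).isSome = true := by
  cases t
  case A2odd => exact exists_remove_of_ne (t := .B1) (by simp) hn p hi hv hpos h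
  case C1 =>
    exact exists_remove_of_ne (t := .A2even) (by simp)
      (Nat.le_of_succ_le hn) p hi hv hpos h
  all_goals exact exists_remove_of_ne (by simp) hn p hi hv hpos h

set_option maxHeartbeats 1000000 in
theorem exists_add_of_ne {t : AffineType} {n : ℕ} (ht : t ≠ .A2odd ∧ t ≠ .C1)
    (hn : minRank t ≤ n) (p : Pattern t n) {i : ℕ}
    (hi : i ≤ n) {c : Column} (hv : c.Valid t n p)
    (h : c.lab t n p = (labMoves t n i).r ∨ c.lab t n p = (labMoves t n i).p) :
    (c.add t n p i).isSome = true := by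
  obtain ⟨r, half⟩ := c
  have hP := period_pos hn
  have h2 := Nat.mod_lt r hP
  cases t <;> simp only [minRank, period] at hn hP h2
  case A2odd => exact absurd rfl ht.1
  case C1 => exact absurd rfl ht.2
  case A1 =>
    cases half with
    | some s => simp [Column.Valid, row, Row.isPair] at hv
    | none =>
      simp only [Column.add, row, Option.isSome_ite]
      simp only [Column.lab, labMoves, Lab.u.injEq, reduceCtorEq, false_or] at h
      -- The label is the color of the row below the slot; adding 1 turns it into the color of the
      -- slot.
      have h3 : (Fin.val (n := n + 1) p + r + n + 1) % (n + 1) = (i + n + 1) % (n + 1) := by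
        rw [Nat.add_mod _ 1, h, ← Nat.add_mod _ 1]
      rwa [add_assoc _ n 1, add_assoc _ n 1, Nat.add_mod_right, Nat.add_mod_right,
        Nat.mod_eq_of_lt (show i < n + 1 by omega)] at h3
  case B1 =>
    rw [labMoves_fork _ (by simp)] at h
    change Bool at p
    cases half with
    | some s =>
      simp only [Column.Valid, row, forkRow, Column.lab, Column.add, reduceCtorEq, false_or]
        at h hv ⊢
      by_cases hk0 : r % (2 * n - 1) = 0
      · cases p <;> cases s <;>
          simp [hk0, Row.sideColor] at h ⊢ <;> grind
      · simp only [hk0, if_false] at hv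
        split_ifs at hv <;> simp [Row.isPair] at hv
    | none =>
      simp only [Column.add, row, forkRow, Column.lab] at h ⊢
      by_cases hk0 : r % (2 * n - 1) = 0
      · cases p <;> simp only [hk0, if_true, Bool.false_eq_true, if_false] at h ⊢ <;> grind
      · simp only [hk0, if_false] at h ⊢
        clear hv
        generalize r % (2 * n - 1) = k at *
        by_cases hk1 : k + 1 < n
        · simp only [hk1, if_true, Option.isSome_ite]; grind
        by_cases hk2 : k ≤ n
        · simp only [hk1, hk2, if_true, if_false, Option.isSome_ite]; grind
        · simp only [hk1, hk2, if_false, Option.isSome_ite]; grind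
  all_goals
    simp only [labMoves_C1, labMoves_A2even, labMoves_D2] at h
    cases half with
    | some s => simp [Column.Valid, row, Row.isPair] at hv
    | none =>
      simp only [Column.add, row, Option.isSome_ite]
      simp only [Column.lab] at h
      clear hP hv
      generalize r % _ = k at *
      split_ifs at h ⊢ <;> grind

/-- Which columns have an `i`-slot. -/
theorem exists_add {t : AffineType} {n : ℕ} (hn : minRank t ≤ n) (p : Pattern t n) {i : ℕ}
    (hi : i ≤ n) {c : Column} (hv : c.Valid t n p)
    (h : c.lab t n p = (labMoves t n i).r ∨ c.lab t n p = (labMoves t n i).p) :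
    (c.add t n p i).isSome = true := by
  cases t
  case A2odd => exact exists_add_of_ne (t := .B1) (by simp) hn p hi hv h
  case C1 => exact exists_add_of_ne (t := .A2even) (by simp) (Nat.le_of_succ_le hn) p hi hv h
  all_goals exact exists_add_of_ne (by simp) hn p hi hv h

end YoungSlice

/-! ### Within one cycle, columns correspond to labels -/

namespace YoungSlice

set_option linter.unusedSimpArgs false
set_option linter.unnecessarySeqFocus false

/-- Labels which occur as tops of columns. -/
def Lab.Occurs (t : AffineType) (n : ℕ) : Lab → Prop :=
  match t with
  | .A1 => fun
      | .u i => i ≤ n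
      | _ => False
  | .B1 | .A2odd => fun
      | .u i => i ≤ n
      | .v i => 1 ≤ i ∧ i ≤ n
      | .w => False
  | .D2 => fun
      | .u i => i ≤ n
      | .v i => 1 ≤ i ∧ i ≤ n
      | .w => True
  | _ => fun
      | .u i => 1 ≤ i ∧ i ≤ n
      | .v i => 1 ≤ i ∧ i ≤ n
      | .w => True

theorem occurs_lab {t : AffineType} {n : ℕ} (hn : minRank t ≤ n) (p : Pattern t n) (c : Column) :
    (c.lab t n p).Occurs t n := by
  obtain ⟨r, half⟩ := c
  have h2 := Nat.mod_lt r (period_pos hn)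
  cases t <;> simp only [minRank, period] at hn h2
  case A1 => exact Nat.lt_succ_iff.mp (Nat.mod_lt _ (by omega))
  case B1 | A2odd =>
    cases half with
    | some s => simp only [Column.lab]; split_ifs <;> simp only [Lab.Occurs] <;> omega
    | none => simp only [Column.lab]; split_ifs <;> simp only [Lab.Occurs] <;> omega
  all_goals simp only [Column.lab]; split_ifs <;> simp only [Lab.Occurs] <;> omega

theorem labMult_eq_zero {t : AffineType} {n : ℕ} {l : ℕ} {b : Coord n}
    (hb : b.Mem t l) {a : Lab} (ha : ¬ a.Occurs t n) : labMult t l b a = 0 := by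
  rw [Coord.mem_iff] at hb
  obtain ⟨hx, hxb, h0, hs⟩ := hb
  have hX := fun k => b.X_of_lt (k := k)
  have hXb := fun k => b.Xb_of_lt (k := k)
  cases t <;> simp only [Coord.ShapeX] at hs
  case A1 => rw [labMult_A1]; cases a <;> simp only [Lab.Occurs] at ha ⊢; grind
  case B1 | A2odd =>
    cases a
    · rw [labMult_fork_u (by simp)]; simp only [Lab.Occurs] at ha; grind
    · rw [labMult_fork_v (by simp)]; simp only [Lab.Occurs] at ha; grind
    · rw [labMult_fork_w (by simp)]
  all_goals rw [labMult_line _ _ (by simp)]; cases a <;> simp only [Lab.Occurs] at ha ⊢ <;> grind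

theorem add_delta_row {t : AffineType} {n : ℕ} (p : Pattern t n) (r : ℕ) :
    row t n p (r + period t n) = row t n p r := by
  cases t
  case A1 => simp only [row, period, ← Nat.add_assoc _ r (n + 1), Nat.add_mod_right]
  all_goals simp only [row, period, Nat.add_mod_right]

theorem lab_addDelta {t : AffineType} {n : ℕ} (p : Pattern t n) (c : Column) :
    (c.addDelta t n).lab t n p = c.lab t n p := by
  obtain ⟨r, half⟩ := c
  have := add_delta_row p r
  cases t
  case A1 =>
    simp only [Column.lab, Column.addDelta, period]
    rw [show Fin.val (n := n + 1) p + (r + (n + 1)) + n = Fin.val (n := n + 1) p + r + n + (n + 1)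
      by ring, Nat.add_mod_right]
  all_goals
    simp only [period] at this
    simp only [Column.lab, Column.addDelta, period, this, Nat.add_mod_right]

/-- Two columns in the same cycle with the same label are equal. -/
theorem lab_injective {t : AffineType} {n : ℕ} (hn : minRank t ≤ n) (p : Pattern t n)
    {c d : Column} (hc : c.Valid t n p) (hd : d.Valid t n p)
    (hcd : c.full / period t n = d.full / period t n) (h : c.lab t n p = d.lab t n p) : c = d := by
  obtain ⟨r, half⟩ := c
  obtain ⟨r', half'⟩ := d
  have h1 := Nat.mod_lt r (period_pos hn)
  have h1' := Nat.mod_lt r' (period_pos hn)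
  have h2 := Nat.div_add_mod r (period t n)
  have h2' := Nat.div_add_mod r' (period t n)
  simp only at hcd
  rw [← hcd] at h2'
  -- The columns lie in the same cycle, so residue and half block determine them.
  suffices r % period t n = r' % period t n ∧ half = half' by
    obtain ⟨h3, rfl⟩ := this
    rw [h3, h2'] at h2
    rw [h2]
  clear h2 h2' hcd
  cases t <;> simp only [minRank, period] at hn h1 h1' ⊢
  case A1 =>
    simp only [Column.Valid, row, Row.isPair, Bool.false_eq_true, or_false] at hc hd
    subst hc hd
    simp only [Column.lab, Lab.u.injEq] at h
    refine ⟨?_, rfl⟩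
    have h3 : (Fin.val (n := n + 1) p + n) + r ≡ (Fin.val (n := n + 1) p + n) + r' [MOD n + 1] := by
      unfold Nat.ModEq
      convert h using 2 <;> ring
    exact Nat.ModEq.add_left_cancel' _ h3
  case B1 | A2odd =>
    change Bool at p
    -- Only the lowest row of a cycle consists of two blocks.
    have key : ∀ {r : ℕ},
        (forkRow n p (r % (2 * n - 1))).isPair = true → r % (2 * n - 1) = 0 := by
      intro r h
      simp only [forkRow] at h
      by_contra h0
      simp only [h0, if_false] at h
      split_ifs at h <;> simp [Row.isPair] at h
    cases half with
    | some s =>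
      have h3 : r % (2 * n - 1) = 0 := key (hc.resolve_left (by simp))
      cases half' with
      | some s' =>
        have h4 : r' % (2 * n - 1) = 0 := key (hd.resolve_left (by simp))
        refine ⟨h3.trans h4.symm, ?_⟩
        simp only [Column.lab, row, forkRow, h3, h4, if_true] at h
        cases p <;> cases s <;> cases s' <;> simp [Row.sideColor] at h ⊢
      | none =>
        simp only [Column.lab] at h
        grind
    | none =>
      cases half' with
      | some s' =>
        simp only [Column.lab] at h
        grind
      | none =>
        simp only [Column.lab] at h
        grind
  all_goals
    simp only [Column.Valid, row, Row.isPair, Bool.false_eq_true, or_false] at hc hd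
    subst hc hd
    simp only [Column.lab] at h
    grind

/-- Every label occurs in the second cycle. -/
theorem exists_lab {t : AffineType} {n : ℕ} (hn : minRank t ≤ n) (p : Pattern t n)
    {a : Lab} (ha : a.Occurs t n) : ∃ c : Column, c.Valid t n p ∧ c.full / period t n = 1 ∧
      c.lab t n p = a := by
  have hP := period_pos hn
  have hdiv : ∀ k, k < period t n → (k + period t n) / period t n = 1 := by
    intro k hk
    rw [Nat.add_div_right _ hP, Nat.div_eq_of_lt hk]
  cases t <;> simp only [minRank, period] at hn hP hdiv ⊢
  case A1 =>
    cases a <;> simp only [Lab.Occurs] at ha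
    case u i =>
      have hp : Fin.val (n := n + 1) p ≤ n := Nat.lt_succ_iff.mp (Fin.isLt (n := n + 1) p)
      -- The top row must be congruent to i - p, and the height is one more; n + 1 is added inside
      -- to keep the subtraction from truncating, and outside to reach the second cycle.
      refine ⟨⟨(i + (n + 1) - Fin.val (n := n + 1) p + 1) % (n + 1) + (n + 1), none⟩, .inl rfl,
        hdiv _ (Nat.mod_lt _ hP), ?_⟩
      simp only [Column.lab, Lab.u.injEq]
      rw [show Fin.val (n := n + 1) p + ((i + (n + 1) - Fin.val (n := n + 1) p + 1) % (n + 1) +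
        (n + 1)) + n = (i + (n + 1) - Fin.val (n := n + 1) p + 1) % (n + 1) +
        (Fin.val (n := n + 1) p + (n + 1) + n) by ring, Nat.mod_add_mod]
      rw [show i + (n + 1) - Fin.val (n := n + 1) p + 1 + (Fin.val (n := n + 1) p + (n + 1) + n) =
        i + (n + 1) * 3 by omega, Nat.add_mul_mod_self_left, Nat.mod_eq_of_lt (by omega)]
  case B1 | A2odd =>
    change Bool at p
    have hr : ∀ k, k < 2 * n - 1 → (k + (2 * n - 1)) % (2 * n - 1) = k := by
      intro k hk
      rw [Nat.add_mod_right, Nat.mod_eq_of_lt hk]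
    cases a <;> simp only [Lab.Occurs] at ha
    case u i =>
      by_cases h0 : i = 0
      · refine ⟨⟨n + (2 * n - 1), none⟩, .inl rfl, hdiv _ (by omega), ?_⟩
        simp only [Column.lab, hr n (by omega)]; grind
      by_cases h1 : i = 1
      -- The 0-block is in front when `p` is true, and the front is encoded by `false`.
      · refine ⟨⟨0 + (2 * n - 1), some (!p)⟩, .inr ?_, hdiv _ (by omega), ?_⟩
        · simp only [row, hr 0 (by omega), forkRow]; cases p <;> rfl
        · simp only [Column.lab, row, hr 0 (by omega), forkRow]
          cases p <;> simp [Row.sideColor, h1]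
      · refine ⟨⟨i - 1 + (2 * n - 1), none⟩, .inl rfl, hdiv _ (by omega), ?_⟩
        simp only [Column.lab, hr (i - 1) (by omega)]; grind
    case v i =>
      by_cases h1 : i = 1
      · refine ⟨⟨0 + (2 * n - 1), some p⟩, .inr ?_, hdiv _ (by omega), ?_⟩
        · simp only [row, hr 0 (by omega), forkRow]; cases p <;> rfl
        · simp only [Column.lab, row, hr 0 (by omega), forkRow]
          cases p <;> simp [Row.sideColor, h1]
      by_cases h2 : i = 2
      · refine ⟨⟨0 + (2 * n - 1), none⟩, .inl rfl, hdiv _ (by omega), ?_⟩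
        simp only [Column.lab, hr 0 (by omega)]; grind
      · refine ⟨⟨2 * n + 1 - i + (2 * n - 1), none⟩, .inl rfl, hdiv _ (by omega), ?_⟩
        simp only [Column.lab, hr (2 * n + 1 - i) (by omega)]; grind
  all_goals
    cases a <;> simp only [Lab.Occurs] at ha
  case C1.u i | A2even.u i =>
    refine ⟨⟨i + 1 + (2 * n + 1), none⟩, .inl rfl, hdiv _ (by omega), ?_⟩
    simp only [Column.lab, Nat.add_mod_right, Nat.mod_eq_of_lt (show i + 1 < 2 * n + 1 by omega)]
    grind
  case C1.v i | A2even.v i =>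
    by_cases h1 : i = 1
    · refine ⟨⟨0 + (2 * n + 1), none⟩, .inl rfl, hdiv _ (by omega), ?_⟩
      simp [Column.lab, h1]
    refine ⟨⟨2 * n + 2 - i + (2 * n + 1), none⟩, .inl rfl, hdiv _ (by omega), ?_⟩
    simp only [Column.lab, Nat.add_mod_right,
      Nat.mod_eq_of_lt (show 2 * n + 2 - i < 2 * n + 1 by omega)]
    grind
  case C1.w | A2even.w =>
    refine ⟨⟨1 + (2 * n + 1), none⟩, .inl rfl, hdiv _ (by omega), ?_⟩
    simp only [Column.lab, Nat.add_mod_right, Nat.mod_eq_of_lt (show 1 < 2 * n + 1 by omega)]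
    grind
  case D2.u i =>
    by_cases h0 : i = 0
    · refine ⟨⟨n + 2 + (2 * n + 2), none⟩, .inl rfl, hdiv _ (by omega), ?_⟩
      simp only [Column.lab, Nat.add_mod_right, Nat.mod_eq_of_lt (show n + 2 < 2 * n + 2 by omega)]
      grind
    refine ⟨⟨i + 1 + (2 * n + 2), none⟩, .inl rfl, hdiv _ (by omega), ?_⟩
    simp only [Column.lab, Nat.add_mod_right, Nat.mod_eq_of_lt (show i + 1 < 2 * n + 2 by omega)]
    grind
  case D2.v i =>
    by_cases h1 : i = 1
    · refine ⟨⟨0 + (2 * n + 2), none⟩, .inl rfl, hdiv _ (by omega), ?_⟩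
      simp [Column.lab, h1]
    refine ⟨⟨2 * n + 3 - i + (2 * n + 2), none⟩, .inl rfl, hdiv _ (by omega), ?_⟩
    simp only [Column.lab, Nat.add_mod_right,
      Nat.mod_eq_of_lt (show 2 * n + 3 - i < 2 * n + 2 by omega)]
    grind
  case D2.w =>
    refine ⟨⟨1 + (2 * n + 2), none⟩, .inl rfl, hdiv _ (by omega), ?_⟩
    simp only [Column.lab, Nat.add_mod_right, Nat.mod_eq_of_lt (show 1 < 2 * n + 2 by omega)]
    grind

end YoungSlice

/-! ### Preferred rows and splitting, in terms of labels -/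

namespace YoungSlice

set_option linter.unusedSimpArgs false
set_option linter.unnecessarySeqFocus false

/-- The cases in which the blocks labelled `q` and `s` (the slots labelled `r` and `p`) are
distinguished by being preferred or not. -/
def Sharp (t : AffineType) (i : ℕ) : Prop :=
  match t with
  | .B1 | .A2odd => 2 ≤ i
  | _ => True

theorem half_mod {n r : ℕ} {z s : Bool}
    (h : some s = none ∨ (forkRow n z (r % (2 * n - 1))).isPair = true) :
    r % (2 * n - 1) = 0 := by
  have h := h.resolve_left (by simp)
  simp only [forkRow] at h
  by_contra h0
  simp only [h0, if_false] at h
  split_ifs at h <;> simp [Row.isPair] at h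

theorem topRow_pred (r : ℕ) : Column.topRow ⟨r + 1, none⟩ = r := rfl

theorem topRow_half (r : ℕ) (s : Bool) : Column.topRow ⟨r, some s⟩ = r := by simp [Column.topRow]

/-- Identifies the preferred blocks with the label q. The exception concerns colors 0 and 1 for B
and A_odd, whose blocks lie in the 01-rows, both supporting and covering, so preference does not
distinguish q from s there. The last two clauses are used for the second block in the two-block
rule. -/
theorem receiver_topRow {t : AffineType} {n : ℕ} (hn : minRank t ≤ n) (p : Pattern t n) {i : ℕ}
    (hi : i ≤ n) {c : Column} (hv : c.Valid t n p) (hpos : 0 < c.full) :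
    (c.lab t n p = (labMoves t n i).q → receiver t n c.topRow = true) ∧
    (Sharp t i → c.lab t n p = (labMoves t n i).s → receiver t n c.topRow = false) ∧
    (isDouble t n i = true → c.lab t n p = (labMoves t n i).q → giver t n c.topRow = false) ∧
    (isDouble t n i = true → c.lab t n p = (labMoves t n i).s → giver t n c.topRow = true) := by
  obtain ⟨full, half⟩ := c
  obtain ⟨r, rfl⟩ : ∃ r, full = r + 1 := ⟨full - 1, by simp only at hpos; omega⟩
  have hP := period_pos hn
  have h1 := succ_mod_cases hP r
  have h2 := Nat.mod_lt r hP
  cases t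
  case A1 =>
    refine ⟨fun _ => rfl, fun _ h => ?_, fun h => ?_, fun h => ?_⟩
    · simp [Column.lab, labMoves] at h
    · simp [isDouble] at h
    · simp [isDouble] at h
  case B1 | A2odd =>
    simp only [minRank, period] at hn hP h1 h2
    simp only [labMoves_fork _ (t := .B1) (Or.inl rfl),
      labMoves_fork _ (t := .A2odd) (Or.inr rfl)]
    change Bool at p
    cases half with
    | some s =>
      have hr := half_mod hv
      -- The 01-row counts as covering as well as supporting.
      have hrec : ∀ t, t = AffineType.B1 ∨ t = .A2odd → receiver t n (r + 1) = true := by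
        rintro t (rfl | rfl) <;> simp [receiver, covering, period, hr]
      simp only [topRow_half, hrec _ (Or.inl rfl), hrec _ (Or.inr rfl)]
      refine ⟨fun _ => trivial, fun h h' => ?_, fun h h' => ?_, fun h h' => ?_⟩
      · simp only [Sharp, Column.lab] at h h'; grind
      · revert h h'; simp only [isDouble, Column.lab]; grind
      · revert h h'; simp only [isDouble, Column.lab]; grind
    | none =>
      simp only [topRow_pred, receiver, giver, supporting, covering, Column.lab, period, Sharp,
        isDouble, decide_eq_true_eq, decide_eq_false_iff_not, Bool.false_eq_true]
      clear hv hP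
      grind
  all_goals
    simp only [minRank, period] at hn hP h1 h2
    simp only [labMoves_C1, labMoves_A2even, labMoves_D2]
    simp only [Column.Valid, row, Row.isPair, Bool.false_eq_true, or_false] at hv
    subst hv
    simp only [topRow_pred, receiver, giver, supporting, covering, Column.lab, period, Sharp,
        isDouble, decide_eq_true_eq, decide_eq_false_iff_not, Bool.false_eq_true]
    clear hP
    grind

/-- The counterpart for slots. If r is the dummy label, the i-blocks occur once in a cycle and are
both supporting and covering, so p cannot be required to be non-preferred; no choice arises then. -/
theorem giver_slotRow {t : AffineType} {n : ℕ} (hn : minRank t ≤ n) (p : Pattern t n) {i : ℕ}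
    (hi : i ≤ n) {c : Column} (hv : c.Valid t n p) :
    (c.lab t n p = (labMoves t n i).r → giver t n c.slotRow = true) ∧
    (Sharp t i → c.lab t n p = (labMoves t n i).p → (labMoves t n i).r ≠ .v 0 →
      giver t n c.slotRow = false) ∧
    (isDouble t n i = true → c.lab t n p = (labMoves t n i).r → receiver t n c.slotRow = false) ∧
    (isDouble t n i = true → c.lab t n p = (labMoves t n i).p → receiver t n c.slotRow = true) := by
  obtain ⟨r, half⟩ := c
  have hP := period_pos hn
  have h2 := Nat.mod_lt r hP
  cases t
  case A1 =>
    refine ⟨fun _ => rfl, fun _ _ h => ?_, fun h => ?_, fun h => ?_⟩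
    · simp [labMoves] at h
    · simp [isDouble] at h
    · simp [isDouble] at h
  case B1 | A2odd =>
    simp only [minRank, period] at hn hP h2
    simp only [labMoves_fork _ (t := .B1) (Or.inl rfl),
      labMoves_fork _ (t := .A2odd) (Or.inr rfl)]
    change Bool at p
    cases half with
    | some s =>
      have hr := half_mod hv
      have hrec : ∀ t, t = AffineType.B1 ∨ t = .A2odd → giver t n r = true := by
        rintro t (rfl | rfl) <;> simp [giver, supporting, period, hr] <;> omega
      simp only [Column.slotRow, hrec _ (Or.inl rfl), hrec _ (Or.inr rfl)]
      refine ⟨fun _ => trivial, fun h h' => ?_, fun h h' => ?_, fun h h' => ?_⟩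
      · simp only [Sharp, Column.lab] at h h'; grind
      · revert h h'; simp only [isDouble, Column.lab]; grind
      · revert h h'; simp only [isDouble, Column.lab]; grind
    | none =>
      simp only [Column.slotRow, receiver, giver, supporting, covering, Column.lab, period, Sharp,
        isDouble, decide_eq_true_eq, decide_eq_false_iff_not, Bool.false_eq_true]
      clear hv hP
      grind
  all_goals
    simp only [minRank, period] at hn hP h2
    simp only [labMoves_C1, labMoves_A2even, labMoves_D2]
    simp only [Column.slotRow, receiver, giver, supporting, covering, Column.lab, period, Sharp,
        isDouble, decide_eq_true_eq, decide_eq_false_iff_not, Bool.false_eq_true]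
    clear hP hv
    grind

theorem splitIndex_of_not_split {t : AffineType} {n i : ℕ} (hn : minRank t ≤ n)
    (hs : (labMoves t n i).split = false) (R : Row) :
    (splitIndex t n i).matchRow R = false := by
  have : splitIndex t n i = .nothing := by
    cases t <;> simp only [labMoves, splitIndex, minRank] at hs hn ⊢ <;> split_ifs at hs ⊢ <;>
      first | rfl | omega
  rw [this]; rfl

set_option maxHeartbeats 1000000 in
/-- In the cases with splitting, the tops that may be broken are those labelled `r`. -/
theorem split_block_iff {t : AffineType} {n : ℕ} (hn : minRank t ≤ n) (p : Pattern t n) {i : ℕ}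
    (hi : i ≤ n) (hs : (labMoves t n i).split = true) {c : Column} (hv : c.Valid t n p)
    (hpos : 0 < c.full) :
    (c.half = none ∧ (splitIndex t n i).matchRow (row t n p (c.full - 1)) = true ∧
      giver t n (c.full - 1) = true) ↔ c.lab t n p = (labMoves t n i).r := by
  obtain ⟨full, half⟩ := c
  obtain ⟨r, rfl⟩ : ∃ r, full = r + 1 := ⟨full - 1, by simp only at hpos; omega⟩
  have hP := period_pos hn
  have h1 := succ_mod_cases hP r
  have h2 := Nat.mod_lt r hP
  cases t
  case A1 => simp [labMoves] at hs
  case B1 | A2odd =>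
    simp only [minRank, period] at hn hP h1 h2
    simp only [labMoves_fork _ (t := .B1) (Or.inl rfl),
      labMoves_fork _ (t := .A2odd) (Or.inr rfl)] at hs ⊢
    change Bool at p
    cases half with
    | some s =>
      simp only [Column.lab, reduceCtorEq, false_and, false_iff]
      grind
    | none =>
      simp only [Nat.add_sub_cancel, giver, supporting, Column.lab, period, splitIndex, row,
        true_and, decide_eq_true_eq]
      clear hv hP hpos
      by_cases hi2 : i = 2
      · subst hi2
        simp only [forkRow, Nat.not_ofNat_le_one, if_false, if_true, SplitIndex.matchRow]
        split_ifs <;> simp only [Row.isPair] <;> grind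
      by_cases hi1 : i ≤ 1
      · grind
      · simp only [forkRow, hi1, hi2, if_false, SplitIndex.matchRow]
        split_ifs <;> simp only [Row.isWhole, beq_iff_eq] <;> grind
  all_goals
    simp only [minRank, period] at hn hP h1 h2
    simp only [labMoves_C1, labMoves_A2even, labMoves_D2] at hs ⊢
    simp only [Column.Valid, row, Row.isPair, Bool.false_eq_true, or_false] at hv
    subst hv
    have hin : i ≠ n := by rintro rfl; grind
    simp only [Nat.add_sub_cancel, giver, covering, Column.lab, period, splitIndex, row,
        true_and, decide_eq_true_eq, hin, if_false, SplitIndex.matchRow, Row.isWhole, beq_iff_eq]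
    clear hP hpos hs
    grind

set_option maxHeartbeats 1000000 in
/-- In the cases with splitting, the slots that may receive a half are those labelled `q`. -/
theorem split_slot_iff {t : AffineType} {n : ℕ} (hn : minRank t ≤ n) (p : Pattern t n) {i : ℕ}
    (hi : i ≤ n) (hs : (labMoves t n i).split = true) {c : Column} (hv : c.Valid t n p) :
    (c.half = none ∧ (splitIndex t n i).matchRow (row t n p c.full) = true ∧
      receiver t n c.full = true) ↔ c.lab t n p = (labMoves t n i).q := by
  obtain ⟨r, half⟩ := c
  have hP := period_pos hn
  have h2 := Nat.mod_lt r hP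
  cases t
  case A1 => simp [labMoves] at hs
  case B1 | A2odd =>
    simp only [minRank, period] at hn hP h2
    simp only [labMoves_fork _ (t := .B1) (Or.inl rfl),
      labMoves_fork _ (t := .A2odd) (Or.inr rfl)] at hs ⊢
    change Bool at p
    cases half with
    | some s =>
      simp only [Column.lab, reduceCtorEq, false_and, false_iff]
      grind
    | none =>
      simp only [receiver, covering, Column.lab, period, splitIndex, row,
        true_and, decide_eq_true_eq]
      clear hv hP
      by_cases hi2 : i = 2
      · subst hi2
        simp only [forkRow, Nat.not_ofNat_le_one, if_false, if_true, SplitIndex.matchRow]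
        split_ifs <;> simp only [Row.isPair] <;> grind
      by_cases hi1 : i ≤ 1
      · grind
      · simp only [forkRow, hi1, hi2, if_false, SplitIndex.matchRow]
        split_ifs <;> simp only [Row.isWhole, beq_iff_eq] <;> grind
  all_goals
    simp only [minRank, period] at hn hP h2
    simp only [labMoves_C1, labMoves_A2even, labMoves_D2] at hs ⊢
    simp only [Column.Valid, row, Row.isPair, Bool.false_eq_true, or_false] at hv
    subst hv
    have hin : i ≠ n := by rintro rfl; grind
    simp only [receiver, supporting, Column.lab, period, splitIndex, row,
        true_and, decide_eq_true_eq, hin, if_false, SplitIndex.matchRow, Row.isWhole, beq_iff_eq]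
    clear hP hs
    grind

end YoungSlice

/-! ### Chains of inclusions, and when a block can be moved -/

namespace YoungSlice

theorem Column.Sub.refl (c : Column) : c.Sub c := Or.inr ⟨rfl, Or.inr rfl⟩

theorem Column.Sub.trans {c d e : Column} (h : c.Sub d) (h' : d.Sub e) : c.Sub e := by
  unfold Column.Sub at *; grind

theorem Column.Sub.antisymm {c d : Column} (h : c.Sub d) (h' : d.Sub c) : c = d := by
  cases c; cases d; simp only [Column.Sub, Column.mk.injEq] at *; grind

theorem Column.Sub.addDelta {t : AffineType} {n : ℕ} {c d : Column} (h : c.Sub d) :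
    (c.addDelta t n).Sub (d.addDelta t n) := by
  simp only [Column.Sub, Column.addDelta] at *; grind

theorem Column.sub_addDelta {t : AffineType} {n : ℕ} (hn : minRank t ≤ n) (c : Column) :
    c.Sub (c.addDelta t n) := by
  have := period_pos hn
  simp only [Column.Sub, Column.addDelta]; omega

/-- The inclusions between the layers of a slice. -/
structure Chain (t : AffineType) (n : ℕ) (p : Pattern t n) {L : ℕ} (C : Fin L → Column) :
    Prop where
  valid : ∀ j, (C j).Valid t n p
  mono : ∀ j k, j ≤ k → (C j).Sub (C k)
  delta : ∀ j k, (C j).Sub ((C k).addDelta t n)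

/-- The inclusions between neighbours and around the end give all inclusions by transitivity. The
symmetric form on the right is what the shift and the updates of single layers preserve
conveniently. -/
theorem isSlice_iff {t : AffineType} {n : ℕ} {p : Pattern t n} {L : ℕ} {C : Fin L → Column} :
    IsSlice t n p C ↔ Chain t n p C ∧ ExtraCondition t n p C := by
  constructor
  · rintro ⟨h1, h2, h3, h4⟩
    have mono : ∀ m : ℕ, ∀ j k : Fin L, k.val = j.val + m → (C j).Sub (C k) := by
      intro m
      induction m with
      | zero => intro j k h; rw [Fin.ext h]; exact .refl _
      | succ m ih =>
        intro j k h
        exact (ih j ⟨j + m, by omega⟩ rfl).trans (h2 _ k (by simp only; omega))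
    have mono' : ∀ j k, j ≤ k → (C j).Sub (C k) := fun j k h =>
      mono (k - j) j k (by have : j.val ≤ k.val := h; omega)
    refine ⟨⟨h1, mono', fun j k => ?_⟩, h4⟩
    have hL : 0 < L := j.pos
    -- Any layer lies in the last one, which lies in c_1 + δ, hence in every layer plus δ.
    have hl := h3 ⟨L - 1, by omega⟩ ⟨0, hL⟩ (by simp only; omega) rfl
    have hj := mono' j ⟨L - 1, by omega⟩ (Fin.mk_le_mk.2 (by omega))
    have hk := mono' ⟨0, hL⟩ k (Fin.mk_le_mk.2 (by omega))
    exact (hj.trans hl).trans hk.addDelta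
  · rintro ⟨h, h4⟩
    exact ⟨h.valid, fun j k hjk => h.mono j k (Fin.mk_le_mk.2 (by omega)),
      fun j k _ _ => h.delta j k, h4⟩

theorem valid_of_full_eq {t : AffineType} {n : ℕ} {p : Pattern t n} {d : Column} {r j : ℕ}
    (hd : d.Valid t n p) (hr : d.full = r) (hrow : row t n p r = .whole j) : d.half = none := by
  subst hr
  rcases hd with h | h
  · exact h
  · simp [hrow, Row.isPair] at h

section cover
variable {t : AffineType} {n : ℕ} {p : Pattern t n} {i : ℕ} {c c' d : Column}

theorem sub_of_remove (h : c.remove t n p i = some c') : c'.Sub c := by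
  obtain ⟨full, half⟩ := c
  unfold Column.remove at h
  split at h
  · simp only [Option.ite_none_right_eq_some, Option.some.injEq] at h
    simp only [← h.2, Column.Sub]; simp
  · split at h
    · cases h
    · simp only at *
      split at h <;> split_ifs at h <;> cases h <;> simp only [Column.Sub] <;> grind

theorem sub_of_add (h : c.add t n p i = some c') : c.Sub c' := by
  obtain ⟨full, half⟩ := c
  unfold Column.add at h
  split at h
  · simp only [Option.ite_none_right_eq_some, Option.some.injEq] at h
    simp only [← h.2, Column.Sub]; simp
  · simp only at *
    split at h <;> split_ifs at h <;> cases h <;> simp only [Column.Sub] <;> grind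

theorem valid_of_remove (h : c.remove t n p i = some c') : c'.Valid t n p := by
  obtain ⟨full, half⟩ := c
  unfold Column.remove at h
  split at h
  · simp only [Option.ite_none_right_eq_some, Option.some.injEq] at h
    exact Or.inl (by rw [← h.2])
  · split at h
    · cases h
    · simp only at *
      split at h <;> split_ifs at h <;> cases h <;>
        first | exact Or.inl rfl | exact Or.inr (by simp [*, Row.isPair])

theorem valid_of_add (h : c.add t n p i = some c') : c'.Valid t n p := by
  obtain ⟨full, half⟩ := c
  unfold Column.add at h
  split at h
  · simp only [Option.ite_none_right_eq_some, Option.some.injEq] at h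
    exact Or.inl (by rw [← h.2])
  · simp only at *
    split at h <;> split_ifs at h <;> cases h <;>
        first | exact Or.inl rfl | exact Or.inr (by simp [*, Row.isPair])

theorem full_of_remove (h : c.remove t n p i = some c') : c.full ≤ c'.full + 1 := by
  obtain ⟨full, half⟩ := c
  unfold Column.remove at h
  split at h
  · simp only [Option.ite_none_right_eq_some, Option.some.injEq] at h
    simp [← h.2]
  · split at h
    · cases h
    · simp only at *
      split at h <;> split_ifs at h <;> cases h <;> simp only <;> omega

/-- Nothing but `i`-blocks in the same row hinders the removal of an `i`-block. -/
theorem remove_cover (h : c.remove t n p i = some c') (hd : d.Valid t n p) (hdc : d.Sub c)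
    (hdc' : ¬ d.Sub c') : (d.remove t n p i).isSome = true ∧ d.topRow = c.topRow := by
  obtain ⟨full, half⟩ := c
  obtain ⟨dfull, dhalf⟩ := d
  rcases half with _ | s
  · rcases full with _ | r
    · simp [Column.remove] at h
    · cases hrow : row t n p r with
      | whole j =>
        have hv := fun hr => valid_of_full_eq hd hr hrow
        simp only [Column.remove, hrow, Option.ite_none_right_eq_some, Option.some.injEq] at h
        obtain ⟨h1, rfl⟩ := h
        simp only [Column.Sub] at hdc hdc' hv
        obtain ⟨rfl, rfl⟩ : dfull = r + 1 ∧ dhalf = none := by grind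
        simp [Column.remove, hrow, h1]
      | pair a b =>
        simp only [Column.remove, hrow] at h
        by_cases hD : dfull = r + 1
        · subst hD
          obtain rfl : dhalf = none := by simp only [Column.Sub] at hdc; grind
          simp only [Column.remove, hrow]
          split_ifs at h ⊢ <;> simp
        · simp only [Column.Sub] at hdc hdc'
          have hd' : dfull = r := by split_ifs at h <;> cases h <;> simp only at hdc' <;> omega
          subst hd'
          split_ifs at h with ha hb <;> cases h <;> simp only at hdc' <;>
            rcases dhalf with _ | (_ | _) <;>
            simp_all [Column.remove, Row.sideColor, Column.topRow]
  · simp only [Column.remove, Option.ite_none_right_eq_some, Option.some.injEq] at h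
    obtain ⟨h1, rfl⟩ := h
    simp only [Column.Sub] at hdc hdc'
    obtain ⟨rfl, rfl⟩ : dfull = full ∧ dhalf = some s := by grind
    simp [Column.remove, h1]

/-- Nothing but `i`-slots in the same row hinders the addition of an `i`-block. -/
theorem add_cover (h : c.add t n p i = some c') (hd : d.Valid t n p) (hdc : c.Sub d)
    (hdc' : ¬ c'.Sub d) : (d.add t n p i).isSome = true ∧ d.slotRow = c.slotRow := by
  obtain ⟨full, half⟩ := c
  obtain ⟨dfull, dhalf⟩ := d
  rcases half with _ | s
  · cases hrow : row t n p full with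
    | whole j =>
      have hv := fun hr => valid_of_full_eq hd hr hrow
      simp only [Column.add, hrow, Option.ite_none_right_eq_some, Option.some.injEq] at h
      obtain ⟨h1, rfl⟩ := h
      simp only [Column.Sub] at hdc hdc' hv
      obtain ⟨rfl, rfl⟩ : dfull = full ∧ dhalf = none := by grind
      simp [Column.add, hrow, h1]
    | pair a b =>
      simp only [Column.add, hrow] at h
      simp only [Column.Sub] at hdc hdc'
      have hd' : dfull = full := by split_ifs at h <;> cases h <;> simp only at hdc' <;> omega
      subst hd'
      split_ifs at h with ha hb <;> cases h <;> simp only at hdc' <;>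
        rcases dhalf with _ | (_ | _) <;>
        simp_all [Column.add, Row.sideColor, Column.slotRow]
  · simp only [Column.add, Option.ite_none_right_eq_some, Option.some.injEq] at h
    obtain ⟨h1, rfl⟩ := h
    simp only [Column.Sub] at hdc hdc'
    obtain ⟨rfl, rfl⟩ : dfull = full ∧ dhalf = some s := by grind
    simp [Column.add, h1]

/-- Unlike for adding blocks, only an implication: the empty column has nothing to remove, whereas a
δ-column has. -/
theorem remove_addDelta (h : c.remove t n p i = some c') :
    (c.addDelta t n).remove t n p i = some (c'.addDelta t n) := by
  obtain ⟨full, half⟩ := c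
  rcases half with _ | s
  · rcases full with _ | r
    · simp [Column.remove] at h
    · have h1 : (⟨r + 1, none⟩ : Column).addDelta t n = ⟨r + period t n + 1, none⟩ := by
        simp only [Column.addDelta, Column.mk.injEq, and_true]; omega
      rw [h1]
      simp only [Column.remove, add_delta_row] at h ⊢
      split at h <;> split_ifs at h ⊢ <;> cases h <;> simp [Column.addDelta]
  · simp only [Column.remove, Column.addDelta, add_delta_row, Option.ite_none_right_eq_some,
      Option.some.injEq] at h ⊢
    exact ⟨h.1, by rw [← h.2]⟩

theorem add_addDelta : (c.addDelta t n).add t n p i =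
    (c.add t n p i).map fun d => d.addDelta t n := by
  obtain ⟨full, half⟩ := c
  rcases half with _ | s
  · simp only [Column.add, Column.addDelta, add_delta_row]
    split <;> split_ifs <;> simp <;> omega
  · simp only [Column.add, Column.addDelta, add_delta_row]
    split_ifs <;> simp; omega

end cover

section update
variable {t : AffineType} {n : ℕ} {p : Pattern t n} {i L : ℕ} {C : Fin L → Column}

theorem Column.Valid.addDelta {c : Column} (h : c.Valid t n p) : (c.addDelta t n).Valid t n p := by
  simpa only [Column.Valid, Column.addDelta, add_delta_row] using h

theorem topRow_addDelta {c : Column} (h : 0 < c.full) :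
    (c.addDelta t n).topRow = c.topRow + period t n := by
  unfold Column.topRow Column.addDelta; simp only; split_ifs <;> omega

/-- By `remove_cover`, only two things can go wrong when layer j shrinks: a layer in front of it has
an i-block in the same row, or some layer has one exactly a cycle higher and no longer fits into c_j
+ δ. -/
theorem Chain.remove (hn : minRank t ≤ n) (hC : Chain t n p C) {j : Fin L} {c : Column}
    (hc : (C j).remove t n p i = some c) (hpos : ∀ j, 0 < (C j).full)
    (h : ∀ k, ((C k).remove t n p i).isSome = true →
      ¬ ((C k).topRow = (C j).topRow ∧ k < j) ∧ (C k).topRow ≠ (C j).topRow + period t n) :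
    Chain t n p (Function.update C j c) := by
  have hsub := sub_of_remove hc
  refine ⟨fun k => ?_, fun k k' hk => ?_, fun k k' => ?_⟩
  · rcases eq_or_ne k j with rfl | hkj
    · rw [Function.update_self]; exact valid_of_remove hc
    · rw [Function.update_of_ne hkj]; exact hC.valid k
  · rcases eq_or_ne k j with hkj | hkj <;> rcases eq_or_ne k' j with hk'j | hk'j
    · rw [hkj, hk'j]; exact .refl _
    · subst hkj
      rw [Function.update_self, Function.update_of_ne hk'j]
      exact hsub.trans (hC.mono _ _ hk)
    · subst hk'j
      rw [Function.update_self, Function.update_of_ne hkj]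
      by_contra hcon
      obtain ⟨h1, h2⟩ := remove_cover hc (hC.valid k) (hC.mono _ _ hk) hcon
      exact (h k h1).1 ⟨h2, lt_of_le_of_ne hk hkj⟩
    · rw [Function.update_of_ne hk'j, Function.update_of_ne hkj]
      exact hC.mono _ _ hk
  · rcases eq_or_ne k' j with rfl | hk'j
    · rcases eq_or_ne k k' with rfl | hkj
      · exact Column.sub_addDelta hn _
      · rw [Function.update_self, Function.update_of_ne hkj]
        by_contra hcon
        obtain ⟨h1, h2⟩ := remove_cover (remove_addDelta hc) (hC.valid k) (hC.delta _ _) hcon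
        rw [topRow_addDelta (hpos _)] at h2
        exact (h k h1).2 h2
    · rw [Function.update_of_ne hk'j]
      rcases eq_or_ne k j with rfl | hkj
      · rw [Function.update_self]; exact hsub.trans (hC.delta _ _)
      · rw [Function.update_of_ne hkj]; exact hC.delta _ _

/-- Dual to the removal: by `add_cover` the obstructions are a layer further back with an i-slot in
the same row, and a layer with an i-slot exactly a cycle lower. -/
theorem Chain.add (hn : minRank t ≤ n) (hC : Chain t n p C) {j : Fin L} {c : Column}
    (hc : (C j).add t n p i = some c)
    (h : ∀ k, ((C k).add t n p i).isSome = true →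
      ¬ ((C k).slotRow = (C j).slotRow ∧ j < k) ∧ (C k).slotRow + period t n ≠ (C j).slotRow) :
    Chain t n p (Function.update C j c) := by
  have hsub := sub_of_add hc
  refine ⟨fun k => ?_, fun k k' hk => ?_, fun k k' => ?_⟩
  · rcases eq_or_ne k j with rfl | hkj
    · rw [Function.update_self]; exact valid_of_add hc
    · rw [Function.update_of_ne hkj]; exact hC.valid k
  · rcases eq_or_ne k j with hkj | hkj <;> rcases eq_or_ne k' j with hk'j | hk'j
    · rw [hkj, hk'j]; exact .refl _
    · subst hkj
      rw [Function.update_self, Function.update_of_ne hk'j]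
      by_contra hcon
      obtain ⟨h1, h2⟩ := add_cover hc (hC.valid k') (hC.mono _ _ hk) hcon
      exact (h k' h1).1 ⟨h2, lt_of_le_of_ne hk (Ne.symm hk'j)⟩
    · subst hk'j
      rw [Function.update_self, Function.update_of_ne hkj]
      exact (hC.mono _ _ hk).trans hsub
    · rw [Function.update_of_ne hk'j, Function.update_of_ne hkj]
      exact hC.mono _ _ hk
  · rcases eq_or_ne k j with rfl | hkj
    · rcases eq_or_ne k k' with rfl | hkk
      · exact Column.sub_addDelta hn _
      · rw [Function.update_self, Function.update_of_ne (Ne.symm hkk)]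
        by_contra hcon
        obtain ⟨h1, h2⟩ := add_cover hc (hC.valid k').addDelta (hC.delta _ _) hcon
        rw [add_addDelta, Option.isSome_map] at h1
        exact (h k' h1).2 h2
    · rw [Function.update_of_ne hkj]
      rcases eq_or_ne k' j with rfl | hk'j
      · rw [Function.update_self]; exact (hC.delta _ _).trans hsub.addDelta
      · rw [Function.update_of_ne hk'j]; exact hC.delta _ _

end update

/-- Higher, or of the same height and further in front. -/
def HigherFront {L : ℕ} (h : Fin L → ℕ) (j k : Fin L) : Prop := h k < h j ∨ (h k = h j ∧ j < k)

/-- Lower, or of the same height and further back. -/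
def LowerBack {L : ℕ} (h : Fin L → ℕ) (j k : Fin L) : Prop := h j < h k ∨ (h k = h j ∧ k < j)

theorem frontHighest_eq_none {L : ℕ} {S : Finset (Fin L)} {h : Fin L → ℕ} :
    frontHighest S h = none ↔ S = ∅ := by
  unfold frontHighest
  simp only [dite_eq_right_iff, reduceCtorEq, imp_false, Finset.not_nonempty_iff_eq_empty]
  constructor
  · intro hT
    by_contra hS
    obtain ⟨j, hj, hjs⟩ := Finset.exists_mem_eq_sup S (Finset.nonempty_iff_ne_empty.2 hS) h
    exact Finset.notMem_empty j (hT ▸ Finset.mem_filter.2 ⟨hj, hjs.symm⟩)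
  · rintro rfl; rfl

theorem frontHighest_spec {L : ℕ} {S : Finset (Fin L)} {h : Fin L → ℕ} {j : Fin L}
    (hj : frontHighest S h = some j) : j ∈ S ∧ ∀ k ∈ S, k ≠ j → HigherFront h j k := by
  unfold frontHighest at hj
  simp only [Option.dite_none_right_eq_some, Option.some.injEq] at hj
  obtain ⟨hT, rfl⟩ := hj
  have h1 := Finset.mem_filter.1 (Finset.min'_mem _ hT)
  refine ⟨h1.1, fun k hk hkj => ?_⟩
  have hle : h k ≤ S.sup h := Finset.le_sup hk
  rcases hle.lt_or_eq with hlt | heq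
  · rw [← h1.2] at hlt; exact Or.inl hlt
  · refine Or.inr ⟨heq.trans h1.2.symm, lt_of_le_of_ne ?_ (Ne.symm hkj)⟩
    exact Finset.min'_le _ _ (Finset.mem_filter.2 ⟨hk, heq⟩)

theorem backLowest_eq_none {L : ℕ} {S : Finset (Fin L)} {h : Fin L → ℕ} :
    backLowest S h = none ↔ S = ∅ := by
  unfold backLowest
  simp only [dite_eq_right_iff, reduceCtorEq, imp_false, Finset.not_nonempty_iff_eq_empty]
  constructor
  · intro hT
    by_contra hS
    obtain ⟨j, hj, hjs⟩ := Finset.exists_min_image S h (Finset.nonempty_iff_ne_empty.2 hS)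
    exact Finset.notMem_empty j (hT ▸ Finset.mem_filter.2 ⟨hj, hjs⟩)
  · rintro rfl; rfl

theorem backLowest_spec {L : ℕ} {S : Finset (Fin L)} {h : Fin L → ℕ} {j : Fin L}
    (hj : backLowest S h = some j) : j ∈ S ∧ ∀ k ∈ S, k ≠ j → LowerBack h j k := by
  unfold backLowest at hj
  simp only [Option.dite_none_right_eq_some, Option.some.injEq] at hj
  obtain ⟨hT, rfl⟩ := hj
  have h1 := Finset.mem_filter.1 (Finset.max'_mem _ hT)
  refine ⟨h1.1, fun k hk hkj => ?_⟩
  rcases (h1.2 k hk).lt_or_eq with hlt | heq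
  · exact Or.inl hlt
  · refine Or.inr ⟨heq.symm, lt_of_le_of_ne ?_ hkj⟩
    exact Finset.le_max' _ _ (Finset.mem_filter.2 ⟨hk, fun k' hk' => heq ▸ h1.2 k' hk'⟩)

end YoungSlice

/-! ### The one-block and two-block rules on label counts -/

namespace YoungSlice

/-- The number of layers with a given label. -/
def cnt (t : AffineType) (n : ℕ) (p : Pattern t n) {L : ℕ} (C : Fin L → Column) (a : Lab) : ℤ :=
  ∑ j, if (C j).lab t n p = a then 1 else 0

theorem cnt_eq_card (t : AffineType) (n : ℕ) (p : Pattern t n) {L : ℕ} (C : Fin L → Column)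
    (a : Lab) :
    cnt t n p C a = ((Finset.univ.filter fun j => (C j).lab t n p = a).card : ℤ) := by
  simp [cnt]

theorem cnt_pos_iff {t : AffineType} {n : ℕ} {p : Pattern t n} {L : ℕ} {C : Fin L → Column}
    {a : Lab} : 0 < cnt t n p C a ↔ ∃ j, (C j).lab t n p = a := by
  rw [cnt_eq_card, Nat.cast_pos, Finset.card_pos]
  simp [Finset.filter_nonempty_iff]

theorem cnt_update (t : AffineType) (n : ℕ) (p : Pattern t n) {L : ℕ} (C : Fin L → Column)
    (j : Fin L) (c : Column) : cnt t n p (Function.update C j c) =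
      relabel ((C j).lab t n p) (c.lab t n p) (cnt t n p C) := by
  funext a
  have h1 := Finset.add_sum_erase Finset.univ
    (fun k => if (Function.update C j c k).lab t n p = a then (1 : ℤ) else 0) (Finset.mem_univ j)
  have h2 := Finset.add_sum_erase Finset.univ
    (fun k => if (C k).lab t n p = a then (1 : ℤ) else 0) (Finset.mem_univ j)
  have h3 : ∑ k ∈ Finset.univ.erase j,
      (if (Function.update C j c k).lab t n p = a then (1 : ℤ) else 0) =
      ∑ k ∈ Finset.univ.erase j, if (C k).lab t n p = a then (1 : ℤ) else 0 :=
    Finset.sum_congr rfl fun k hk => by rw [Function.update_of_ne (Finset.ne_of_mem_erase hk)]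
  simp only [Function.update_self] at h1 h2
  simp only [cnt, relabel, ← h1, ← h2, h3]
  simp only [eq_comm (a := a)]
  ring

/-- What the choice of layers needs to know about the layers `U` which are not broken. -/
structure Unbroken (t : AffineType) (n : ℕ) (p : Pattern t n) (m : LabMoves) {L : ℕ}
    (better : Fin L → Fin L → Prop) (U : Finset (Fin L)) (C : Fin L → Column) : Prop where
  broken : ∀ k ∉ U, (C k).lab t n p = m.q ∨ (C k).lab t n p = m.s →
    m.split = true ∧ (C k).lab t n p = m.q ∧ ∀ j ∈ U, (C j).lab t n p = m.q → better j k
  card : ((U.filter fun j => (C j).lab t n p = m.q).card : ℤ) =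
    max 0 (cnt t n p C m.q - if m.split then cnt t n p C m.r else 0)

/-- The properties common to the rules for removing and for adding blocks. -/
structure MoveRule (t : AffineType) (n : ℕ) (p : Pattern t n) (m : LabMoves) (L : ℕ)
    (sharp : Prop) (move : Column → Option Column) (height : Column → ℕ)
    (pick : Finset (Fin L) → (Fin L → ℕ) → Option (Fin L))
    (better : (Fin L → ℕ) → Fin L → Fin L → Prop) (preferred : ℕ → Bool) : Prop where
  lab_of_move : ∀ c c', move c = some c' →
    (c.lab t n p = m.q ∧ c'.lab t n p = m.p) ∨ (c.lab t n p = m.s ∧ c'.lab t n p = m.r)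
  isSome : ∀ c, c.Valid t n p → 0 < c.full → c.lab t n p = m.q ∨ c.lab t n p = m.s →
    (move c).isSome = true
  preferred_q : ∀ c, c.Valid t n p → 0 < c.full → c.lab t n p = m.q →
    preferred (height c) = true
  preferred_s : sharp → m.q ≠ .v 0 → ∀ c, c.Valid t n p → 0 < c.full → c.lab t n p = m.s →
    preferred (height c) = false
  preferred_congr : ∀ a b, a % period t n = b % period t n → preferred a = preferred b
  unsharp : ¬ sharp → ∀ C : Fin L → Column, Chain t n p C → (∀ j, 0 < (C j).full) → ∀ j k,
    (C k).lab t n p = m.q → (C j).lab t n p = m.s → ¬ better (fun j => height (C j)) j k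
  update : ∀ (N : ℕ) (C : Fin L → Column), Chain t n p C → (∀ j, N + 1 ≤ (C j).full) →
    ∀ j c, move (C j) = some c →
    (∀ k, (move (C k)).isSome = true → height (C k) % period t n = height (C j) % period t n →
      k ≠ j → better (fun j => height (C j)) j k) →
    Chain t n p (Function.update C j c) ∧ ∀ k, N ≤ (Function.update C j c k).full
  pick_none : ∀ S h, pick S h = none ↔ S = ∅
  pick_some : ∀ S h j, pick S h = some j → j ∈ S ∧ ∀ k ∈ S, k ≠ j → better h j k
  better_congr : ∀ (h h' : Fin L → ℕ) j k, h j = h' j → h k = h' k → better h j k → better h' j k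
  split_sharp : m.split = true → sharp
  q_ne_s : m.q ≠ m.s
  split_ne : m.split = true → m.q ≠ m.p ∧ m.s ≠ m.r ∧ m.p ≠ m.r ∧ m.q ≠ m.r

section act
variable {t : AffineType} {n : ℕ} {p : Pattern t n} {m : LabMoves} {L : ℕ} {sharp : Prop}
  {move : Column → Option Column} {height : Column → ℕ}
  {pick : Finset (Fin L) → (Fin L → ℕ) → Option (Fin L)}
  {better : (Fin L → ℕ) → Fin L → Fin L → Prop} {preferred other : ℕ → Bool}
  {C : Fin L → Column} {U : Finset (Fin L)}

/-- The label 𝐯_0 stands for a move that does not exist for the given color. -/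
theorem lab_ne_dummy (hn : minRank t ≤ n) (c : Column) : c.lab t n p ≠ .v 0 := by
  intro h
  have := occurs_lab hn p c
  rw [h] at this
  revert this
  cases t <;> simp [Lab.Occurs]


theorem moveAt_of_eq_some {j : Fin L} {c : Column} (h : move (C j) = some c) :
    moveAt move C j = Function.update C j c := by
  simp [moveAt, h]

/-- Links the existence of an intact preferred layer to the test in `stepE`. -/
theorem Unbroken.exists_q_iff {better : Fin L → Fin L → Prop}
    (hU : Unbroken t n p m better U C) :
    (∃ j ∈ U, (C j).lab t n p = m.q) ↔
      (if m.split then cnt t n p C m.r else 0) < cnt t n p C m.q := by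
  have h := hU.card
  rw [← Finset.filter_nonempty_iff, ← Finset.card_pos]
  omega

namespace MoveRule
variable (R : MoveRule t n p m L sharp move height pick better preferred)
include R

theorem isSome_iff (hC : Chain t n p C) (hpos : ∀ j, 0 < (C j).full) (j : Fin L) :
    (move (C j)).isSome = true ↔ (C j).lab t n p = m.q ∨ (C j).lab t n p = m.s := by
  refine ⟨fun h => ?_, R.isSome _ (hC.valid j) (hpos j)⟩
  obtain ⟨c, hc⟩ := Option.isSome_iff_exists.1 h
  exact (R.lab_of_move _ _ hc).imp And.left And.left

theorem mem_movable (hC : Chain t n p C) (hpos : ∀ j, 0 < (C j).full) {j : Fin L} :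
    j ∈ movable move U C ↔ j ∈ U ∧ ((C j).lab t n p = m.q ∨ (C j).lab t n p = m.s) := by
  rw [movable, Finset.mem_filter, R.isSome_iff hC hpos]

/-- Splitting never makes a layer labelled s unavailable: the broken movable layers all carry q. -/
theorem mem_of_lab_s (hU : Unbroken t n p m (better fun j => height (C j)) U C) {j : Fin L}
    (hj : (C j).lab t n p = m.s) : j ∈ U := by
  by_contra h
  exact R.q_ne_s ((hU.broken j h (Or.inr hj)).2.1.symm.trans hj)

/-- A layer that is preferable to all movable layers at the same height of the cycle which are not
broken is preferable to the broken ones as well. -/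
theorem better_of_mem (hn : minRank t ≤ n) (hC : Chain t n p C) (hpos : ∀ j, 0 < (C j).full)
    (hU : Unbroken t n p m (better fun j => height (C j)) U C) {j : Fin L}
    (hj : j ∈ movable move U C)
    (h : ∀ k ∈ movable move U C, height (C k) % period t n = height (C j) % period t n → k ≠ j →
      better (fun j => height (C j)) j k) (k : Fin L) (hk : (move (C k)).isSome = true)
    (hkj : height (C k) % period t n = height (C j) % period t n) (hne : k ≠ j) :
    better (fun j => height (C j)) j k := by
  by_cases hkU : k ∈ U
  · exact h k (Finset.mem_filter.2 ⟨hkU, hk⟩) hkj hne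
  · rw [R.isSome_iff hC hpos] at hk
    rw [R.mem_movable hC hpos] at hj
    obtain ⟨hs, hq, hb⟩ := hU.broken k hkU hk
    rcases hj.2 with hjq | hjs
    · exact hb j hj.1 hjq
    · have h1 := R.preferred_q _ (hC.valid k) (hpos k) hq
      have h2 := R.preferred_s (R.split_sharp hs) (hq ▸ lab_ne_dummy hn _) _ (hC.valid j) (hpos j)
        hjs
      rw [R.preferred_congr _ _ hkj, h2] at h1
      exact absurd h1 (by simp)

/-- Carries out one move. Only intact layers have to be compared with j, which is what the choice
rules provide. The bound N keeps track of the distance from the ground, so that a second move is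
possible. -/
theorem update_of_mem (hn : minRank t ≤ n) {N : ℕ} (hC : Chain t n p C)
    (hfull : ∀ j, N + 1 ≤ (C j).full)
    (hU : Unbroken t n p m (better fun j => height (C j)) U C) {j : Fin L}
    (hj : j ∈ movable move U C)
    (h : ∀ k ∈ movable move U C, height (C k) % period t n = height (C j) % period t n → k ≠ j →
      better (fun j => height (C j)) j k) :
    ∃ c, move (C j) = some c ∧ moveAt move C j = Function.update C j c ∧
      Chain t n p (Function.update C j c) ∧ (∀ k, N ≤ (Function.update C j c k).full) ∧
      (((C j).lab t n p = m.q ∧ c.lab t n p = m.p) ∨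
        ((C j).lab t n p = m.s ∧ c.lab t n p = m.r)) := by
  obtain ⟨c, hc⟩ := Option.isSome_iff_exists.1 (Finset.mem_filter.1 hj).2
  obtain ⟨h1, h2⟩ := R.update N C hC hfull j c hc
    (R.better_of_mem hn hC (fun j => by have := hfull j; omega) hU hj h)
  exact ⟨c, hc, moveAt_of_eq_some hc, h1, h2, R.lab_of_move _ _ hc⟩

theorem canE_iff (hC : Chain t n p C) (hpos : ∀ j, 0 < (C j).full)
    (hU : Unbroken t n p m (better fun j => height (C j)) U C) :
    m.canE (cnt t n p C) ↔ (movable move U C).Nonempty := by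
  rw [LabMoves.canE, ← hU.exists_q_iff, cnt_pos_iff]
  constructor
  · rintro (⟨j, hj, hq⟩ | ⟨j, hs⟩)
    · exact ⟨j, (R.mem_movable hC hpos).2 ⟨hj, Or.inl hq⟩⟩
    · exact ⟨j, (R.mem_movable hC hpos).2 ⟨R.mem_of_lab_s hU hs, Or.inr hs⟩⟩
  · rintro ⟨j, hj⟩
    obtain ⟨hj, hq | hs⟩ := (R.mem_movable hC hpos).1 hj
    · exact Or.inl ⟨j, hj, hq⟩
    · exact Or.inr ⟨j, hs⟩

/-- The one-block rule on labels. -/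
theorem actOnce_spec (hn : minRank t ≤ n) {N : ℕ} (hC : Chain t n p C)
    (hfull : ∀ j, N + 1 ≤ (C j).full)
    (hU : Unbroken t n p m (better fun j => height (C j)) U C) :
    (¬ m.canE (cnt t n p C) ∧ actOnce move height pick preferred U C = none) ∨
    (m.canE (cnt t n p C) ∧ ∃ D, actOnce move height pick preferred U C = some D ∧
      Chain t n p D ∧ cnt t n p D = m.stepE (cnt t n p C)) := by
  have hpos : ∀ j, 0 < (C j).full := fun j => by have := hfull j; omega
  rw [R.canE_iff hC hpos hU]
  simp only [actOnce]
  set S := movable move U C with hS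
  set P := S.filter fun j => preferred (height (C j)) = true with hP
  set T := if P.Nonempty then P else S with hT
  have hTS : T ⊆ S := by
    rw [hT]; split_ifs
    · exact Finset.filter_subset _ _
    · exact subset_rfl
  rcases hpick : pick T (fun j => height (C j)) with _ | j
  · left
    rw [R.pick_none] at hpick
    refine ⟨fun hne => ?_, rfl⟩
    rw [hT] at hpick
    split_ifs at hpick with hPn
    · exact hPn.ne_empty hpick
    · exact hne.ne_empty hpick
  · right
    obtain ⟨hj, hbest⟩ := R.pick_some _ _ _ hpick
    refine ⟨⟨j, hTS hj⟩, ?_⟩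
    obtain ⟨c, hc, hmove, hD, -, hlab⟩ := R.update_of_mem hn hC hfull hU (hTS hj)
      -- Preference is periodic in the height, so a movable layer at a congruent height belongs to
      -- the same set of candidates as the chosen one.
      (fun k hk hkj hne => by
        refine hbest k ?_ hne
        rw [hT] at hj ⊢
        split_ifs at hj ⊢
        · rw [hP, Finset.mem_filter] at hj ⊢
          exact ⟨hk, (R.preferred_congr _ _ hkj).trans hj.2⟩
        · exact hk)
    refine ⟨_, by rw [Option.map_some, hmove], hD, ?_⟩
    rw [cnt_update, LabMoves.stepE]
    have hjU : j ∈ U := (Finset.mem_filter.1 (hTS hj)).1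
    by_cases hcond : (if m.split then cnt t n p C m.r else 0) < cnt t n p C m.q
    · rw [if_pos hcond]
      obtain ⟨k, hkU, hkq⟩ := (hU.exists_q_iff).2 hcond
      have hkP : k ∈ P := Finset.mem_filter.2 ⟨(R.mem_movable hC hpos).2 ⟨hkU, Or.inl hkq⟩,
        R.preferred_q _ (hC.valid k) (hpos k) hkq⟩
      rw [hT, if_pos ⟨k, hkP⟩] at hj hbest
      rcases hlab with ⟨h1, h2⟩ | ⟨h1, h2⟩
      · rw [h1, h2]
      · exfalso
        -- An intact q-layer exists, so the chosen layer must not have label s. Where preference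
        -- distinguishes the two labels this is immediate; for the half blocks of B and A_odd it
        -- follows from the order of the layers.
        by_cases hsh : sharp
        · have := R.preferred_s hsh (hkq ▸ lab_ne_dummy hn _) _ (hC.valid j) (hpos j) h1
          rw [(Finset.mem_filter.1 hj).2] at this
          exact absurd this (by simp)
        · refine R.unsharp hsh C hC hpos j k hkq h1 (hbest k hkP ?_)
          rintro rfl
          exact R.q_ne_s (hkq.symm.trans h1)
    · rw [if_neg hcond]
      rcases hlab with ⟨h1, h2⟩ | ⟨h1, h2⟩
      · exact absurd ((hU.exists_q_iff).1 ⟨j, hjU, h1⟩) hcond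
      · rw [h1, h2]

/-- The two-block rule on labels. -/
theorem actTwice_spec (hn : minRank t ≤ n) (hsplit : m.split = true) (hps : m.p = m.s)
    (hq0 : m.q ≠ .v 0)
    (other_q : ∀ c, c.Valid t n p → 0 < c.full → c.lab t n p = m.q → other (height c) = false)
    (other_s : ∀ c, c.Valid t n p → 0 < c.full → c.lab t n p = m.s → other (height c) = true)
    (other_congr : ∀ a b, a % period t n = b % period t n → other a = other b)
    {N : ℕ} (hC : Chain t n p C) (hfull : ∀ j, N + 2 ≤ (C j).full)
    (hU : Unbroken t n p m (better fun j => height (C j)) U C)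
    (heven : Even (cnt t n p C m.s)) :
    (¬ m.canE (cnt t n p C) ∧ actTwice move height pick preferred other U C = none) ∨
    (m.canE (cnt t n p C) ∧ ∃ D, actTwice move height pick preferred other U C = some D ∧
      Chain t n p D ∧ cnt t n p D = m.stepE (m.stepE (cnt t n p C))) := by
  have hpos : ∀ j, 0 < (C j).full := fun j => by have := hfull j; omega
  obtain ⟨hqp, hsr, hpr, hqr⟩ := R.split_ne hsplit
  have hqs := R.q_ne_s
  have hsharp := R.split_sharp hsplit
  -- Layers labelled q and s never have congruent heights here, so they cannot obstruct each other;
  -- only layers of the same label need comparing.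
  have ne_of : ∀ {D : Fin L → Column} {j k : Fin L}, Chain t n p D → (∀ j, 0 < (D j).full) →
      (D j).lab t n p = m.q → (D k).lab t n p = m.s →
      height (D j) % period t n ≠ height (D k) % period t n := by
    intro D j k hD hDpos hj hk hjk
    have h1 := other_q _ (hD.valid j) (hDpos j) hj
    rw [other_congr _ _ hjk, other_s _ (hD.valid k) (hDpos k) hk] at h1
    exact absurd h1 (by simp)
  rw [R.canE_iff hC hpos hU]
  have hmemS := fun {j : Fin L} => R.mem_movable (U := U) hC hpos (j := j)
  simp only [actTwice]
  set S := movable move U C with hS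
  set P := S.filter fun j => preferred (height (C j)) = true with hP
  have hmemP : ∀ j, j ∈ P ↔ j ∈ U ∧ (C j).lab t n p = m.q := by
    intro j
    rw [hP, Finset.mem_filter, hmemS]
    constructor
    · rintro ⟨⟨hjU, hq | hs⟩, hpref⟩
      · exact ⟨hjU, hq⟩
      · by_contra hcon
        rw [R.preferred_s hsharp hq0 _ (hC.valid j) (hpos j) hs] at hpref
        exact absurd hpref (by simp)
    · rintro ⟨hjU, hq⟩
      exact ⟨⟨hjU, Or.inl hq⟩, R.preferred_q _ (hC.valid j) (hpos j) hq⟩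
  -- The three cases of the rule thus correspond to the excess of q over r being 1, at least 2, or
  -- at most 0.
  have hPcard : ((P.card : ℕ) : ℤ) = max 0 (cnt t n p C m.q - cnt t n p C m.r) := by
    have := hU.card
    rw [if_pos hsplit] at this
    rw [← this]
    congr 2
    ext j
    rw [hmemP, Finset.mem_filter]
  by_cases hP1 : P.card = 1
  · right
    rw [if_pos hP1]
    obtain ⟨i₀, hi₀⟩ := Finset.card_eq_one.1 hP1
    rcases hpick : pick P (fun j => height (C j)) with _ | j
    · rw [R.pick_none, hi₀] at hpick
      simp at hpick
    obtain ⟨hj, hbest⟩ := R.pick_some _ _ _ hpick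
    have hjS : j ∈ S := (Finset.mem_filter.1 hj).1
    obtain ⟨hjU, hjq⟩ := (hmemP j).1 hj
    refine ⟨⟨j, hjS⟩, ?_⟩
    obtain ⟨c, hc, hmove, hD, hfullD, hlab⟩ := R.update_of_mem hn (N := N + 1) hC hfull hU hjS
      (fun k hk hkj hne => by
        obtain ⟨hkU, hq | hs⟩ := hmemS.1 hk
        · exact hbest k ((hmemP k).2 ⟨hkU, hq⟩) hne
        · exact absurd hkj.symm (ne_of hC hpos hjq hs))
    have hcp : c.lab t n p = m.p := by
      rcases hlab with h | h
      · exact h.2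
      · exact absurd (hjq.symm.trans h.1) hqs
    rw [Option.bind_some, hmove]
    set D := Function.update C j c with hDdef
    have hDpos : ∀ k, 0 < (D k).full := fun k => by have := hfullD k; omega
    -- As p = s, the layer just moved is itself a candidate for the second move, which therefore
    -- always exists. The excess of q has dropped to 0, so the second step of `stepE` is s → r.
    have hDj : (D j).lab t n p = m.s := by rw [hDdef, Function.update_self, hcp, hps]
    set Q := (movable move U D).filter fun k => other (height (D k)) = true with hQ
    have hmemQ : ∀ k, k ∈ Q ↔ k ∈ U ∧ (D k).lab t n p = m.s := by
      intro k
      rw [hQ, Finset.mem_filter, R.mem_movable hD hDpos]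
      constructor
      · rintro ⟨⟨hkU, hq | hs⟩, ho⟩
        · rw [other_q _ (hD.valid k) (hDpos k) hq] at ho
          exact absurd ho (by simp)
        · exact ⟨hkU, hs⟩
      · rintro ⟨hkU, hs⟩
        exact ⟨⟨hkU, Or.inr hs⟩, other_s _ (hD.valid k) (hDpos k) hs⟩
    rcases hpick' : pick Q (fun k => height (D k)) with _ | k
    · rw [R.pick_none] at hpick'
      exact absurd hpick' (Finset.Nonempty.ne_empty ⟨j, (hmemQ j).2 ⟨hjU, hDj⟩⟩)
    obtain ⟨hk, hbest'⟩ := R.pick_some _ _ _ hpick'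
    obtain ⟨hkU, hks⟩ := (hmemQ k).1 hk
    obtain ⟨c', hc'⟩ := Option.isSome_iff_exists.1 ((R.isSome_iff hD hDpos k).2 (Or.inr hks))
    -- All competitors labelled s are candidates: they were never broken, or they are the layer just
    -- moved.
    obtain ⟨hE, -⟩ := R.update N D hD hfullD k c' hc' (fun k' hk' hkk' hne => by
      rcases (R.isSome_iff hD hDpos k').1 hk' with hq | hs
      · exact absurd hkk' (ne_of hD hDpos hq hks)
      · refine hbest' k' ((hmemQ k').2 ⟨?_, hs⟩) hne
        rcases eq_or_ne k' j with rfl | hkj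
        · exact hjU
        · rw [hDdef, Function.update_of_ne hkj] at hs
          exact R.mem_of_lab_s hU hs)
    refine ⟨_, by rw [Option.map_some, moveAt_of_eq_some hc'], hE, ?_⟩
    have hcr : c'.lab t n p = m.r := by
      rcases R.lab_of_move _ _ hc' with h | h
      · exact absurd (h.1.symm.trans hks) hqs
      · exact h.2
    rw [cnt_update, hks, hcr, cnt_update, hjq, hcp]
    rw [hP1] at hPcard
    have h1 : m.stepE (cnt t n p C) = relabel m.q m.p (cnt t n p C) := by
      rw [LabMoves.stepE, if_pos]; rw [if_pos hsplit]; omega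
    rw [h1, LabMoves.stepE, if_neg]
    rw [if_pos hsplit]
    simp only [relabel, hqp, hqr.symm, hpr.symm, if_false, if_true]
    omega
  rw [if_neg hP1]
  by_cases hPn : P.Nonempty
  · right
    rw [if_pos hPn]
    -- The excess of q over r is at least 2, so both steps are q → p.
    have hPc : 2 ≤ P.card := by have := hPn.card_pos; omega
    rcases hpick : pick P (fun j => height (C j)) with _ | j
    · rw [R.pick_none] at hpick
      exact absurd hpick hPn.ne_empty
    obtain ⟨hj, hbest⟩ := R.pick_some _ _ _ hpick
    have hjS : j ∈ S := (Finset.mem_filter.1 hj).1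
    obtain ⟨hjU, hjq⟩ := (hmemP j).1 hj
    refine ⟨⟨j, hjS⟩, ?_⟩
    obtain ⟨c, hc, hmove, hD, hfullD, hlab⟩ := R.update_of_mem hn (N := N + 1) hC hfull hU hjS
      (fun k hk hkj hne => by
        obtain ⟨hkU, hq | hs⟩ := hmemS.1 hk
        · exact hbest k ((hmemP k).2 ⟨hkU, hq⟩) hne
        · exact absurd hkj.symm (ne_of hC hpos hjq hs))
    have hcp : c.lab t n p = m.p := by
      rcases hlab with h | h
      · exact h.2
      · exact absurd (hjq.symm.trans h.1) hqs
    rw [Option.bind_some, hmove]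
    set D := Function.update C j c with hDdef
    have hDpos : ∀ k, 0 < (D k).full := fun k => by have := hfullD k; omega
    have hDj : (D j).lab t n p = m.s := by rw [hDdef, Function.update_self, hcp, hps]
    rcases hpick' : pick (P.erase j) (fun k => height (C k)) with _ | k
    · rw [R.pick_none, ← Finset.card_eq_zero, Finset.card_erase_of_mem hj] at hpick'
      omega
    obtain ⟨hk, hbest'⟩ := R.pick_some _ _ _ hpick'
    obtain ⟨hkj, hkP⟩ := Finset.mem_erase.1 hk
    obtain ⟨hkU, hkq⟩ := (hmemP k).1 hkP
    have hDk : D k = C k := by rw [hDdef, Function.update_of_ne hkj]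
    rw [← hDk] at hkq
    obtain ⟨c', hc'⟩ := Option.isSome_iff_exists.1 ((R.isSome_iff hD hDpos k).2 (Or.inl hkq))
    -- The set `U` was determined before the first move. Competitors labelled q are either in `U`,
    -- and then beaten by the choice of k, or broken, and then beaten by every intact q-layer.
    obtain ⟨hE, -⟩ := R.update N D hD hfullD k c' hc' (fun k' hk' hkk' hne => by
      rcases (R.isSome_iff hD hDpos k').1 hk' with hq | hs
      · rcases eq_or_ne k' j with rfl | hk'j
        · exact absurd (hq.symm.trans hDj) hqs
        have hDk' : D k' = C k' := by rw [hDdef, Function.update_of_ne hk'j]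
        refine R.better_congr (fun j => height (C j)) _ _ _ (by simp only [hDk])
          (by simp only [hDk']) ?_
        rw [hDk'] at hq
        by_cases hk'U : k' ∈ U
        · exact hbest' k' (Finset.mem_erase.2 ⟨hk'j, (hmemP k').2 ⟨hk'U, hq⟩⟩) hne
        · exact (hU.broken k' hk'U (Or.inl hq)).2.2 k hkU (hDk ▸ hkq)
      · exact absurd hkk'.symm (ne_of hD hDpos hkq hs))
    refine ⟨_, by rw [Option.map_some, moveAt_of_eq_some hc'], hE, ?_⟩
    have hcr : c'.lab t n p = m.p := by
      rcases R.lab_of_move _ _ hc' with h | h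
      · exact h.2
      · exact absurd (hkq.symm.trans h.1) hqs
    rw [cnt_update, hkq, hcr, cnt_update, hjq, hcp]
    have h1 : m.stepE (cnt t n p C) = relabel m.q m.p (cnt t n p C) := by
      rw [LabMoves.stepE, if_pos]; rw [if_pos hsplit]; omega
    rw [h1, LabMoves.stepE, if_pos]
    rw [if_pos hsplit]
    simp only [relabel, hqp, hqr.symm, hpr.symm, if_false, if_true]
    omega
  · rw [if_neg hPn]
    rw [Finset.not_nonempty_iff_eq_empty] at hPn
    -- No q-layer is intact, so the movable layers are exactly those labelled s.
    have hmemS' : ∀ j, j ∈ S ↔ (C j).lab t n p = m.s := by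
      intro j
      rw [hmemS]
      constructor
      · rintro ⟨hjU, hq | hs⟩
        · exact absurd ((hmemP j).2 ⟨hjU, hq⟩) (by simp [hPn])
        · exact hs
      · exact fun hs => ⟨R.mem_of_lab_s hU hs, Or.inr hs⟩
    have hScard : ((S.card : ℕ) : ℤ) = cnt t n p C m.s := by
      rw [cnt_eq_card]
      congr 2
      ext j
      rw [hmemS', Finset.mem_filter, and_iff_right (Finset.mem_univ j)]
    rcases hpick : pick S (fun j => height (C j)) with _ | j
    · left
      rw [R.pick_none] at hpick
      exact ⟨by rw [hpick]; exact Finset.not_nonempty_empty, rfl⟩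
    right
    obtain ⟨hjS, hbest⟩ := R.pick_some _ _ _ hpick
    have hjs := (hmemS' j).1 hjS
    refine ⟨⟨j, hjS⟩, ?_⟩
    obtain ⟨c, hc, hmove, hD, hfullD, hlab⟩ := R.update_of_mem hn (N := N + 1) hC hfull hU hjS
      (fun k hk _ hne => hbest k hk hne)
    have hcr : c.lab t n p = m.r := by
      rcases hlab with h | h
      · exact absurd (h.1.symm.trans hjs) hqs
      · exact h.2
    rw [Option.bind_some, hmove]
    set D := Function.update C j c with hDdef
    have hDpos : ∀ k, 0 < (D k).full := fun k => by have := hfullD k; omega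
    have hDj : (D j).lab t n p = m.r := by rw [hDdef, Function.update_self, hcr]
    -- The number of s-layers is even, so a second one exists.
    rcases hpick' : pick (S.erase j) (fun k => height (C k)) with _ | k
    · rw [R.pick_none, ← Finset.card_eq_zero, Finset.card_erase_of_mem hjS] at hpick'
      have := Finset.card_pos.2 ⟨j, hjS⟩
      rw [show S.card = 1 by omega] at hScard
      rw [← hScard] at heven
      exact absurd heven (by decide)
    obtain ⟨hk, hbest'⟩ := R.pick_some _ _ _ hpick'
    obtain ⟨hkj, hkS⟩ := Finset.mem_erase.1 hk
    have hks := (hmemS' k).1 hkS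
    have hDk : D k = C k := by rw [hDdef, Function.update_of_ne hkj]
    rw [← hDk] at hks
    obtain ⟨c', hc'⟩ := Option.isSome_iff_exists.1 ((R.isSome_iff hD hDpos k).2 (Or.inr hks))
    obtain ⟨hE, -⟩ := R.update N D hD hfullD k c' hc' (fun k' hk' hkk' hne => by
      rcases (R.isSome_iff hD hDpos k').1 hk' with hq | hs
      · exact absurd hkk' (ne_of hD hDpos hq hks)
      · rcases eq_or_ne k' j with rfl | hk'j
        · exact absurd (hs.symm.trans hDj) hsr
        have hDk' : D k' = C k' := by rw [hDdef, Function.update_of_ne hk'j]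
        refine R.better_congr (fun j => height (C j)) _ _ _ (by simp only [hDk])
          (by simp only [hDk']) ?_
        rw [hDk'] at hs
        exact hbest' k' (Finset.mem_erase.2 ⟨hk'j, (hmemS' k').2 hs⟩) hne)
    refine ⟨_, by rw [Option.map_some, moveAt_of_eq_some hc'], hE, ?_⟩
    have hcr' : c'.lab t n p = m.r := by
      rcases R.lab_of_move _ _ hc' with h | h
      · exact absurd (h.1.symm.trans hks) hqs
      · exact h.2
    rw [cnt_update, hks, hcr', cnt_update, hjs, hcr]
    rw [hPn, Finset.card_empty] at hPcard
    have h1 : m.stepE (cnt t n p C) = relabel m.s m.r (cnt t n p C) := by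
      rw [LabMoves.stepE, if_neg]; rw [if_pos hsplit]; omega
    rw [h1, LabMoves.stepE, if_neg]
    rw [if_pos hsplit]
    simp only [relabel, hqs, hqr, hsr.symm, if_false, if_true]
    omega

end MoveRule
end act
end YoungSlice

/-! ### Splitting, and the operators on slices away from the ground -/

namespace YoungSlice

section split
variable {t : AffineType} {n : ℕ} (hn : minRank t ≤ n) {p : Pattern t n} {i : ℕ} (hi : i ≤ n)
  {L : ℕ} {C : Fin L → Column}
include hn hi

/-- The layers which are broken after `m` splittings. -/
theorem iterate_splitStep_spec (hs : (labMoves t n i).split = true)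
    (hv : ∀ j, (C j).Valid t n p) (hpos : ∀ j, 0 < (C j).full) (m : ℕ) :
    let st := (splitStep t n p (splitIndex t n i) C)^[m] (∅, ∅)
    let A := Finset.univ.filter fun j => (C j).lab t n p = (labMoves t n i).r
    let B := Finset.univ.filter fun j => (C j).lab t n p = (labMoves t n i).q
    st.1 ⊆ A ∧ st.2 ⊆ B ∧ st.1.card = min m (min A.card B.card) ∧
      st.2.card = min m (min A.card B.card) ∧
      (∀ k ∈ st.1, ∀ j ∈ A, j ∉ st.1 → HigherFront (fun j => (C j).topRow) k j) ∧
      ∀ k ∈ st.2, ∀ j ∈ B, j ∉ st.2 → LowerBack (fun j => (C j).slotRow) k j := by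
  intro st A B
  have hqr := (labMoves_split_ne hs).2.2.2.2
  induction m with
  | zero => simp [st]
  | succ m ih =>
    obtain ⟨h1, h2, h3, h4, h5, h6⟩ := ih
    have hst : st = splitStep t n p (splitIndex t n i) C
      ((splitStep t n p (splitIndex t n i) C)^[m] (∅, ∅)) := Function.iterate_succ_apply' _ _ _
    set st' := (splitStep t n p (splitIndex t n i) C)^[m] (∅, ∅)
    -- Since q and r differ, a layer that gave away a half was never a slot to be filled, and
    -- conversely; the next splitting therefore works on the remaining parts of `A` and `B`
    -- separately.
    have hdisj : ∀ j, j ∈ A → j ∈ B → False := fun j hA hB =>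
      hqr ((Finset.mem_filter.1 hB).2.symm.trans (Finset.mem_filter.1 hA).2)
    have hblocks : ((Finset.univ.filter fun j => j ∉ st'.1 ∧ j ∉ st'.2 ∧ (C j).half = none).filter
        fun j => 0 < (C j).full ∧ (splitIndex t n i).matchRow (row t n p ((C j).full - 1)) = true ∧
          giver t n ((C j).full - 1) = true) = A \ st'.1 := by
      ext j
      have := split_block_iff hn p hi hs (hv j) (hpos j)
      simp only [Finset.mem_filter, Finset.mem_univ, true_and, Finset.mem_sdiff, A]
      rw [← this]
      have hAj := hdisj j
      have := @h2 j
      simp only [A, Finset.mem_filter, Finset.mem_univ, true_and] at hAj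
      have := hpos j
      tauto
    have hslots : ((Finset.univ.filter fun j => j ∉ st'.1 ∧ j ∉ st'.2 ∧ (C j).half = none).filter
        fun j => (splitIndex t n i).matchRow (row t n p (C j).full) = true ∧
          receiver t n (C j).full = true) = B \ st'.2 := by
      ext j
      have := split_slot_iff hn p hi hs (hv j)
      simp only [Finset.mem_filter, Finset.mem_univ, true_and, Finset.mem_sdiff, B]
      rw [← this]
      have hBj := hdisj j
      have := @h1 j
      simp only [B, Finset.mem_filter, Finset.mem_univ, true_and] at hBj
      tauto
    simp only [splitStep, hblocks, hslots] at hst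
    have hAc := Finset.card_sdiff_of_subset h1
    have hBc := Finset.card_sdiff_of_subset h2
    have hAle := Finset.card_le_card h1
    have hBle := Finset.card_le_card h2
    rcases hj : frontHighest (A \ st'.1) (fun j => (C j).topRow) with _ | j
    -- One of the two sets is exhausted, and further steps leave the state unchanged.
    · rw [hj] at hst
      rw [frontHighest_eq_none] at hj
      rw [hj, Finset.card_empty] at hAc
      replace hst : st = st' := hst
      rw [hst]
      exact ⟨h1, h2, by omega, by omega, h5, h6⟩
    rcases hk : backLowest (B \ st'.2) (fun j => (C j).slotRow) with _ | k
    · rw [hj, hk] at hst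
      rw [backLowest_eq_none] at hk
      rw [hk, Finset.card_empty] at hBc
      replace hst : st = st' := hst
      rw [hst]
      exact ⟨h1, h2, by omega, by omega, h5, h6⟩
    rw [hj, hk] at hst
    obtain ⟨hj1, hj2⟩ := frontHighest_spec hj
    obtain ⟨hk1, hk2⟩ := backLowest_spec hk
    rw [Finset.mem_sdiff] at hj1 hk1
    have hAp := Finset.card_pos.2 ⟨j, Finset.mem_sdiff.2 hj1⟩
    have hBp := Finset.card_pos.2 ⟨k, Finset.mem_sdiff.2 hk1⟩
    rw [hst]
    refine ⟨Finset.insert_subset hj1.1 h1, Finset.insert_subset hk1.1 h2, ?_, ?_, ?_, ?_⟩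
    · simp only [Finset.card_insert_of_notMem hj1.2]; omega
    · simp only [Finset.card_insert_of_notMem hk1.2]; omega
    · intro j' hj' k' hk' hk''
      rw [Finset.mem_insert, not_or] at hk''
      rcases Finset.mem_insert.1 hj' with rfl | hj'
      · exact hj2 k' (Finset.mem_sdiff.2 ⟨hk', hk''.2⟩) hk''.1
      · exact h5 j' hj' k' hk' hk''.2
    · intro j' hj' k' hk' hk''
      rw [Finset.mem_insert, not_or] at hk''
      rcases Finset.mem_insert.1 hj' with rfl | hj'
      · exact hk2 k' (Finset.mem_sdiff.2 ⟨hk', hk''.2⟩) hk''.1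
      · exact h6 j' hj' k' hk' hk''.2

omit hi in
theorem unbroken_of_not_split (hs : (labMoves t n i).split = false) :
    unbroken t n p i C = Finset.univ := by
  have hstep : ∀ st, splitStep t n p (splitIndex t n i) C st = st := by
    intro st
    have h : ∀ S : Finset (Fin L), (S.filter fun j => 0 < (C j).full ∧
        (splitIndex t n i).matchRow (row t n p ((C j).full - 1)) = true ∧
          giver t n ((C j).full - 1) = true) = ∅ := by
      intro S
      simp [splitIndex_of_not_split hn hs]
    simp only [splitStep, h, frontHighest_eq_none.2]
  have : (splitStep t n p (splitIndex t n i) C)^[L] (∅, ∅) = (∅, ∅) :=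
    Function.iterate_fixed (hstep _) L
  simp [unbroken, this]

/-- Splitting fills the lowest and backmost slots, whereas ẽ_i takes the highest and foremost block.
So the broken q-layers are those ẽ_i would choose last. -/
theorem unbroken_remove (hv : ∀ j, (C j).Valid t n p) (hpos : ∀ j, 0 < (C j).full) :
    Unbroken t n p (labMoves t n i) (HigherFront fun j => (C j).topRow) (unbroken t n p i C) C := by
  rcases hs : (labMoves t n i).split with _ | _
  · rw [unbroken_of_not_split hn hs]
    refine ⟨fun k hk => absurd (Finset.mem_univ k) hk, ?_⟩
    rw [hs, cnt_eq_card]; simp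
  · obtain ⟨h1, h2, h3, h4, h5, h6⟩ := iterate_splitStep_spec hn hi (p := p) hs hv hpos L
    simp only [unbroken]
    set st := (splitStep t n p (splitIndex t n i) C)^[L] (∅, ∅)
    obtain ⟨e1, e2, e3, e4, e5⟩ := labMoves_split_ne hs
    refine ⟨fun k hk hlab => ?_, ?_⟩
    · simp only [Finset.mem_filter, Finset.mem_univ, true_and, not_and_or, not_not] at hk
      rcases hk with hk | hk
      · exfalso
        have := (Finset.mem_filter.1 (h1 hk)).2
        rw [this] at hlab
        rcases hlab with h | h
        · exact e5 h.symm
        · exact e2 h.symm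
      · refine ⟨hs, (Finset.mem_filter.1 (h2 hk)).2, fun j hj hjq => ?_⟩
        simp only [Finset.mem_filter, Finset.mem_univ, true_and] at hj
        -- For columns without a half block the slot lies one row above the top, so lower and
        -- further back for slots is the reverse of higher and further in front for blocks.
        have := h6 k hk j (by simp [hjq]) hj.2
        have hk1 := ((split_slot_iff hn p hi hs (hv k)).2 (Finset.mem_filter.1 (h2 hk)).2).1
        have hj1 := ((split_slot_iff hn p hi hs (hv j)).2 hjq).1
        have hk2 := hpos k
        have hj2 := hpos j
        simp only [LowerBack, HigherFront, Column.slotRow, Column.topRow, hk1, hj1, if_true] at *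
        omega
    · have hsd : ((Finset.univ.filter fun j => j ∉ st.1 ∧ j ∉ st.2).filter fun j =>
          (C j).lab t n p = (labMoves t n i).q) =
          (Finset.univ.filter fun j => (C j).lab t n p = (labMoves t n i).q) \ st.2 := by
        ext j
        have := @h1 j
        simp only [Finset.mem_filter, Finset.mem_univ, true_and, Finset.mem_sdiff] at this ⊢
        constructor
        · rintro ⟨⟨_, h⟩, h'⟩; exact ⟨h', h⟩
        · rintro ⟨h, h'⟩; exact ⟨⟨fun h'' => e5 (h.symm.trans (this h'')), h'⟩, h⟩
      rw [hsd, Finset.card_sdiff_of_subset h2, h4, if_pos hs, cnt_eq_card, cnt_eq_card]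
      -- Neither set has more than L elements, so L splittings suffice and min(|A|, |B|) pairs are
      -- broken.
      have hA := Finset.card_le_univ
        (Finset.univ.filter fun j => (C j).lab t n p = (labMoves t n i).r)
      have hB := Finset.card_le_univ
        (Finset.univ.filter fun j => (C j).lab t n p = (labMoves t n i).q)
      rw [Fintype.card_fin] at hA hB
      omega

/-- The mirror image: splitting takes halves from the highest and foremost r-layers, and f̃_i fills
the lowest and backmost slot. -/
theorem unbroken_add (hv : ∀ j, (C j).Valid t n p) (hpos : ∀ j, 0 < (C j).full) :
    Unbroken t n p (labMoves t n i).flip (LowerBack fun j => (C j).slotRow)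
      (unbroken t n p i C) C := by
  rcases hs : (labMoves t n i).split with _ | _
  · rw [unbroken_of_not_split hn hs]
    refine ⟨fun k hk => absurd (Finset.mem_univ k) hk, ?_⟩
    simp [LabMoves.flip, hs, cnt_eq_card]
  · obtain ⟨h1, h2, h3, h4, h5, h6⟩ := iterate_splitStep_spec hn hi (p := p) hs hv hpos L
    simp only [unbroken]
    set st := (splitStep t n p (splitIndex t n i) C)^[L] (∅, ∅)
    obtain ⟨e1, e2, e3, e4, e5⟩ := labMoves_split_ne hs
    refine ⟨fun k hk hlab => ?_, ?_⟩
    · simp only [Finset.mem_filter, Finset.mem_univ, true_and, not_and_or, not_not] at hk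
      simp only [LabMoves.flip] at hlab ⊢
      rcases hk with hk | hk
      · refine ⟨hs, (Finset.mem_filter.1 (h1 hk)).2, fun j hj hjq => ?_⟩
        simp only [Finset.mem_filter, Finset.mem_univ, true_and] at hj
        have := h5 k hk j (by simp [hjq]) hj.1
        have hk2 := hpos k
        have hj2 := hpos j
        have hk1 := ((split_block_iff hn p hi hs (hv k) hk2).2 (Finset.mem_filter.1 (h1 hk)).2).1
        have hj1 := ((split_block_iff hn p hi hs (hv j) hj2).2 hjq).1
        simp only [LowerBack, HigherFront, Column.slotRow, Column.topRow, hk1, hj1, if_true] at *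
        omega
      · exfalso
        have := (Finset.mem_filter.1 (h2 hk)).2
        rw [this] at hlab
        rcases hlab with h | h
        · exact e5 h
        · exact e1 h
    · have hsd : ((Finset.univ.filter fun j => j ∉ st.1 ∧ j ∉ st.2).filter fun j =>
          (C j).lab t n p = (labMoves t n i).r) =
          (Finset.univ.filter fun j => (C j).lab t n p = (labMoves t n i).r) \ st.1 := by
        ext j
        have := @h2 j
        simp only [Finset.mem_filter, Finset.mem_univ, true_and, Finset.mem_sdiff] at this ⊢
        constructor
        · rintro ⟨⟨h, _⟩, h'⟩; exact ⟨h', h⟩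
        · rintro ⟨h, h'⟩; exact ⟨⟨h', fun h'' => e5 ((this h'').symm.trans h)⟩, h⟩
      change (((Finset.filter (fun j => (C j).lab t n p = (labMoves t n i).r)
        (Finset.univ.filter fun j => j ∉ st.1 ∧ j ∉ st.2)).card : ℕ) : ℤ) =
        max 0 (cnt t n p C (labMoves t n i).r -
          if (labMoves t n i).split = true then cnt t n p C (labMoves t n i).q else 0)
      rw [hsd, Finset.card_sdiff_of_subset h1, h3, if_pos hs, cnt_eq_card, cnt_eq_card]
      have hA := Finset.card_le_univ
        (Finset.univ.filter fun j => (C j).lab t n p = (labMoves t n i).r)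
      have hB := Finset.card_le_univ
        (Finset.univ.filter fun j => (C j).lab t n p = (labMoves t n i).q)
      rw [Fintype.card_fin] at hA hB
      omega

end split

theorem giver_congr {t : AffineType} {n : ℕ} {a b : ℕ} (h : a % period t n = b % period t n) :
    giver t n a = giver t n b := by
  cases t <;> simp only [giver, supporting, covering, h]

theorem receiver_congr {t : AffineType} {n : ℕ} {a b : ℕ} (h : a % period t n = b % period t n) :
    receiver t n a = receiver t n b := by
  cases t <;> simp only [receiver, supporting, covering, h]

/-- Locates the labels around the 01-row; needed where preference does not separate q from s, and
for the incompatibility of the two half blocks. -/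
theorem lab_half {t : AffineType} (ht : t = .B1 ∨ t = .A2odd) {n : ℕ} (hn : minRank t ≤ n)
    (p : Pattern t n) {c : Column} (hv : c.Valid t n p) :
    (c.lab t n p = .u 1 ∨ c.lab t n p = .v 1 → c.half ≠ none ∧ c.full % period t n = 0) ∧
    (c.lab t n p = .u 2 → c.half = none ∧ c.full % period t n = 1) ∧
    (c.lab t n p = .v 2 → c.half = none ∧ c.full % period t n = 0) := by
  obtain ⟨r, half⟩ := c
  have h2 := Nat.mod_lt r (period_pos hn)
  rcases ht with rfl | rfl <;> simp only [minRank, period] at * <;> change Bool at p <;>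
  · rcases half with _ | s
    · simp only [Column.lab]; grind
    · have hr := half_mod hv
      simp only [Column.lab]; grind

theorem unsharp_iff {t : AffineType} {i : ℕ} : ¬ Sharp t i ↔ (t = .B1 ∨ t = .A2odd) ∧ i ≤ 1 := by
  cases t <;> simp [Sharp]

theorem q_ne_s_and {t : AffineType} {n : ℕ} (hn : minRank t ≤ n) (i : ℕ) :
    (labMoves t n i).q ≠ (labMoves t n i).s ∧ (labMoves t n i).r ≠ (labMoves t n i).p := by
  cases t <;> simp only [labMoves, minRank] at * <;> (try split_ifs) <;> simp <;> omega

theorem split_sharp {t : AffineType} {n i : ℕ} (h : (labMoves t n i).split = true) :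
    Sharp t i := by
  by_contra hs
  obtain ⟨ht, hi⟩ := unsharp_iff.1 hs
  rw [labMoves_fork i ht] at h
  rcases Nat.le_one_iff_eq_zero_or_eq_one.1 hi with rfl | rfl <;> simp at h

theorem labMoves_unsharp {t : AffineType} {n i : ℕ} (h : ¬ Sharp t i) :
    ((labMoves t n i).q = .u 1 ∨ (labMoves t n i).q = .v 1) ∧ (labMoves t n i).s = .u 2 ∧
    ((labMoves t n i).r = .u 1 ∨ (labMoves t n i).r = .v 1) ∧ (labMoves t n i).p = .v 2 := by
  obtain ⟨ht, hi⟩ := unsharp_iff.1 h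
  rw [labMoves_fork i ht]
  rcases Nat.le_one_iff_eq_zero_or_eq_one.1 hi with rfl | rfl <;> simp

theorem labMoves_double {t : AffineType} {n i : ℕ} (hn : minRank t ≤ n)
    (h : isDouble t n i = true) : (labMoves t n i).p = (labMoves t n i).s ∧
      (labMoves t n i).q ≠ .v 0 ∧ (labMoves t n i).r ≠ .v 0 := by
  cases t <;> simp [isDouble, minRank] at * <;> subst h <;> simp [labMoves]
  have h0 : i ≠ 0 := by omega
  have h1 : i ≠ 1 := by omega
  simp [h0, h1]

section rules
variable {t : AffineType} {n : ℕ} (hn : minRank t ≤ n) (p : Pattern t n) {i : ℕ} (hi : i ≤ n)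
  (L : ℕ)
include hn hi

/-- Besides collecting the facts about labels, this contains two geometric arguments: a complete
01-row never takes precedence over a half one, and the highest foremost layer can be shortened. -/
theorem moveRule_remove : MoveRule t n p (labMoves t n i) L (Sharp t i) (Column.remove t n p i)
    Column.topRow frontHighest HigherFront (receiver t n) where
  lab_of_move _ _ := remove_lab hn p hi
  isSome _ hv hpos := exists_remove hn p hi hv hpos
  preferred_q _ hv hpos := (receiver_topRow hn p hi hv hpos).1
  preferred_s hs _ _ hv hpos := (receiver_topRow hn p hi hv hpos).2.1 hs
  preferred_congr _ _ := receiver_congr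
  unsharp hs C hC _ j k hk hj := by
    obtain ⟨h1, h2, -, -⟩ := labMoves_unsharp (n := n) hs
    have ht := (unsharp_iff.1 hs).1
    obtain ⟨k1, k2⟩ := (lab_half ht hn p (hC.valid k)).1 (hk ▸ h1)
    obtain ⟨j1, j2⟩ := (lab_half ht hn p (hC.valid j)).2.1 (hj.trans h2)
    have hdel := hC.delta j k
    have hmono := hC.mono j k
    simp only [HigherFront, Column.topRow, k1, j1, if_true, if_false]
    simp only [Column.Sub, Column.addDelta] at hdel hmono
    have ek := Nat.div_add_mod (C k).full (period t n)
    have ej := Nat.div_add_mod (C j).full (period t n)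
    rw [k2] at ek
    rw [j2] at ej
    -- If the 01-row of layer j were higher, it would be at least a cycle higher and complete, hence
    -- not contained in c_k + δ. If it were in the same row and further in front, it would have to
    -- lie in a half row.
    rintro (h | ⟨h, h'⟩)
    · have h3 : (C k).full / period t n < (C j).full / period t n :=
        Nat.lt_of_mul_lt_mul_left (a := period t n) (by omega)
      have := Nat.mul_le_mul_left (period t n) (Nat.succ_le_of_lt h3)
      rw [Nat.mul_succ] at this
      omega
    · have := hmono h'.le
      omega
  update N C hC hfull j c hc h := by
    have hP := period_pos hn
    -- The rows of both possible obstructions, the same row and the row one cycle higher, are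
    -- congruent to that of j, so the assumption on congruent heights excludes them.
    refine ⟨hC.remove hn hc (fun j => by have := hfull j; omega) fun k hk =>
      ⟨fun hkj => ?_, fun hkj => ?_⟩, fun k => ?_⟩
    · have := h k hk (by rw [hkj.1]) hkj.2.ne
      simp only [HigherFront] at this
      have h3 := hkj.2
      omega
    · have := h k hk (by rw [hkj, Nat.add_mod_right]) (by rintro rfl; omega)
      simp only [HigherFront] at this
      omega
    · rcases eq_or_ne k j with rfl | hkj
      · rw [Function.update_self]
        have := full_of_remove hc
        have := hfull k
        omega
      · rw [Function.update_of_ne hkj]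
        have := hfull k
        omega
  pick_none _ _ := frontHighest_eq_none
  pick_some _ _ _ := frontHighest_spec
  better_congr h h' j k h1 h2 h3 := by simpa only [HigherFront, h1, h2] using h3
  split_sharp := split_sharp
  q_ne_s := (q_ne_s_and hn i).1
  split_ne hs := by
    obtain ⟨h1, h2, h3, -, h5⟩ := labMoves_split_ne hs
    exact ⟨h1, h2, h3, h5⟩

/-- The same argument with the moves flipped: a slot next to a half block precedes an empty 01-row,
and the lowest backmost layer can be enlarged. -/
theorem moveRule_add : MoveRule t n p (labMoves t n i).flip L (Sharp t i) (Column.add t n p i)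
    Column.slotRow backLowest LowerBack (giver t n) where
  lab_of_move _ _ := add_lab hn p hi
  isSome _ hv _ := exists_add hn p hi hv
  preferred_q _ hv _ := (giver_slotRow hn p hi hv).1
  preferred_s hs hq _ hv _ h := (giver_slotRow hn p hi hv).2.1 hs h hq
  preferred_congr _ _ := giver_congr
  unsharp hs C hC _ j k hk hj := by
    obtain ⟨-, -, h1, h2⟩ := labMoves_unsharp (n := n) hs
    have ht := (unsharp_iff.1 hs).1
    simp only [LabMoves.flip] at hk hj
    obtain ⟨k1, k2⟩ := (lab_half ht hn p (hC.valid k)).1 (hk ▸ h1)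
    obtain ⟨j1, j2⟩ := (lab_half ht hn p (hC.valid j)).2.2 (hj.trans h2)
    have hdel := hC.delta k j
    have hmono := hC.mono k j
    simp only [LowerBack, Column.slotRow]
    simp only [Column.Sub, Column.addDelta, j1, k1, or_false, and_false] at hdel hmono
    have ek := Nat.div_add_mod (C k).full (period t n)
    have ej := Nat.div_add_mod (C j).full (period t n)
    rw [k2] at ek
    rw [j2] at ej
    rintro (h | ⟨h, h'⟩)
    · have h3 : (C j).full / period t n < (C k).full / period t n :=
        Nat.lt_of_mul_lt_mul_left (a := period t n) (by omega)
      have := Nat.mul_le_mul_left (period t n) (Nat.succ_le_of_lt h3)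
      rw [Nat.mul_succ] at this
      omega
    · have := hmono h'.le
      omega
  update N C hC hfull j c hc h := by
    have hP := period_pos hn
    refine ⟨hC.add hn hc fun k hk => ⟨fun hkj => ?_, fun hkj => ?_⟩, fun k => ?_⟩
    · have := h k hk (by rw [hkj.1]) hkj.2.ne'
      simp only [LowerBack] at this
      have h3 := hkj.2
      omega
    · have := h k hk (by rw [← hkj, Nat.add_mod_right]) (by rintro rfl; omega)
      simp only [LowerBack] at this
      omega
    · have := hfull k
      rcases eq_or_ne k j with rfl | hkj
      · rw [Function.update_self]
        have := sub_of_add hc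
        simp only [Column.Sub] at this
        omega
      · rw [Function.update_of_ne hkj]
        omega
  pick_none _ _ := backLowest_eq_none
  pick_some _ _ _ := backLowest_spec
  better_congr h h' j k h1 h2 h3 := by simpa only [LowerBack, h1, h2] using h3
  split_sharp := split_sharp
  q_ne_s := (q_ne_s_and hn i).2
  split_ne hs := by
    obtain ⟨h1, h2, -, h4, h5⟩ := labMoves_split_ne hs
    exact ⟨h2.symm, h1.symm, h4.symm, h5.symm⟩

variable {p L}

/-- The action of `ẽ_i` on the labels of a slice away from the ground. -/
theorem sliceE_spec {C : Fin L → Column} (hC : Chain t n p C) (hfull : ∀ j, 2 ≤ (C j).full)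
    (heven : isDouble t n i = true → Even (cnt t n p C (labMoves t n i).s)) :
    (¬ (labMoves t n i).canE (cnt t n p C) ∧ sliceE t n p i C = none) ∨
    ((labMoves t n i).canE (cnt t n p C) ∧ ∃ D, sliceE t n p i C = some D ∧ Chain t n p D ∧
      cnt t n p D = if isDouble t n i = true then
        (labMoves t n i).stepE ((labMoves t n i).stepE (cnt t n p C))
        else (labMoves t n i).stepE (cnt t n p C)) := by
  have hU := unbroken_remove hn hi hC.valid (fun j => by have := hfull j; omega)
  have R := moveRule_remove hn p hi L
  rw [sliceE]
  split_ifs with hd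
  · obtain ⟨hps, hq0, -⟩ := labMoves_double hn hd
    exact R.actTwice_spec hn (isDouble_split hn hd) hps hq0
      (fun c hv hpos => (receiver_topRow hn p hi hv hpos).2.2.1 hd)
      (fun c hv hpos => (receiver_topRow hn p hi hv hpos).2.2.2 hd)
      (fun _ _ => giver_congr) (N := 0) hC hfull hU (heven hd)
  · exact R.actOnce_spec hn (N := 1) hC hfull hU

/-- The action of `f̃_i` on the labels of a slice away from the ground. -/
theorem sliceF_spec {C : Fin L → Column} (hC : Chain t n p C) (hfull : ∀ j, 2 ≤ (C j).full)
    (heven : isDouble t n i = true → Even (cnt t n p C (labMoves t n i).p)) :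
    (¬ (labMoves t n i).canF (cnt t n p C) ∧ sliceF t n p i C = none) ∨
    ((labMoves t n i).canF (cnt t n p C) ∧ ∃ D, sliceF t n p i C = some D ∧ Chain t n p D ∧
      cnt t n p D = if isDouble t n i = true then
        (labMoves t n i).stepF ((labMoves t n i).stepF (cnt t n p C))
        else (labMoves t n i).stepF (cnt t n p C)) := by
  have hU := unbroken_add hn hi hC.valid (fun j => by have := hfull j; omega)
  have R := moveRule_add hn p hi L
  rw [sliceF]
  split_ifs with hd
  · obtain ⟨hps, -, hr0⟩ := labMoves_double hn hd
    exact R.actTwice_spec hn (isDouble_split hn hd) hps.symm hr0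
      (fun c hv hpos => (giver_slotRow hn p hi hv).2.2.1 hd)
      (fun c hv hpos => (giver_slotRow hn p hi hv).2.2.2 hd)
      (fun _ _ => receiver_congr) (N := 0) hC hfull hU (heven hd)
  · exact R.actOnce_spec hn (N := 1) hC hfull hU

end rules
end YoungSlice

/-! ### Classes of slices are determined by label counts -/

namespace YoungSlice

section shift
variable {t : AffineType} {n : ℕ} {p : Pattern t n} {L : ℕ} {C D : Fin L → Column}

theorem cnt_addDelta (C : Fin L → Column) : cnt t n p (addDelta t n C) = cnt t n p C := by
  funext a
  obtain _ | L := L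
  · simp [cnt]
  -- On labels, adding δ is the cyclic rotation j ↦ j + 1 of the layers.
  · refine Eq.trans (Finset.sum_congr rfl fun j _ => ?_) (Equiv.sum_comp
      (Equiv.addRight (1 : Fin (L + 1))) fun j => if (C j).lab t n p = a then (1 : ℤ) else 0)
    have h : ((addDelta t n C) j).lab t n p = (C (j + 1)).lab t n p := by
      have hv := Fin.val_add_one j
      unfold addDelta
      split_ifs with hj
      · congr 2
        rw [if_neg (by rintro rfl; simp at hj)] at hv
        exact Fin.ext hv.symm
      · rw [lab_addDelta]
        congr 2
        rw [if_pos (Fin.ext (by simp only [Fin.val_last]; omega))] at hv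
        exact Fin.ext hv.symm
    rw [h, Equiv.coe_addRight]

theorem cnt_iterate_addDelta (k : ℕ) (C : Fin L → Column) :
    cnt t n p ((addDelta t n)^[k] C) = cnt t n p C := by
  induction k with
  | zero => rfl
  | succ k ih => rw [Function.iterate_succ_apply', cnt_addDelta, ih]

theorem Chain.addDelta (hn : minRank t ≤ n) (hC : Chain t n p C) :
    Chain t n p (addDelta t n C) := by
  refine ⟨fun j => ?_, fun j k hjk => ?_, fun j k => ?_⟩
  · unfold YoungSlice.addDelta
    split_ifs
    · exact hC.valid _
    · exact (hC.valid _).addDelta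
  · have hjk' : j.val ≤ k.val := hjk
    unfold YoungSlice.addDelta
    split_ifs
    · exact hC.mono _ _ (Fin.mk_le_mk.2 (by omega))
    · exact hC.delta _ _
    · omega
    · exact .refl _
  · unfold YoungSlice.addDelta
    split_ifs
    · exact hC.delta _ _
    · exact (hC.delta _ _).trans (Column.sub_addDelta hn _)
    · exact (hC.mono _ _ (Fin.mk_le_mk.2 (by omega))).addDelta
    · exact Column.sub_addDelta hn _

theorem full_le_of_sub {c d : Column} (h : c.Sub d) : c.full ≤ d.full := by
  simp only [Column.Sub] at h; omega

theorem sum_full_addDelta (hL : 0 < L) (C : Fin L → Column) :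
    ∑ j, (addDelta t n C j).full = ∑ j, (C j).full + period t n := by
  obtain ⟨L, rfl⟩ : ∃ M, L = M + 1 := ⟨L - 1, by omega⟩
  rw [Fin.sum_univ_castSucc, Fin.sum_univ_succ (fun j => (C j).full)]
  have h1 : ∀ j : Fin L, addDelta t n C j.castSucc = C j.succ := by
    intro j
    unfold addDelta
    rw [dif_pos (by simp)]
    rfl
  have h2 : addDelta t n C (Fin.last L) = (C 0).addDelta t n := by
    unfold addDelta
    rw [dif_neg (by simp)]
    rfl
  simp only [h1, h2, Column.addDelta]
  omega

/-- Every chain can be shifted such that all layers end in the same cycle. -/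
theorem exists_iterate_addDelta (hn : minRank t ≤ n) (K : ℕ) : ∀ (M : ℕ) (C : Fin L → Column),
    Chain t n p C → (∀ j, (C j).full < (K + 1) * period t n) →
    L * ((K + 1) * period t n) ≤ ∑ j, (C j).full + M →
    ∃ k, Chain t n p ((addDelta t n)^[k] C) ∧
      ∀ j, ((addDelta t n)^[k] C j).full / period t n = K := by
  have hP := period_pos hn
  intro M
  induction M using Nat.strong_induction_on with
  | _ M ih =>
    intro C hC hlt hM
    by_cases hall : ∀ j, K * period t n ≤ (C j).full
    · refine ⟨0, hC, fun j => ?_⟩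
      exact Nat.div_eq_of_lt_le (hall j) (hlt j)
    · push Not at hall
      obtain ⟨j, hj⟩ := hall
      have hL : 0 < L := j.pos
      -- The front layer also ends below the cycle `K`, so raising it by a period keeps it below the
      -- bound. Each shift adds a period to the total height, which is bounded; hence the process
      -- ends.
      have h0 := full_le_of_sub (hC.mono ⟨0, hL⟩ j (Fin.mk_le_mk.2 (Nat.zero_le _)))
      have hlt' : ∀ j, (addDelta t n C j).full < (K + 1) * period t n := by
        intro j
        unfold addDelta
        split_ifs
        · exact hlt _
        · simp only [Column.addDelta]; rw [Nat.add_mul]; omega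
      have hsum := sum_full_addDelta (t := t) (n := n) hL C
      have hle : ∑ j, (addDelta t n C j).full ≤ L * ((K + 1) * period t n) := by
        have := Finset.sum_le_sum fun (j : Fin L) (_ : j ∈ Finset.univ) => (hlt' j).le
        simpa using this
      obtain ⟨k, h1, h2⟩ := ih (M - period t n) (by omega) (addDelta t n C) (hC.addDelta hn) hlt'
        (by omega)
      exact ⟨k + 1, h1, h2⟩

/-- Within one cycle labels determine columns, so equal counts mean equal multisets of layers; and a
multiset has at most one arrangement increasing for the antisymmetric relation of inclusion. -/
theorem eq_of_cnt_eq (hn : minRank t ≤ n) (hC : Chain t n p C) (hD : Chain t n p D) {K : ℕ}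
    (hCK : ∀ j, (C j).full / period t n = K) (hDK : ∀ j, (D j).full / period t n = K)
    (h : cnt t n p C = cnt t n p D) : C = D := by
  classical
  have h1 : (Finset.univ : Finset (Fin L)).val.map (fun j => (C j).lab t n p) =
      (Finset.univ : Finset (Fin L)).val.map (fun j => (D j).lab t n p) := by
    ext a
    have := congrFun h a
    rw [cnt_eq_card, cnt_eq_card, Nat.cast_inj] at this
    rw [Multiset.count_map, Multiset.count_map]
    simp only [eq_comm (a := a)]
    exact this
  let good : Set Column := {c | c.Valid t n p ∧ c.full / period t n = K}
  have hinj : Set.InjOn (Column.lab t n p) good := fun c hc d hd hcd =>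
    lab_injective hn p hc.1 hd.1 (hc.2.trans hd.2.symm) hcd
  have : Nonempty Column := ⟨⟨0, none⟩⟩
  have hleft : ∀ c ∈ good, Function.invFunOn (Column.lab t n p) good (c.lab t n p) = c :=
    fun c hc => hinj.leftInvOn_invFunOn hc
  have h2 := congrArg (Multiset.map (Function.invFunOn (Column.lab t n p) good)) h1
  simp only [Multiset.map_map, Function.comp_def, hleft _ ⟨hC.valid _, hCK _⟩,
    hleft _ ⟨hD.valid _, hDK _⟩] at h2
  rw [Fin.univ_val_map, Fin.univ_val_map, Multiset.coe_eq_coe] at h2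
  refine List.ofFn_injective (List.Perm.eq_of_pairwise (le := Column.Sub)
    (fun _ _ _ _ => Column.Sub.antisymm) ?_ ?_ h2)
  · exact List.pairwise_ofFn.2 fun i j hij => hC.mono i j hij.le
  · exact List.pairwise_ofFn.2 fun i j hij => hD.mono i j hij.le

theorem iterate_addDelta_of_cnt_eq (hn : minRank t ≤ n) (hC : Chain t n p C)
    (hD : Chain t n p D) (h : cnt t n p C = cnt t n p D) :
    ∃ k, D = (addDelta t n)^[k] C ∨ C = (addDelta t n)^[k] D := by
  have hP := period_pos hn
  obtain ⟨K, hK⟩ : ∃ K, ∀ j, (C j).full < (K + 1) * period t n ∧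
      (D j).full < (K + 1) * period t n := by
    -- Any common bound on the heights would do; the sum is a convenient one.
    refine ⟨∑ j, ((C j).full + (D j).full), fun j => ?_⟩
    have := Finset.single_le_sum (f := fun j => (C j).full + (D j).full)
      (fun _ _ => Nat.zero_le _) (Finset.mem_univ j)
    have h2 := Nat.le_mul_of_pos_right (∑ j, ((C j).full + (D j).full) + 1) hP
    omega
  obtain ⟨k, hCk, hCk'⟩ := exists_iterate_addDelta hn K _ C hC (fun j => (hK j).1)
    (Nat.le_add_left _ _)
  obtain ⟨k', hDk, hDk'⟩ := exists_iterate_addDelta hn K _ D hD (fun j => (hK j).2)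
    (Nat.le_add_left _ _)
  have heq := eq_of_cnt_eq hn hCk hDk hCk' hDk'
    (by rw [cnt_iterate_addDelta, cnt_iterate_addDelta, h])
  have inj := fun k => (addDelta_injective t n L).iterate k
  rcases le_total k k' with hkk | hkk
  · refine ⟨k' - k, Or.inr (inj k ?_)⟩
    rw [heq, ← Function.iterate_add_apply]
    congr 2; omega
  · refine ⟨k - k', Or.inl (inj k' ?_)⟩
    rw [← heq, ← Function.iterate_add_apply]
    congr 2; omega

theorem related_iff (hn : minRank t ≤ n) {l : ℕ} {C D : Slice t n p l} :
    Related C D ↔ cnt t n p C.1 = cnt t n p D.1 := by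
  constructor
  · rintro ⟨k, h | h⟩
    · rw [h, cnt_iterate_addDelta]
    · rw [h, cnt_iterate_addDelta]
  · exact iterate_addDelta_of_cnt_eq hn (isSlice_iff.1 C.2).1 (isSlice_iff.1 D.2).1

end shift

/-! ### Which label counts occur for slices -/

section counts
variable {t : AffineType} {n : ℕ} {p : Pattern t n} {L : ℕ}

/-- The labels of the columns of rank `n`. -/
def labels (n : ℕ) : Finset Lab :=
  (Finset.range (n + 1)).image .u ∪ (Finset.range (n + 1)).image .v ∪ {.w}

theorem mem_labels {a : Lab} (ha : a.Occurs t n) : a ∈ labels n := by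
  cases t <;> cases a <;> simp [Lab.Occurs, labels] at * <;> omega

theorem sum_labels {M : Type} [AddCommMonoid M] (g : Lab → M) : ∑ a ∈ labels n, g a =
    ∑ i ∈ Finset.range (n + 1), g (.u i) + ∑ i ∈ Finset.range (n + 1), g (.v i) + g .w := by
  rw [labels, Finset.sum_union (by simp), Finset.sum_union, Finset.sum_image (by simp),
    Finset.sum_image (by simp), Finset.sum_singleton]
  rw [Finset.disjoint_left]
  simp only [Finset.mem_image, Finset.mem_range]
  rintro _ ⟨i, -, rfl⟩ ⟨j, -, h⟩
  cases h

theorem sum_cnt (hn : minRank t ≤ n) (C : Fin L → Column) :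
    ∑ a ∈ labels n, cnt t n p C a = L := by
  simp only [cnt_eq_card]
  rw [← Nat.cast_sum, ← Finset.card_eq_sum_card_fiberwise, Finset.card_univ, Fintype.card_fin]
  exact fun j _ => mem_labels (occurs_lab hn p (C j))

/-- The numbers of layers with the various labels which occur for slices. -/
structure Admissible (t : AffineType) (n L : ℕ) (g : Lab → ℤ) : Prop where
  nonneg : ∀ a, 0 ≤ g a
  eq_zero : ∀ a, ¬ a.Occurs t n → g a = 0
  sum_eq : ∑ a ∈ labels n, g a = L
  clash : t = .B1 ∨ t = .A2odd → g (.u 1) = 0 ∨ g (.v 1) = 0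

theorem half_ne_none (hn : minRank t ≤ n) {c : Column} (hv : c.Valid t n p) (h : c.half ≠ none) :
    (t = .B1 ∨ t = .A2odd) ∧ (c.lab t n p = .u 1 ∨ c.lab t n p = .v 1) := by
  have h1 := hv.resolve_left h
  obtain ⟨r, half⟩ := c
  rcases half with _ | s
  · exact absurd rfl h
  cases t
  case B1 | A2odd => refine ⟨by simp, ?_⟩; simp only [Column.lab]; split_ifs <;> simp
  all_goals simp [row, Row.isPair] at h1

/-- The essential point is `clash`: a lone 0-block and a lone 1-block in the same row are
incomparable, and the inclusion in c_1 + δ extends this to different cycles. -/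
theorem Chain.admissible (hn : minRank t ≤ n) {C : Fin L → Column} (hC : Chain t n p C) :
    Admissible t n L (cnt t n p C) where
  nonneg a := by rw [cnt_eq_card]; exact Int.natCast_nonneg _
  eq_zero a ha := by
    by_contra h
    have h1 : 0 ≤ cnt t n p C a := by rw [cnt_eq_card]; exact Int.natCast_nonneg _
    obtain ⟨j, hj⟩ := cnt_pos_iff.1 (lt_of_le_of_ne h1 (Ne.symm h))
    exact ha (hj ▸ occurs_lab hn p (C j))
  sum_eq := sum_cnt hn C
  clash ht := by
    by_contra hcon
    rw [not_or] at hcon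
    have h1 : ∀ a, 0 ≤ cnt t n p C a := fun a => by rw [cnt_eq_card]; exact Int.natCast_nonneg _
    obtain ⟨j, hj⟩ := cnt_pos_iff.1 (lt_of_le_of_ne (h1 _) (Ne.symm hcon.1))
    obtain ⟨k, hk⟩ := cnt_pos_iff.1 (lt_of_le_of_ne (h1 _) (Ne.symm hcon.2))
    obtain ⟨j1, j2⟩ := (lab_half ht hn p (hC.valid j)).1 (Or.inl hj)
    obtain ⟨k1, k2⟩ := (lab_half ht hn p (hC.valid k)).1 (Or.inr hk)
    -- Two layers ending in a half row are equal, or the larger one is the smaller one plus δ;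
    -- either way the labels agree.
    have key : ∀ a b : Fin L, a ≤ b → (C a).half ≠ none → (C b).half ≠ none →
        (C a).full % period t n = 0 → (C b).full % period t n = 0 →
        (C a).lab t n p = (C b).lab t n p := by
      intro a b hab a1 b1 a2 b2
      have h1 := hC.mono a b hab
      have h2 := hC.delta b a
      simp only [Column.Sub, a1, b1, false_or, Column.addDelta] at h1 h2
      rcases h1 with h1 | ⟨h1, h1'⟩
      · have ek := Nat.div_add_mod (C a).full (period t n)
        have ej := Nat.div_add_mod (C b).full (period t n)
        rw [a2] at ek
        rw [b2] at ej
        have h3 : (C a).full / period t n < (C b).full / period t n :=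
          Nat.lt_of_mul_lt_mul_left (a := period t n) (by omega)
        have := Nat.mul_le_mul_left (period t n) (Nat.succ_le_of_lt h3)
        rw [Nat.mul_succ] at this
        obtain ⟨h4, h5⟩ := h2.resolve_left (by omega)
        have : C b = (C a).addDelta t n := by
          rcases hb : C b with ⟨x, y⟩
          simp only [hb] at h4 h5
          simp only [Column.addDelta, h4, h5]
        rw [this, lab_addDelta]
      · have : C a = C b := by
          rcases ha : C a with ⟨x, y⟩
          rcases hb : C b with ⟨x', y'⟩
          simp only [ha, hb] at h1 h1'
          simp only [h1, h1']
        rw [this]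
    rcases le_total j k with h | h
    · have := key j k h j1 k1 j2 k2
      rw [hj, hk] at this
      cases this
    · have := key k j h k1 j1 k2 j2
      rw [hj, hk] at this
      cases this

theorem exists_fun_card_eq {g : Lab → ℤ} (hg : Admissible t n L g) :
    ∃ f : Fin L → Lab, ∀ a, ((Finset.univ.filter fun j => f j = a).card : ℤ) = g a := by
  let F : Lab →₀ ℕ := Finsupp.onFinset (labels n) (fun a => (g a).toNat) (fun a ha => by
    by_contra h
    refine ha ?_
    rw [hg.eq_zero a fun h' => h (mem_labels h')]
    rfl)
  have hcard : (Finsupp.toMultiset F).card = L := by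
    rw [Finsupp.card_toMultiset, Finsupp.onFinset_sum _ (fun _ => rfl)]
    have h := hg.sum_eq
    have h2 : ∑ a ∈ labels n, g a = ((∑ a ∈ labels n, (g a).toNat : ℕ) : ℤ) := by
      rw [Nat.cast_sum]
      exact Finset.sum_congr rfl fun a _ => (Int.toNat_of_nonneg (hg.nonneg a)).symm
    rw [h2] at h
    exact_mod_cast h
  have key : ∀ M : Multiset Lab, M.card = L →
      ∃ f : Fin L → Lab, ∀ a, (Finset.univ.filter fun j => f j = a).card = M.count a := by
    intro M
    induction M using Quotient.inductionOn with
    | h l =>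
      rintro rfl
      refine ⟨l.get, fun a => ?_⟩
      have h1 : Multiset.count a ((Finset.univ : Finset (Fin _)).val.map l.get) = l.count a := by
        rw [Fin.univ_val_map, List.ofFn_get, Multiset.coe_count]
      rw [Multiset.count_map] at h1
      simp only [eq_comm (a := a)] at h1
      exact h1.trans (Multiset.coe_count a l).symm
  obtain ⟨f, hf⟩ := key _ hcard
  refine ⟨f, fun a => ?_⟩
  rw [hf, Finsupp.count_toMultiset]
  exact Int.toNat_of_nonneg (hg.nonneg a)

/-- Take columns with the desired labels in the second cycle and sort them. The second cycle makes
every layer contain a full δ-column. -/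
theorem exists_chain (hn : minRank t ≤ n) (p : Pattern t n) {g : Lab → ℤ}
    (hg : Admissible t n L g) : ∃ C : Fin L → Column, Chain t n p C ∧
      (∀ j, period t n ≤ (C j).full) ∧ cnt t n p C = g := by
  obtain ⟨f, hf⟩ := exists_fun_card_eq hg
  have hpos : ∀ j, 0 < g (f j) := fun j => by
    rw [← hf, Nat.cast_pos, Finset.card_pos]
    exact ⟨j, by simp⟩
  have hocc : ∀ j, (f j).Occurs t n := fun j => by
    by_contra h
    exact (hpos j).ne' (hg.eq_zero _ h)
  choose col hv hfull hlab using fun j => exists_lab hn p (hocc j)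
  -- This orders by height, with a half block counting as half a row. It agrees with inclusion
  -- except for two half blocks in one row, which `clash` forces to be equal.
  let key : Fin L → ℕ := fun j => 2 * (col j).full + if (col j).half = none then 0 else 1
  let σ := Tuple.sort key
  have hσ : Monotone (key ∘ σ) := Tuple.monotone_sort key
  refine ⟨col ∘ σ, ⟨fun j => hv _, fun j k hjk => ?_, fun j k => ?_⟩, fun j => ?_, ?_⟩
  · have h := hσ hjk
    simp only [Function.comp_apply, key] at h ⊢
    set a := σ j
    set b := σ k
    rcases lt_trichotomy (col a).full (col b).full with h1 | h1 | h1
    · exact Or.inl h1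
    · right
      refine ⟨h1, ?_⟩
      by_contra hcon
      rw [not_or] at hcon
      have hb : (col b).half ≠ none := by
        intro hb
        rw [if_neg hcon.1, if_pos hb] at h
        omega
      obtain ⟨ht, ha'⟩ := half_ne_none hn (hv a) hcon.1
      obtain ⟨-, hb'⟩ := half_ne_none hn (hv b) hb
      have hab : f a = f b := by
        rw [hlab] at ha' hb'
        have ha'' := hpos a
        have hb'' := hpos b
        have := hg.clash ht
        rcases ha' with h2 | h2 <;> rcases hb' with h3 | h3 <;> rw [h2] at ha'' ⊢ <;>
          rw [h3] at hb'' ⊢ <;> omega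
      exact hcon.2 (congrArg Column.half (lab_injective hn p (hv a) (hv b)
        ((hfull a).trans (hfull b).symm) (by rw [hlab, hlab, hab])))
    · exfalso; split_ifs at h <;> omega
  -- All heights lie in one cycle, so any of them is strictly below any other plus a period.
  · left
    simp only [Function.comp_apply, Column.addDelta]
    have h1 := hfull (σ j)
    have h2 := hfull (σ k)
    have hP := period_pos hn
    have e1 := Nat.div_add_mod (col (σ j)).full (period t n)
    have e2 := Nat.div_add_mod (col (σ k)).full (period t n)
    have e3 := Nat.mod_lt (col (σ j)).full hP
    rw [h1] at e1
    rw [h2] at e2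
    omega
  · have e2 := Nat.div_add_mod (col (σ j)).full (period t n)
    rw [hfull] at e2
    simp only [Function.comp_apply]
    omega
  · funext a
    rw [← hf, cnt]
    simp only [Function.comp_apply, hlab]
    rw [Equiv.sum_comp σ fun j => if f j = a then (1 : ℤ) else 0]
    simp

end counts
end YoungSlice

/-! ### Label counts correspond to coordinate vectors -/

namespace YoungSlice
variable {n : ℕ}

theorem Coord.total_eq_sum (b : Coord n) : b.total =
    ∑ k ∈ Finset.range (n + 1), b.X k + ∑ k ∈ Finset.range (n + 1), b.Xb k := by
  rw [Coord.total, ← Fin.sum_univ_eq_sum_range, ← Fin.sum_univ_eq_sum_range]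
  simp only [Coord.X_fin, Coord.Xb_fin]

/-- For each k, x_k + x̄_k = (x_k - x̄_k)_+ + (x̄_k - x_k)_+ + 2 min(x_k, x̄_k). Moving the overlaps
one index up, the last one to 𝐮_0, preserves the total. -/
theorem sum_labMult_fork {t : AffineType} (ht : t = .B1 ∨ t = .A2odd) (l : ℕ) (b : Coord n)
    (h0 : b.Xb 0 = 0) : ∑ a ∈ labels n, labMult t l b a = b.total := by
  rw [sum_labels, b.total_eq_sum, labMult_fork_w ht]
  simp only [Finset.sum_range_succ']
  simp only [labMult_fork_u ht, labMult_fork_v ht, Nat.add_sub_cancel, Nat.add_eq_zero_iff,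
    one_ne_zero, and_false, if_false, if_true, h0]
  have h1 : ∀ k ∈ Finset.range n, k + 1 ≤ n := fun k hk => by
    have := Finset.mem_range.1 hk; omega
  -- Splitting the sum of the overlaps at either end expresses the shift of index.
  have h2 := Finset.sum_range_succ (fun k => b.overlap k) n
  rw [Finset.sum_range_succ'] at h2
  have h3 : ∑ k ∈ Finset.range n, (b.X (k + 1) + b.Xb (k + 1)) = ∑ k ∈ Finset.range n,
      (pos (b.X (k + 1) - b.Xb (k + 1)) + pos (b.Xb (k + 1) - b.X (k + 1)) +
        2 * b.overlap (k + 1)) := by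
    refine Finset.sum_congr rfl fun k _ => ?_
    simp only [pos, Coord.overlap, Nat.add_eq_zero_iff, one_ne_zero, and_false, if_false]
    omega
  rw [Finset.sum_congr rfl fun k hk => if_pos (h1 k hk),
    Finset.sum_congr rfl fun k hk => if_pos (h1 k hk)]
  simp only [Finset.sum_add_distrib, ← Finset.mul_sum] at h3 ⊢
  have h4 : b.overlap 0 = 0 := by simp [Coord.overlap]
  linarith

/-- The condition on the numbers of labels that is special to the type. -/
def Special (t : AffineType) (g : Lab → ℤ) : Prop :=
  match t with
  | .A2odd => Even (g (.u 0))
  | .C1 => Even (g .w)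
  | .D2 => g (.u 0) ≤ 1
  | _ => True

theorem sum_labMult {t : AffineType} {l : ℕ} {b : Coord n} (hb : b.Mem t l) :
    ∑ a ∈ labels n, labMult t l b a = numLayers t l := by
  rw [Coord.mem_iff] at hb
  obtain ⟨-, -, h0, hs⟩ := hb
  cases t <;> simp only [Coord.ShapeX] at hs
  case B1 => rw [sum_labMult_fork (by simp) l b h0, hs.2]; rfl
  case A2odd => rw [sum_labMult_fork (by simp) l b h0, hs.2]; rfl
  case A1 =>
    rw [sum_labels, labMult_A1]
    have := hs.2
    rw [b.total_eq_sum] at this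
    simp only [hs.1, numLayers, Finset.sum_const_zero, add_zero] at this ⊢
    exact this
  all_goals
    rw [sum_labels, labMult_line _ _ (by simp)]
    simp only [b.total_eq_sum]
    ring

theorem admissible_labMult {t : AffineType} (hn : minRank t ≤ n) {l : ℕ} {b : Coord n}
    (hb : b.Mem t l) : Admissible t n (numLayers t l) (labMult t l b) where
  nonneg := labMult_nonneg hb
  eq_zero _ := labMult_eq_zero hb
  sum_eq := sum_labMult hb
  clash ht := by
    have : 1 ≤ n := by rcases ht with rfl | rfl <;> simp only [minRank] at hn <;> omega
    simp only [labMult_fork_u ht, labMult_fork_v ht, one_ne_zero, if_false, this, if_true, pos,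
      Nat.sub_self, Coord.overlap]
    omega

theorem special_labMult {t : AffineType} {l : ℕ} {b : Coord n} (hb : b.Mem t l) :
    Special t (labMult t l b) := by
  rw [Coord.mem_iff] at hb
  obtain ⟨-, -, h0, hs⟩ := hb
  cases t <;> simp only [Coord.ShapeX] at hs <;> simp only [Special]
  case A2odd => rw [labMult_fork_u (by simp), if_pos rfl, hs.1, Int.even_iff]; omega
  case C1 => rw [labMult_line _ _ (by simp), Int.even_iff]; simp only [numLayers]; push_cast; omega
  case D2 => rw [labMult_line _ _ (by simp)]; exact hs.1

/-- Coordinates given by functions on the natural numbers. -/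
def Coord.ofFun (n : ℕ) (f g : ℕ → ℤ) : Coord n := ⟨fun i => f i, fun i => g i⟩

theorem Coord.X_ofFun (f g : ℕ → ℤ)
    (k : ℕ) : (Coord.ofFun n f g).X k = if k ≤ n then f k else 0 := by
  simp only [Coord.X, Coord.ofFun, Nat.lt_succ_iff, dite_eq_ite]

theorem Coord.Xb_ofFun (f g : ℕ → ℤ) (k : ℕ) :
    (Coord.ofFun n f g).Xb k = if k ≤ n then g k else 0 := by
  simp only [Coord.Xb, Coord.ofFun, Nat.lt_succ_iff, dite_eq_ite]

theorem Coord.total_ofFun (f g : ℕ → ℤ) : (Coord.ofFun n f g).total =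
    ∑ k ∈ Finset.range (n + 1), f k + ∑ k ∈ Finset.range (n + 1), g k := by
  rw [Coord.total, ← Fin.sum_univ_eq_sum_range, ← Fin.sum_univ_eq_sum_range]
  rfl

/-- One of the two positive parts at k vanishes, so min(𝐮_k, 𝐯_k) is the overlap of index k - 1.
This recovers the overlaps, and then the coordinates. -/
theorem exists_labMult_eq_fork {t : AffineType} (ht : t = .B1 ∨ t = .A2odd) (hn : minRank t ≤ n)
    {l : ℕ} {g : Lab → ℤ} (hg : Admissible t n (numLayers t l) g) (hs : Special t g) :
    ∃ b : Coord n, b.Mem t l ∧ labMult t l b = g := by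
  have hn3 : 3 ≤ n := by rcases ht with rfl | rfl <;> exact hn
  -- The overlap of index k that the coordinates are going to have; the remainder of 𝐮_0 modulo 2
  -- becomes x_0.
  let o : ℕ → ℤ := fun k => if k = 0 then 0 else if k = n then g (.u 0) / 2
    else min (g (.u (k + 1))) (g (.v (k + 1)))
  let b : Coord n := Coord.ofFun n
    (fun k => if k = 0 then g (.u 0) % 2 else g (.u k) - o (k - 1) + o k)
    (fun k => if k = 0 then 0 else g (.v k) - o (k - 1) + o k)
  have hX : ∀ k, b.X k = _ := fun k => Coord.X_ofFun _ _ k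
  have hXb : ∀ k, b.Xb k = _ := fun k => Coord.Xb_ofFun _ _ k
  have hpos := hg.nonneg
  have ho : ∀ k, k ≤ n → 0 ≤ o k := by
    intro k hk
    have h1 := hpos (.u 0)
    have h2 := hpos (.u (k + 1))
    have h3 := hpos (.v (k + 1))
    simp only [o]
    split_ifs <;> omega
  -- For k = 1 this is where `clash` enters: there is no overlap of index 0.
  have hmin : ∀ k, 0 < k → k ≤ n → min (g (.u k)) (g (.v k)) = o (k - 1) := by
    intro k hk hkn
    rcases Nat.lt_or_ge 1 k with h1 | h1
    · simp only [o]
      rw [if_neg (by omega), if_neg (by omega), Nat.sub_add_cancel hk]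
    · obtain rfl : k = 1 := by omega
      have := hg.clash ht
      have h2 := hpos (.u 1)
      have h3 := hpos (.v 1)
      simp only [o, Nat.sub_self, if_true]
      omega
  have hov : ∀ k, k ≤ n → b.overlap k = o k := by
    intro k hk
    unfold Coord.overlap
    split_ifs with h
    · simp [o, h]
    · have := hmin k (by omega) hk
      rw [hX, hXb, if_pos hk, if_pos hk, if_neg h, if_neg h]
      omega
  have hlab : labMult t l b = g := by
    have hocc : ∀ a : Lab, ¬ a.Occurs t n → g a = 0 := hg.eq_zero
    funext a
    cases a with
    | w =>
      rw [labMult_fork_w ht, hocc]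
      rcases ht with rfl | rfl <;> simp [Lab.Occurs]
    | u k =>
      rw [labMult_fork_u ht]
      split_ifs with h h'
      · rw [hov n le_rfl, hX, if_pos (Nat.zero_le _), if_pos rfl, h]
        simp only [o]
        rw [if_neg (by omega), if_pos trivial]
        omega
      · rw [hov _ (by omega), hX, hXb, if_pos h', if_pos h', if_neg h, if_neg h, pos]
        have := hmin k (by omega) h'
        omega
      · rw [hocc]
        rcases ht with rfl | rfl <;> simpa [Lab.Occurs] using h'
    | v k =>
      rw [labMult_fork_v ht]
      split_ifs with h h'
      · rw [hocc]
        rcases ht with rfl | rfl <;> simp [Lab.Occurs, h]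
      · rw [hov _ (by omega), hX, hXb, if_pos h', if_pos h', if_neg h, if_neg h, pos]
        have := hmin k (by omega) h'
        omega
      · rw [hocc]
        rcases ht with rfl | rfl <;> simp only [Lab.Occurs] <;> omega
  have h0 : b.Xb 0 = 0 := by simp [hXb]
  have htot : b.total = l := by
    rw [← sum_labMult_fork ht l b h0, hlab, hg.sum_eq]
    rcases ht with rfl | rfl <;> rfl
  refine ⟨b, Coord.mem_iff.2 ⟨fun k => ?_, fun k => ?_, h0, ?_⟩, hlab⟩
  · rw [hX]
    split_ifs with h1 h2
    · omega
    · have := hmin k (by omega) h1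
      have := ho k h1
      omega
    · rfl
  · rw [hXb]
    split_ifs with h1 h2
    · rfl
    · have := hmin k (by omega) h1
      have := ho k h1
      omega
    · rfl
  · have hX0 : b.X 0 = g (.u 0) % 2 := by simp [hX]
    rcases ht with rfl | rfl
    · exact ⟨by omega, htot⟩
    · exact ⟨by rw [hX0]; exact Int.even_iff.1 hs, htot⟩

theorem exists_labMult_eq {t : AffineType} (hn : minRank t ≤ n)
    {l : ℕ} {g : Lab → ℤ} (hg : Admissible t n (numLayers t l) g) (hs : Special t g) :
    ∃ b : Coord n, b.Mem t l ∧ labMult t l b = g := by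
  by_cases ht : t = .B1 ∨ t = .A2odd
  · exact exists_labMult_eq_fork ht hn hg hs
  have hocc := hg.eq_zero
  have hpos := hg.nonneg
  have hsum := hg.sum_eq
  rw [sum_labels] at hsum
  refine ⟨Coord.ofFun n (fun k => g (.u k)) (fun k => g (.v k)), Coord.mem_iff.2 ⟨fun k => ?_,
    fun k => ?_, ?_, ?_⟩, ?_⟩
  · rw [Coord.X_ofFun]; split_ifs; exacts [hpos _, le_rfl]
  · rw [Coord.Xb_ofFun]; split_ifs; exacts [hpos _, le_rfl]
  · rw [Coord.Xb_ofFun, if_pos (Nat.zero_le _), hocc]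
    cases t <;> simp [Lab.Occurs] at ht ⊢
  · cases t <;> simp only [not_true, not_false_iff, or_true, true_or, or_self, reduceCtorEq] at ht
      <;> simp only [Coord.ShapeX, Coord.Xb_ofFun, Coord.X_ofFun, Coord.total_ofFun,
        Nat.zero_le, if_true, numLayers, Special] at hsum hs ⊢
    case A1 =>
      have hv : ∀ k, g (.v k) = 0 := fun k => hocc _ (by simp [Lab.Occurs])
      refine ⟨fun k => by rw [hv, ite_self], ?_⟩
      rw [hocc .w (by simp [Lab.Occurs])] at hsum
      omega
    case C1 =>
      have := hpos .w
      rw [Int.even_iff] at hs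
      push_cast at hsum
      exact ⟨hocc _ (by simp [Lab.Occurs]), by omega, by omega⟩
    case A2even =>
      have := hpos .w
      exact ⟨hocc _ (by simp [Lab.Occurs]), by omega⟩
    case D2 =>
      have := hpos .w
      exact ⟨hs, by omega⟩
  · funext a
    cases t <;> simp only [not_true, not_false_iff, or_true, true_or, or_self, reduceCtorEq] at ht
    case A1 =>
      rw [labMult_A1]
      cases a with
      | u k =>
        simp only [Coord.X_ofFun]
        split_ifs with h
        · rfl
        · rw [hocc]; simpa [Lab.Occurs] using h
      | v k => rw [hocc]; simp [Lab.Occurs]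
      | w => rw [hocc]; simp [Lab.Occurs]
    all_goals
      rw [labMult_line _ _ (by simp)]
      cases a with
      | u k =>
        simp only [Coord.X_ofFun]
        split_ifs with h
        · rfl
        · rw [hocc]; simp only [Lab.Occurs]; omega
      | v k =>
        simp only [Coord.Xb_ofFun]
        split_ifs with h
        · rfl
        · rw [hocc]; simp only [Lab.Occurs]; omega
      | w => simp only [Coord.total_ofFun]; omega

theorem labMult_injective {t : AffineType} {l : ℕ} {b b' : Coord n} (hb : b.Mem t l)
    (hb' : b'.Mem t l) (h : labMult t l b = labMult t l b') : b = b' := by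
  rw [Coord.mem_iff] at hb hb'
  obtain ⟨h1, h2, h3, h4⟩ := hb
  obtain ⟨h1', h2', h3', h4'⟩ := hb'
  by_cases ht : t = .B1 ∨ t = .A2odd
  · have hx : 0 ≤ b.X 0 ∧ b.X 0 ≤ 1 ∧ 0 ≤ b'.X 0 ∧ b'.X 0 ≤ 1 := by
      refine ⟨h1 0, ?_, h1' 0, ?_⟩ <;> rcases ht with rfl | rfl <;>
        simp only [Coord.ShapeX] at h4 h4' <;> omega
    have hu := fun k => congrFun h (.u k)
    have hv := fun k => congrFun h (.v k)
    simp only [labMult_fork_u ht, labMult_fork_v ht] at hu hv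
    -- The overlaps below n are minima of equal counts; the last one follows from the number of 𝐮_0
    -- because x_0 is 0 or 1.
    have hov : ∀ k, k ≤ n → b.overlap k = b'.overlap k := by
      intro k hk
      rcases Nat.lt_or_ge k n with hkn | hkn
      · have hu' := hu (k + 1)
        have hv' := hv (k + 1)
        simp only [Nat.add_eq_zero_iff, one_ne_zero, and_false, if_false,
          Nat.add_sub_cancel, pos, Nat.succ_le_of_lt hkn, if_true] at hu' hv'
        omega
      · obtain rfl : k = n := le_antisymm hk hkn
        have := hu 0
        simp only [if_true] at this
        omega
    have h0 : b.X 0 = b'.X 0 := by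
      have := hu 0
      simp only [if_true] at this
      omega
    have key : ∀ k, k ≤ n → b.X k = b'.X k ∧ b.Xb k = b'.Xb k := by
      intro k hk
      by_cases hk0 : k = 0
      · subst hk0; exact ⟨h0, by rw [h3, h3']⟩
      · have hu' := hu k
        have hv' := hv k
        have ho1 := hov k hk
        have ho2 := hov (k - 1) (by omega)
        simp only [hk0, hk, if_false, if_true, ho2, pos] at hu' hv'
        simp only [Coord.overlap, hk0, if_false] at ho1
        omega
    exact Coord.ext_of_XXb (fun k hk => (key k hk).1) fun k hk => (key k hk).2
  · cases t <;> simp only [not_true, not_false_iff, or_true, true_or, or_self, reduceCtorEq] at ht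
    case A1 =>
      rw [labMult_A1, labMult_A1] at h
      exact Coord.ext_of_XXb (fun k _ => congrFun h (.u k)) fun k _ => by rw [h4.1, h4'.1]
    all_goals
      rw [labMult_line _ _ (by simp), labMult_line _ _ (by simp)] at h
      exact Coord.ext_of_XXb (fun k _ => congrFun h (.u k)) fun k _ => congrFun h (.v k)

end YoungSlice

/-! ### Tops, the special condition, and pasting -/

namespace YoungSlice
variable {n : ℕ}

/-- The label of an elementary slice. -/
def Elementary.toLab : Elementary n → Lab
  | .u i => .u i
  | .v i => .v i
  | .w => .w

theorem isTop_half {t : AffineType} (ht : t = .B1 ∨ t = .A2odd) (hn : minRank t ≤ n)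
    (p : Pattern t n) (a : Elementary n) {r : ℕ} {s : Bool}
    (hv : Column.Valid t n p ⟨r, some s⟩) :
    a.isTop t n p ⟨r, some s⟩ = true ↔ Column.lab t n p ⟨r, some s⟩ = a.toLab := by
  rcases ht with rfl | rfl <;>
  · change Bool at p
    have hr := half_mod hv
    rcases a with ⟨i, hi⟩ | ⟨i, hi⟩ | _ <;>
      simp only [Elementary.isTop, Elementary.toLab, Column.topWhole, Column.topPair,
        Column.topHalf, Column.lab, row, forkRow, hr, if_true, Option.isNone_some,
        Bool.false_and] <;>
      cases p <;> cases s <;> simp [Row.sideColor] <;> grind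

set_option maxHeartbeats 1000000 in
theorem isTop_fork {t : AffineType} (ht : t = .B1 ∨ t = .A2odd) (hn : minRank t ≤ n)
    (p : Pattern t n) (a : Elementary n) (r : ℕ) :
    a.isTop t n p ⟨r + 1, none⟩ = true ↔ Column.lab t n p ⟨r + 1, none⟩ = a.toLab := by
  have hP := period_pos hn
  have h1 := succ_mod_cases hP r
  have h2 := Nat.mod_lt r hP
  rcases ht with rfl | rfl <;>
  · change Bool at p
    simp only [minRank, period] at hn hP h1 h2
    rcases a with ⟨i, hi⟩ | ⟨i, hi⟩ | _ <;>
      simp only [Elementary.isTop, Elementary.toLab, Column.topWhole, Column.topPair,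
        Column.topHalf, Column.lab, row, forkRow, Option.isNone_none, Nat.add_sub_cancel,
        Bool.true_and, Nat.succ_pos, decide_true, supporting, covering, period] <;>
      split_ifs <;> (try simp only [Row.isWhole, Row.isPair, Bool.and_eq_true, beq_iff_eq,
        decide_eq_true_eq]) <;> grind

set_option maxHeartbeats 1000000 in
theorem isTop_line {t : AffineType} (ht : ¬ (t = .B1 ∨ t = .A2odd)) (hn : minRank t ≤ n)
    (p : Pattern t n) (a : Elementary n) (r : ℕ) :
    a.isTop t n p ⟨r + 1, none⟩ = true ↔ Column.lab t n p ⟨r + 1, none⟩ = a.toLab := by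
  have hP := period_pos hn
  have h1 := succ_mod_cases hP r
  have h2 := Nat.mod_lt r hP
  cases t <;> simp only [not_true, not_false_iff, or_true, true_or, or_self, reduceCtorEq] at ht
  case A1 =>
    rcases a with ⟨i, hi⟩ | ⟨i, hi⟩ | _ <;>
      simp only [Elementary.isTop, Elementary.toLab, Column.topWhole, Column.lab, row,
        Option.isNone_none, Nat.add_sub_cancel, Bool.true_and, Nat.succ_pos, decide_true,
        supporting, Row.isWhole, Bool.and_true, beq_iff_eq, Lab.u.injEq, reduceCtorEq,
        Bool.false_eq_true]
    rw [show Fin.val (n := n + 1) p + (r + 1) + n = Fin.val (n := n + 1) p + r + (n + 1) by ring,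
      Nat.add_mod_right]
  all_goals
    simp only [minRank, period] at hn hP h1 h2
    rcases a with ⟨i, hi⟩ | ⟨i, hi⟩ | _ <;>
      simp only [Elementary.isTop, Elementary.toLab, Column.topWhole, Column.lab, row,
        Option.isNone_none, Nat.add_sub_cancel, Row.isWhole,
        Bool.true_and, Nat.succ_pos, decide_true, supporting, covering, period] <;>
      (try split_ifs) <;> simp only [Bool.and_eq_true, beq_iff_eq, false_iff,
        decide_eq_true_eq] <;> grind

theorem isTop_zero {t : AffineType} (p : Pattern t n) (a : Elementary n) :
    a.isTop t n p ⟨0, none⟩ = false := by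
  cases t <;> rcases a with ⟨i, hi⟩ | ⟨i, hi⟩ | _ <;>
    simp [Elementary.isTop, Column.topWhole, Column.topPair, Column.topHalf]

/-- The empty column is exceptional: its label is the one its height has modulo the period, although
it has no top block. -/
theorem isTop_iff {t : AffineType} (hn : minRank t ≤ n) (p : Pattern t n) (a : Elementary n)
    {c : Column} (hv : c.Valid t n p) : a.isTop t n p c = true ↔
      c.lab t n p = a.toLab ∧ ¬ (c.full = 0 ∧ c.half = none) := by
  obtain ⟨r, half⟩ := c
  rcases half with _ | s
  · rcases r with _ | r
    · simp [isTop_zero]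
    · by_cases ht : t = .B1 ∨ t = .A2odd
      · rw [isTop_fork ht hn]; simp
      · rw [isTop_line ht hn]; simp
  · rw [isTop_half (half_ne_none hn hv (by simp)).1 hn p a hv]; simp

/-- The n-blocks come in pairs of adjacent rows n - 1 and n of each cycle, so their number is odd
exactly between the two. -/
theorem count_fork_parity (hn : 3 ≤ n) (z : Bool) (r : ℕ) :
    (∑ k ∈ Finset.range r, (row .A2odd n z k).count n) % 2 =
      if r % (2 * n - 1) = n then 1 else 0 := by
  induction r with
  | zero => simp [show 0 ≠ n by omega]
  | succ r ih =>
    have h1 := succ_mod_cases (show 0 < 2 * n - 1 by omega) r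
    have h2 := Nat.mod_lt r (show 0 < 2 * n - 1 by omega)
    have h3 : (row .A2odd n z r).count n =
        if r % (2 * n - 1) + 1 = n ∨ r % (2 * n - 1) = n then 1 else 0 := by
      simp only [row, forkRow]
      split_ifs <;> simp only [Row.count] <;> grind
    rw [Finset.sum_range_succ, Nat.add_mod, ih, h3]
    grind

theorem count_A2odd (hn : 3 ≤ n) (z : Bool) {c : Column} (hv : c.Valid .A2odd n z) :
    c.count .A2odd n z n % 2 = if c.lab .A2odd n z = .u 0 then 1 else 0 := by
  obtain ⟨r, half⟩ := c
  have h2 := Nat.mod_lt r (show 0 < 2 * n - 1 by omega)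
  rcases half with _ | s
  · simp only [Column.count, add_zero, count_fork_parity hn, Column.lab]
    grind
  · have hr := half_mod hv
    have h1 : (row .A2odd n z r).sideColor s ≠ some n := by
      simp only [row, forkRow, hr, if_true]
      cases z <;> cases s <;> simp [Row.sideColor] <;> omega
    simp only [Column.count, h1, if_false, add_zero, count_fork_parity hn, Column.lab, hr]
    grind

/-- Each cycle begins with two 0-blocks, so the number is odd exactly when the top is the first of
them. -/
theorem count_C1 (hn : 2 ≤ n) (z : Unit) {c : Column} (hv : c.Valid .C1 n z) :
    c.count .C1 n z 0 % 2 = if c.lab .C1 n z = .w then 1 else 0 := by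
  obtain ⟨r, half⟩ := c
  simp only [Column.Valid, row, Row.isPair, Bool.false_eq_true, or_false] at hv
  subst hv
  have key : (∑ k ∈ Finset.range r, (row .C1 n z k).count 0) % 2 =
      if r % (2 * n + 1) = 1 then 1 else 0 := by
    induction r with
    | zero => simp
    | succ r ih =>
      have h1 := succ_mod_cases (show 0 < 2 * n + 1 by omega) r
      have h2 := Nat.mod_lt r (show 0 < 2 * n + 1 by omega)
      rw [Finset.sum_range_succ, Nat.add_mod, ih]
      simp only [row, Row.count]
      grind
  have h2 := Nat.mod_lt r (show 0 < 2 * n + 1 by omega)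
  simp only [Column.count, add_zero, key, Column.lab]
  grind

theorem extraCondition_iff {t : AffineType} (hn : minRank t ≤ n) {p : Pattern t n} {L : ℕ}
    {C : Fin L → Column} (hv : ∀ j, (C j).Valid t n p) :
    ExtraCondition t n p C ↔ Special t (cnt t n p C) := by
  have key : ∀ (a : Lab) (f : Column → ℕ),
      (∀ j, f (C j) % 2 = if (C j).lab t n p = a then 1 else 0) →
      (Even (∑ j, f (C j)) ↔ Even (cnt t n p C a)) := by
    intro a f hf
    rw [cnt_eq_card, Int.even_coe_nat, Finset.card_filter, Nat.even_iff, Nat.even_iff,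
      Finset.sum_nat_mod]
    simp only [hf]
  cases t <;> simp only [ExtraCondition, Special]
  case A2odd => exact key _ _ fun j => count_A2odd hn p (hv j)
  case C1 => exact key _ _ fun j => count_C1 hn p (hv j)
  case D2 =>
    rw [cnt_eq_card]
    have h : ∀ j, (C j).topWhole .D2 n p n (supporting .D2 n) = true ↔
        (C j).lab .D2 n p = .u 0 := by
      intro j
      have h := isTop_iff hn p (.u 0) (hv j)
      simp only [Elementary.isTop, Fin.val_zero, if_true, Elementary.toLab] at h
      rw [h, and_iff_left_iff_imp]
      -- The empty column has label 𝐯_1, so it is no exception for 𝐮_0.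
      rintro h1 ⟨h2, h3⟩
      rcases hC : C j with ⟨x, y⟩
      simp only [hC] at h2 h3
      subst h2 h3
      simp [hC, Column.lab] at h1
    simp only [h]
    exact_mod_cast Iff.rfl

theorem multiplicity_eq {t : AffineType} {l : ℕ} {b : Coord n} (hb : b.Mem t l)
    (a : Elementary n) : multiplicity t l b a = labMult t l b a.toLab := by
  rcases a with ⟨i, hi⟩ | ⟨i, hi⟩ | _
  case w => cases t <;> rfl
  all_goals
    have hi' : i ≤ n := by omega
    cases t <;> simp only [multiplicity, Elementary.toLab, labMult, hi', if_true]

section pastes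
variable {t : AffineType} (hn : minRank t ≤ n) {p : Pattern t n} {l : ℕ} {b : Perfect t n l}
  {C : Slice t n p l}
include hn

/-- The slice need not be away from the ground, so tops give only a lower bound for the labels;
since both families of numbers sum to L, equality follows. -/
theorem cnt_of_pastes (h : Pastes b C) : cnt t n p C.1 = labMult t l b.1 := by
  have hC := (isSlice_iff.1 C.2).1
  have hadm := hC.admissible hn
  have hadm' := admissible_labMult hn b.2
  have hle : ∀ a : Elementary n, labMult t l b.1 a.toLab ≤ cnt t n p C.1 a.toLab := by
    intro a
    rw [← multiplicity_eq b.2, ← h a, cnt_eq_card, Nat.cast_le]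
    refine Finset.card_le_card fun j hj => ?_
    rw [Finset.mem_filter] at hj ⊢
    exact ⟨hj.1, ((isTop_iff hn p a (hC.valid j)).1 hj.2).1⟩
  have hle' : ∀ a ∈ labels n, labMult t l b.1 a ≤ cnt t n p C.1 a := by
    intro a ha
    simp only [labels, Finset.mem_union, Finset.mem_image, Finset.mem_range,
      Finset.mem_singleton] at ha
    rcases ha with (⟨i, hi, rfl⟩ | ⟨i, hi, rfl⟩) | rfl
    · exact hle (.u ⟨i, hi⟩)
    · exact hle (.v ⟨i, hi⟩)
    · exact hle .w
  funext a
  by_cases ha : a.Occurs t n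
  · exact ((Finset.sum_eq_sum_iff_of_le hle').1 (hadm'.sum_eq.trans hadm.sum_eq.symm) a
      (mem_labels ha)).symm
  · rw [hadm.eq_zero a ha, hadm'.eq_zero a ha]

theorem pastes_of_cnt (hC : C.Tall) (h : cnt t n p C.1 = labMult t l b.1) : Pastes b C := by
  intro a
  rw [multiplicity_eq b.2, ← h, cnt_eq_card]
  congr 2
  ext j
  have h1 := hC j
  have hP := period_pos hn
  simp only [Finset.mem_filter, Finset.mem_univ, true_and]
  rw [isTop_iff hn p a ((isSlice_iff.1 C.2).1.valid j), and_iff_left]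
  rintro ⟨h2, -⟩
  omega

theorem exists_slice {g : Lab → ℤ} (hg : Admissible t n (numLayers t l) g) (hs : Special t g) :
    ∃ C : Slice t n p l, C.Tall ∧ cnt t n p C.1 = g := by
  obtain ⟨C, hC, htall, hcnt⟩ := exists_chain hn p hg
  exact ⟨⟨C, isSlice_iff.2 ⟨hC, (extraCondition_iff hn hC.valid).2 (hcnt ▸ hs)⟩⟩, htall, hcnt⟩

end pastes

end YoungSlice

/-! ### String lengths, transport of structure, and the canonical map -/

namespace YoungSlice

/-- A function that is 0 where the operator is 0 and drops by one along it must be the string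
length; in particular strings are finite. -/
theorem maxIterate_eq {B : Type} {op : B → Option B} {N : B → ℕ}
    (h0 : ∀ X, op X = none → N X = 0) (h1 : ∀ X Y, op X = some Y → N X = N Y + 1) (X : B) :
    maxIterate op X = N X := by
  have hnone : ∀ k, (fun Y : Option B => Y.bind op)^[k] none = none := fun k =>
    Function.iterate_fixed rfl k
  have key : ∀ k X, ((fun Y : Option B => Y.bind op)^[k] (some X)).isSome = true ↔ k ≤ N X := by
    intro k
    induction k with
    | zero => simp
    | succ k ih =>
      intro X
      rw [Function.iterate_succ_apply, Option.bind_some]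
      rcases hX : op X with _ | Y
      · rw [hnone, h0 X hX]; simp
      · rw [ih, h1 X Y hX]; omega
  have hset : {k : ℕ | ((fun Y : Option B => Y.bind op)^[k] (some X)).isSome = true} =
      Set.Iic (N X) := Set.ext fun k => key k X
  rw [maxIterate, hset, csSup_Iic]

theorem maxIterate_map {B B' : Type} {op : B → Option B} {op' : B' → Option B'} {ψ : B → B'}
    (h : ∀ X, op' (ψ X) = (op X).map ψ) (X : B) : maxIterate op' (ψ X) = maxIterate op X := by
  have key : ∀ k (Y : Option B), (fun Y : Option B' => Y.bind op')^[k] (Y.map ψ) =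
      ((fun Y : Option B => Y.bind op)^[k] Y).map ψ := by
    intro k
    induction k with
    | zero => exact fun _ => rfl
    | succ k ih =>
      intro Y
      rw [Function.iterate_succ_apply, Function.iterate_succ_apply, ← ih]
      congr 1
      cases Y with
      | none => rfl
      | some Y => simp [h]
  have key' := fun k => key k (some X)
  simp only [Option.map_some] at key'
  simp only [maxIterate, key', Option.isSome_map]

theorem IsCrystal.of_iso {n : ℕ} {B₁ B₂ : Type} {A : Matrix (Fin (n + 1)) (Fin (n + 1)) ℤ}
    {K₁ : CrystalData n B₁} {K₂ : CrystalData n B₂} {ψ : B₁ → B₂} (h : IsCrystal A K₁)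
    (hψ : IsCrystalIso K₁ K₂ ψ) : IsCrystal A K₂ := by
  have he : ∀ i b b', K₂.e i (ψ b) = some (ψ b') ↔ K₁.e i b = some b' := by
    intro i b b'
    rw [hψ.e, Option.map_eq_some_iff]
    exact ⟨fun ⟨c, hc, hcb⟩ => hψ.bijective.1 hcb ▸ hc, fun hb => ⟨b', hb, rfl⟩⟩
  have hf : ∀ i b b', K₂.f i (ψ b) = some (ψ b') ↔ K₁.f i b = some b' := by
    intro i b b'
    rw [hψ.f, Option.map_eq_some_iff]
    exact ⟨fun ⟨c, hc, hcb⟩ => hψ.bijective.1 hcb ▸ hc, fun hb => ⟨b', hb, rfl⟩⟩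
  have hsurj := hψ.bijective.2
  constructor
  · refine fun i => hsurj.forall.2 fun b => ?_
    rw [hψ.wt, hψ.eps, hψ.phi, h.phi_eq]
  · refine fun i => hsurj.forall₂.2 fun b b' hb j => ?_
    rw [hψ.wt, hψ.wt, h.wt_e i b b' ((he i b b').1 hb)]
  · refine fun i => hsurj.forall₂.2 fun b b' hb j => ?_
    rw [hψ.wt, hψ.wt, h.wt_f i b b' ((hf i b b').1 hb)]
  · refine fun i => hsurj.forall₂.2 fun b b' hb => ?_
    rw [hψ.eps, hψ.eps, h.eps_e i b b' ((he i b b').1 hb)]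
  · refine fun i => hsurj.forall₂.2 fun b b' hb => ?_
    rw [hψ.phi, hψ.phi, h.phi_e i b b' ((he i b b').1 hb)]
  · refine fun i => hsurj.forall₂.2 fun b b' hb => ?_
    rw [hψ.eps, hψ.eps, h.eps_f i b b' ((hf i b b').1 hb)]
  · refine fun i => hsurj.forall₂.2 fun b b' hb => ?_
    rw [hψ.phi, hψ.phi, h.phi_f i b b' ((hf i b b').1 hb)]
  · refine fun i => hsurj.forall₂.2 fun b b' => ?_
    rw [he, hf, h.e_f]
  · refine fun i => hsurj.forall.2 fun b hb => ?_
    rw [hψ.eps] at hb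
    rw [hψ.e, hψ.f, (h.bot i b hb).1, (h.bot i b hb).2]
    exact ⟨rfl, rfl⟩

section canonical
variable {t : AffineType} {n : ℕ} (hn : minRank t ≤ n) {p : Pattern t n} {l : ℕ}
include hn

theorem mk_eq_mk_iff {C D : Slice t n p l} : (Quotient.mk _ C : SliceClass t n p l) =
    Quotient.mk _ D ↔ cnt t n p C.1 = cnt t n p D.1 :=
  (Quotient.eq (r := sliceSetoid t n p l)).trans (related_iff hn)

theorem exists_perfect (C : Slice t n p l) :
    ∃ b : Perfect t n l, cnt t n p C.1 = labMult t l b.1 := by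
  obtain ⟨hC, hE⟩ := isSlice_iff.1 C.2
  obtain ⟨b, hb, hbC⟩ := exists_labMult_eq hn (hC.admissible hn)
    ((extraCondition_iff hn hC.valid).1 hE)
  exact ⟨⟨b, hb⟩, hbC.symm⟩

variable (p l) in
theorem exists_canonicalMap : ∃ ψ : Perfect t n l → SliceClass t n p l,
    ∀ b, ∃ C : Slice t n p l, C.Tall ∧ cnt t n p C.1 = labMult t l b.1 ∧
      ψ b = Quotient.mk _ C := by
  choose C hC using fun b : Perfect t n l => exists_slice (p := p) hn
    (admissible_labMult hn b.2) (special_labMult b.2)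
  exact ⟨fun b => Quotient.mk _ (C b), fun b => ⟨C b, (hC b).1, (hC b).2, rfl⟩⟩

variable {ψ : Perfect t n l → SliceClass t n p l}
  (hψ : ∀ b, ∃ C : Slice t n p l, C.Tall ∧ cnt t n p C.1 = labMult t l b.1 ∧
    ψ b = Quotient.mk _ C)
include hψ

/-- Since classes are determined by counts, the value at b is independent of the slice chosen for b.
-/
theorem canonicalMap_eq_iff {b : Perfect t n l} {C : Slice t n p l} :
    ψ b = Quotient.mk _ C ↔ cnt t n p C.1 = labMult t l b.1 := by
  obtain ⟨D, -, hD, hb⟩ := hψ b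
  rw [hb]
  exact (mk_eq_mk_iff hn).trans (by rw [hD, eq_comm])

theorem canonicalMap_bijective : Function.Bijective ψ := by
  constructor
  · intro b b' h
    obtain ⟨D, -, hD, hb⟩ := hψ b'
    rw [hb, canonicalMap_eq_iff hn hψ, hD] at h
    exact (Subtype.ext (labMult_injective b'.2 b.2 h)).symm
  · intro X
    induction X using Quotient.inductionOn with
    | h C =>
      obtain ⟨b, hb⟩ := exists_perfect hn C
      exact ⟨b, (canonicalMap_eq_iff hn hψ).2 hb⟩

/-- An operator on slices which corresponds to an operator on the perfect crystal induces the
corresponding operator on classes. -/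
theorem classOp_canonicalMap {R : Perfect t n l → Option (Perfect t n l)}
    {op : (Fin (numLayers t l) → Column) → Option (Fin (numLayers t l) → Column)}
    (h : ∀ (C : Slice t n p l) b, C.Tall → cnt t n p C.1 = labMult t l b.1 →
      (op C.1 = none ∧ R b = none) ∨
      ∃ (D : Slice t n p l) (b' : Perfect t n l), op C.1 = some D.1 ∧ R b = some b' ∧
        cnt t n p D.1 = labMult t l b'.1) :
    (∀ b, classOp (p := p) op (ψ b) = (R b).map ψ) ∧
      InducedBy (p := p) op (classOp op) := by
  have key : ∀ b, classOp (p := p) op (ψ b) = (R b).map ψ := by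
    intro b
    unfold classOp
    split_ifs with hex
    -- Whichever representative the choice refers to, its counts are those of b, so the result has
    -- the counts prescribed by `R b`.
    · obtain ⟨C, hC, hCb, hop⟩ := hex.choose_spec
      have hcnt := (canonicalMap_eq_iff hn hψ).1 hCb.symm
      rcases h C b hC hcnt with ⟨h1, -⟩ | ⟨D, b', h1, h2, h3⟩
      · rw [h1] at hop; cases hop
      · rw [h1, Option.some.injEq] at hop
        rw [h2, Option.map_some, (canonicalMap_eq_iff hn hψ).2 h3, Subtype.ext hop]
    · obtain ⟨C, hC, hCb, hb⟩ := hψ b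
      rcases h C b hC hCb with ⟨-, h1⟩ | ⟨D, b', h1, h2, h3⟩
      · rw [h1, Option.map_none]
      · exact absurd ⟨D, C, hC, hb.symm, h1⟩ hex
  refine ⟨key, fun C hC => ?_⟩
  obtain ⟨b, hb⟩ := exists_perfect hn C
  have hbC := (canonicalMap_eq_iff hn hψ).2 hb
  rw [← hbC, key]
  rcases h C b hC hb with ⟨h1, h2⟩ | ⟨D, b', h1, h2, h3⟩
  · exact Or.inl ⟨h1, by rw [h2]; rfl⟩
  · exact Or.inr ⟨D, h1, by
      rw [h2]; exact congrArg some ((canonicalMap_eq_iff hn hψ).2 h3)⟩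

end canonical

theorem two_le_period {t : AffineType} {n : ℕ} (hn : minRank t ≤ n) : 2 ≤ period t n := by
  cases t <;> simp only [minRank, period] at * <;> omega

section operators
variable {t : AffineType} {n : ℕ} (hn : minRank t ≤ n) {p : Pattern t n} {l : ℕ} {i : ℕ}
  (hi : i ≤ n)
include hn

/-- The parity condition in the definition of slices is exactly what lets the two-block rule find
its second block. -/
theorem even_of_isDouble (hd : isDouble t n i = true) {g : Lab → ℤ} (hs : Special t g) :
    Even (g (labMoves t n i).s) := by
  cases t <;> simp only [isDouble, Bool.false_eq_true, decide_eq_true_eq] at hd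
  · subst hd; exact hs
  · subst hd
    simp only [minRank] at hn
    rw [labMoves_fork _ (by simp), if_neg (by omega), if_neg (by omega), if_pos rfl]
    exact hs

theorem slice_of_chain {b : Coord n} (hb : b.Mem t l) {D : Fin (numLayers t l) → Column}
    (hD : Chain t n p D) (h : cnt t n p D = labMult t l b) : IsSlice t n p D :=
  isSlice_iff.2 ⟨hD, (extraCondition_iff hn hD.valid).2 (h ▸ special_labMult hb)⟩

include hi

/-- The meeting point of the two sides: both operators act on the common count by the same moves.
That the result satisfies the special condition comes for free, because its counts belong to an
element of B^l. -/
theorem sliceE_toPerfect (C : Slice t n p l) (b : Perfect t n l) (hC : C.Tall)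
    (h : cnt t n p C.1 = labMult t l b.1) :
    (sliceE t n p i C.1 = none ∧ toPerfect t l (rawE t i b.1) = none) ∨
    ∃ (D : Slice t n p l) (b' : Perfect t n l), sliceE t n p i C.1 = some D.1 ∧
      toPerfect t l (rawE t i b.1) = some b' ∧ cnt t n p D.1 = labMult t l b'.1 := by
  have hP := two_le_period hn
  have hspec := sliceE_spec hn hi (isSlice_iff.1 C.2).1 (fun j => hP.trans (hC j))
    (fun hd => h ▸ even_of_isDouble hn hd (special_labMult b.2))
  rw [h, ← canE_labMult hn hi b.2] at hspec
  rcases hspec with ⟨h1, h2⟩ | ⟨h1, D, h2, h3, h4⟩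
  · exact Or.inl ⟨h2, dif_neg h1⟩
  · rw [← labMult_rawE hn hi b.2 h1] at h4
    exact Or.inr ⟨⟨D, slice_of_chain hn h1 h3 h4⟩, ⟨_, h1⟩, h2, dif_pos h1, h4⟩

theorem sliceF_toPerfect (C : Slice t n p l) (b : Perfect t n l) (hC : C.Tall)
    (h : cnt t n p C.1 = labMult t l b.1) :
    (sliceF t n p i C.1 = none ∧ toPerfect t l (rawF t i b.1) = none) ∨
    ∃ (D : Slice t n p l) (b' : Perfect t n l), sliceF t n p i C.1 = some D.1 ∧
      toPerfect t l (rawF t i b.1) = some b' ∧ cnt t n p D.1 = labMult t l b'.1 := by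
  have hP := two_le_period hn
  have hspec := sliceF_spec hn hi (isSlice_iff.1 C.2).1 (fun j => hP.trans (hC j))
    (fun hd => by
      -- For two-block colors p and s are the same label, so one parity statement serves both
      -- operators.
      rw [(labMoves_double hn hd).1, h]
      exact even_of_isDouble hn hd (special_labMult b.2))
  rw [h, ← canF_labMult hn hi b.2] at hspec
  rcases hspec with ⟨h1, h2⟩ | ⟨h1, D, h2, h3, h4⟩
  · exact Or.inl ⟨h2, dif_neg h1⟩
  · rw [← labMult_rawF hn hi b.2 h1] at h4
    exact Or.inr ⟨⟨D, slice_of_chain hn h1 h3 h4⟩, ⟨_, h1⟩, h2, dif_pos h1, h4⟩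

end operators

theorem oldEps_nonneg {t : AffineType} {n l : ℕ} {b : Coord n} (hb : b.Mem t l) (i : ℕ) :
    0 ≤ oldEps t l i b := by
  rw [Coord.mem_iff] at hb
  obtain ⟨hx, hxb, h0, hs⟩ := hb
  have h1 := hx i
  have h2 := hxb i
  have h3 := hx 0
  have h4 := hx 1
  have h5 := hxb n
  cases t <;> simp only [Coord.ShapeX] at hs <;>
    simp only [oldEps_A1, oldEps_B1, oldEps_C1, oldEps_A2odd, oldEps_A2even, oldEps_D2, pos] <;>
    (try split_ifs) <;> omega

theorem oldPhi_nonneg {t : AffineType} {n l : ℕ} {b : Coord n} (hb : b.Mem t l) (i : ℕ) :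
    0 ≤ oldPhi t l i b := by
  rw [Coord.mem_iff] at hb
  obtain ⟨hx, hxb, h0, hs⟩ := hb
  have h0' := hx ((i + n) % (n + 1))
  have h1 := hx i
  have h2 := hxb 1
  have h3 := hx 0
  have h5 := hx n
  cases t <;> simp only [Coord.ShapeX] at hs <;>
    simp only [oldPhi_A1, oldPhi_B1, oldPhi_C1, oldPhi_A2odd, oldPhi_A2even, oldPhi_D2, pos] <;>
    (try split_ifs) <;> omega

section maxIterate
variable {t : AffineType} {n : ℕ} (hn : minRank t ≤ n) {l : ℕ} (b : Perfect t n l)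
  (i : Fin (n + 1))
include hn

/-- By `mem_rawE` and the crystal axioms, ε_i vanishes where ẽ_i does and drops by one along it. -/
theorem maxIterate_perfect_e :
    (maxIterate ((perfectCrystal t n l).e i) b : ℤ) = oldEps t l i b.1 := by
  have hi : i.val ≤ n := Nat.lt_succ_iff.1 i.isLt
  rw [maxIterate_eq (N := fun b => (oldEps t l i b.1).toNat),
      Int.toNat_of_nonneg (oldEps_nonneg b.2 i)]
  · intro b hb
    have h1 := toPerfect_eq_none.1 hb
    rw [mem_rawE hn hi b.2] at h1
    change (oldEps t l i b.1).toNat = 0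
    omega
  · intro b b' hb
    have h1 := (isCrystal_perfect l hn).eps_e i b b' hb
    have h2 : oldEps t l i b.1 = oldEps t l i b'.1 + 1 := by
      simp only [perfectCrystal] at h1
      exact_mod_cast h1
    have h3 := oldEps_nonneg b'.2 i
    change (oldEps t l i b.1).toNat = (oldEps t l i b'.1).toNat + 1
    omega

theorem maxIterate_perfect_f :
    (maxIterate ((perfectCrystal t n l).f i) b : ℤ) = oldPhi t l i b.1 := by
  have hi : i.val ≤ n := Nat.lt_succ_iff.1 i.isLt
  rw [maxIterate_eq (N := fun b => (oldPhi t l i b.1).toNat),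
      Int.toNat_of_nonneg (oldPhi_nonneg b.2 i)]
  · intro b hb
    have h1 := toPerfect_eq_none.1 hb
    rw [mem_rawF hn hi b.2] at h1
    change (oldPhi t l i b.1).toNat = 0
    omega
  · intro b b' hb
    have h1 := (isCrystal_perfect l hn).phi_f i b b' hb
    have h2 : oldPhi t l i b.1 = oldPhi t l i b'.1 + 1 := by
      simp only [perfectCrystal] at h1
      exact_mod_cast h1
    have h3 := oldPhi_nonneg b'.2 i
    change (oldPhi t l i b.1).toNat = (oldPhi t l i b'.1).toNat + 1
    omega

end maxIterate

end YoungSlice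

theorem theorem3p7 (t : YoungSlice.AffineType) (n : ℕ) (hn : YoungSlice.minRank t ≤ n)
    (l : ℕ) (hl : 0 < l) (p : YoungSlice.Pattern t n) :
    -- both sides are crystals; the operators on classes are the ones induced from slices
    YoungSlice.IsCrystal (YoungSlice.cartan t n) (YoungSlice.perfectCrystal t n l) ∧
    (∀ i : Fin (n + 1),
      YoungSlice.InducedBy (YoungSlice.sliceE t n p i) ((YoungSlice.sliceCrystal t n p l).e i) ∧
      YoungSlice.InducedBy (YoungSlice.sliceF t n p i) ((YoungSlice.sliceCrystal t n p l).f i)) ∧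
    YoungSlice.IsCrystal (YoungSlice.cartan t n) (YoungSlice.sliceCrystal t n p l) ∧
    -- the canonical map is well defined and an isomorphism of crystals
    ∃ ψ : YoungSlice.Perfect t n l → YoungSlice.SliceClass t n p l,
      (∀ b, ∃ C : YoungSlice.Slice t n p l, YoungSlice.Pastes b C) ∧
      (∀ b (C : YoungSlice.Slice t n p l), YoungSlice.Pastes b C → ψ b = Quotient.mk _ C) ∧
      YoungSlice.IsCrystalIso (YoungSlice.perfectCrystal t n l)
        (YoungSlice.sliceCrystal t n p l) ψ := by
  open YoungSlice in
  obtain ⟨ψ, hψ⟩ := exists_canonicalMap hn p l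
  have hE := fun i : Fin (n + 1) => classOp_canonicalMap hn hψ
    (sliceE_toPerfect hn (Nat.lt_succ_iff.1 i.isLt))
  have hF := fun i : Fin (n + 1) => classOp_canonicalMap hn hψ
    (sliceF_toPerfect hn (Nat.lt_succ_iff.1 i.isLt))
  have heps : ∀ (i : Fin (n + 1)) b,
      (maxIterate (classOp (sliceE t n p i)) (ψ b) : ℤ) = oldEps t l i b.1 := fun i b => by
    rw [maxIterate_map (hE i).1, ← maxIterate_perfect_e hn]; rfl
  have hphi : ∀ (i : Fin (n + 1)) b,
      (maxIterate (classOp (sliceF t n p i)) (ψ b) : ℤ) = oldPhi t l i b.1 := fun i b => by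
    rw [maxIterate_map (hF i).1, ← maxIterate_perfect_f hn]; rfl
  -- On classes ε_i, φ_i and the weight are defined by string lengths, which the bijection preserves
  -- as it intertwines the operators. The crystal axioms for classes are then transported along it.
  have hiso : IsCrystalIso (perfectCrystal t n l) (sliceCrystal t n p l) ψ :=
    { bijective := canonicalMap_bijective hn hψ
      wt := fun b => funext fun i => by simp only [sliceCrystal, perfectCrystal, heps, hphi]
      eps := fun i b => by simp only [sliceCrystal, perfectCrystal, heps]
      phi := fun i b => by simp only [sliceCrystal, perfectCrystal, hphi]
      e := fun i b => (hE i).1 b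
      f := fun i b => (hF i).1 b }
  refine ⟨isCrystal_perfect l hn, fun i => ⟨(hE i).2, (hF i).2⟩,
    (isCrystal_perfect l hn).of_iso hiso, ψ, fun b => ?_, fun b C hC => ?_, hiso⟩
  · obtain ⟨C, hC, hCb, -⟩ := hψ b
    exact ⟨C, pastes_of_cnt hn hC hCb⟩
  · exact (canonicalMap_eq_iff hn hψ).2 (cnt_of_pastes hn hC)
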